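/- **Conventions.** $\lambda$ is the security parameter. A function $\mu$ is negligible if $\lambda^{c}\mu(\lambda)\to 0$ for every $c\in\mathbb N$; a function $f:\mathbb N\to\mathbb N$ is polynomially bounded if $f(\lambda)<\lambda^{c}$ for some constant $c$ and all large $\lambda$. PPT and QPT algorithms are (non-uniform) families, indexed by $\lambda$, of randomized classical circuits, respectively quantum circuits (over $H$, $T$, $\mathrm{CNOT}$, with standard-basis measurements, classical gates and coins, and classical control), of polynomially bounded size. In an interactive protocol a sender and a receiver alternately apply such circuits, the total size being polynomially bounded, and exchange only classical messages. Write $|{+_\theta}\rangle=\frac1{\sqrt2}(|0\rangle+e^{i\theta}|1\rangle)$. Suppose that for every $\lambda$ and $b,s\in\{0,1\}$ a single-qubit unit vector $|v^{\lambda}_{b,s}\rangle$ is given. An *oblivious state preparation protocol for the states $v$* is a protocol $(s,|\psi\rangle)\leftarrow\langle S(1^\lambda,b),R(1^\lambda)\rangle$ between a classical PPT sender $S$ with input $b\in\{0,1\}$ and output $s\in\{0,1\}$ and a QPT receiver $R$ with a one-qubit output $|\psi\rangle$ such that: * (Correctness) for each $b\in\{0,1\}$, with $\Pi_b=\sum_{s\in\{0,1\}}|s\rangle\langle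 s|\otimes|v^{\lambda}_{b,s}\rangle\langle v^{\lambda}_{b,s}|$, the quantity $1-\mathbb E\big[\,\|\Pi_b|s\rangle|\psi\rangle\|\,\big]$ is negligible in $\lambda$ (if the receiver has further qubits, $\Pi_b$ is applied to the output qubit of the joint state); * (Security) for every QPT receiver $\mathsf{Adv}=\{\mathsf{Adv}_\lambda\}$ that outputs a bit $b_{\mathsf{Adv}}$, the quantity $\big|\Pr[b_{\mathsf{Adv}}=0\mid b=0]-\Pr[b_{\mathsf{Adv}}=0\mid b=1]\big|$ for the interaction $\langle S(1^\lambda,b),\mathsf{Adv}_\lambda\rangle$ is negligible in $\lambda$. *OSP* is the case $|v^\lambda_{b,s}\rangle=H^b|s\rangle$. For $\epsilon:\mathbb N\to(0,1]$ (in particular for a constant $\epsilon\in(0,1]$), *$\epsilon$-OSP* is the case $|v^\lambda_{b,s}\rangle=Z^s|{+_{b\,\epsilon(\lambda)\pi/2}}\rangle$. **Claim.** 1. Let $\epsilon\in(0,1]$ be a constant that can be written as $\epsilon=c/d$ with integers $c,d$ and $c$ odd. If an $\epsilon$-OSP protocol exists, then an OSP protocol exists. 2. In particular, for every constant integer $n\ge1$,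 if a $(1/n)$-OSP protocol exists, then an OSP protocol exists. 3. More generally, the same holds when the angle depends on the security parameter and is only inverse-polynomially large: let $\epsilon(\lambda)=c(\lambda)/d(\lambda)$ with positive integers $c(\lambda)\le d(\lambda)$, where $c(\lambda)$ is odd for every $\lambda$ and $d$ is polynomially bounded (for instance $\epsilon=1/p(\lambda)$ with $p$ positive-integer-valued and polynomially bounded). If an $\epsilon$-OSP protocol exists, then an OSP protocol exists. -/

import Mathlib

open scoped BigOperators

noncomputable section

namespace OSP

/-! ### Asymptotics -/

/-- Negligible functions of the security parameter: `n ^ c * f n → 0` for every `c`. -/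
def Negligible (f : ℕ → ℝ) : Prop :=
  Asymptotics.SuperpolynomialDecay Filter.atTop (fun n : ℕ => (n : ℝ)) f

/-- Polynomially bounded functions of the security parameter. -/
def PolyBounded (f : ℕ → ℕ) : Prop :=
  ∃ c N : ℕ, ∀ n > N, f n < n ^ c

/-! ### Gates and circuits

A circuit is a list of gates, its size is the number of gates. Classical wires carry bits and are
indexed by a type `W`, quantum wires carry qubits and are indexed by a finite type `Q`. -/

/-- Gates of randomized classical circuits. -/
inductive BitGate (W : Type) : Type
  /-- `w := v` -/
  | set (w : W) (v : Bool)
  /-- `w := ¬ (u ∧ v)` -/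
  | nand (u v w : W)
  /-- `w :=` a fresh uniformly random bit -/
  | coin (w : W)

/-- The universal set of unitary gates `H`, `T`, `CNOT` (`cnot p q` has control `p`, target `q`). -/
inductive QubitGate (Q : Type) : Type
  | hadamard (q : Q)
  | tGate (q : Q)
  | cnot (p q : Q) (h : p ≠ q)

/-- Gates of quantum circuits with classical wires. -/
inductive Instr (W Q : Type) : Type
  /-- a classical gate -/
  | bit (g : BitGate W)
  /-- a unitary gate -/
  | gate (u : QubitGate Q)
  /-- a unitary gate that is applied if and only if the bit `w` is `1` -/
  | gateIf (w : W) (u : QubitGate Q)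
  /-- measurement of the qubit `q` in the standard basis, with the outcome stored in `w` -/
  | measure (q : Q) (w : W)

/-- Renaming of the classical wires of a gate. -/
def BitGate.map {W W' : Type} (f : W → W') : BitGate W → BitGate W'
  | .set w v => .set (f w) v
  | .nand u v w => .nand (f u) (f v) (f w)
  | .coin w => .coin (f w)

/-- Renaming of the classical wires of a gate. -/
def Instr.map {W W' Q : Type} (f : W → W') : Instr W Q → Instr W' Q
  | .bit g => .bit (g.map f)
  | .gate u => .gate u
  | .gateIf w u => .gateIf (f w) u
  | .measure q w => .measure q (f w)

/-! ### Semantics -/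

/-- Amplitudes, in the standard basis, of a (not necessarily normalized) state of the qubits `Q`. -/
abbrev Amp (Q : Type) : Type := (Q → Bool) → ℂ

/-- The squared norm of a state vector. -/
def normSq {Q : Type} [Fintype Q] [DecidableEq Q] (ψ : Amp Q) : ℝ :=
  ∑ x : Q → Bool, ‖ψ x‖ ^ 2

/-- The norm of a state vector. -/
def stateNorm {Q : Type} [Fintype Q] [DecidableEq Q] (ψ : Amp Q) : ℝ :=
  Real.sqrt (normSq ψ)

/-- The sign `(-1) ^ v`. -/
def sgn (v : Bool) : ℂ := if v then -1 else 1

/-- The action of a unitary gate on state vectors. -/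
def QubitGate.apply {Q : Type} [DecidableEq Q] : QubitGate Q → Amp Q → Amp Q
  | .hadamard q, ψ => fun x =>
      (ψ (Function.update x q false) + sgn (x q) * ψ (Function.update x q true)) / (Real.sqrt 2 : ℂ)
  | .tGate q, ψ => fun x =>
      (if x q then Complex.exp (Complex.I * (Real.pi / 4 : ℝ)) else 1) * ψ x
  | .cnot p q _, ψ => fun x => ψ (Function.update x q (xor (x p) (x q)))

/-- One branch of a probabilistic execution: the values of all the classical wires, and the state
of the qubits multiplied by the square root of the probability of the branch. Thus a branch
`(store, amp)` occurs with probability `normSq amp`, and then the qubits are in the pure state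
`amp / stateNorm amp`. -/
structure Branch (W Q : Type) : Type where
  store : W → Bool
  amp : Amp Q

/-- Execution of a classical gate: the list of the possible branches. -/
def BitGate.step {W Q : Type} [DecidableEq W] : BitGate W → Branch W Q → List (Branch W Q)
  | .set w v, β => [⟨Function.update β.store w v, β.amp⟩]
  | .nand u v w, β => [⟨Function.update β.store w (!(β.store u && β.store v)), β.amp⟩]
  | .coin w, β => [false, true].map fun o =>
      ⟨Function.update β.store w o, fun x => β.amp x / (Real.sqrt 2 : ℂ)⟩

/-- Execution of a gate: the list of the possible branches. -/
def Instr.step {W Q : Type} [DecidableEq W] [DecidableEq Q] :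
    Instr W Q → Branch W Q → List (Branch W Q)
  | .bit g, β => g.step β
  | .gate u, β => [⟨β.store, u.apply β.amp⟩]
  | .gateIf w u, β => [⟨β.store, if β.store w then u.apply β.amp else β.amp⟩]
  | .measure q w, β => [false, true].map fun o =>
      ⟨Function.update β.store w o, fun x => if x q = o then β.amp x else 0⟩

/-- Execution of a circuit: the list of the possible branches. -/
def exec {W Q : Type} [DecidableEq W] [DecidableEq Q] :
    List (Instr W Q) → Branch W Q → List (Branch W Q)
  | [], β => [β]
  | i :: c, β => (i.step β).flatMap (exec c)

/-! ### Interaction between a classical sender and a quantum receiver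

The parties share a register `M` of classical message wires and take turns, the sender moving
first. In each of its turns a party applies a circuit to its private wires and to the message
register: it reads the last message there and writes its reply. -/

/-- A classical interactive circuit with an input bit and an output bit. -/
structure Sender (M : Type) : Type 1 where
  Bits : Type
  [decBits : DecidableEq Bits]
  inp : Bits
  out : Bits
  turns : List (List (BitGate (Bits ⊕ M)))

/-- A quantum interactive circuit which sends and receives classical messages. -/
structure Receiver (M : Type) : Type 1 where
  Bits : Type
  [decBits : DecidableEq Bits]
  Qubits : Type
  [decQubits : DecidableEq Qubits]
  [finQubits : Fintype Qubits]
  turns : List (List (Instr (Bits ⊕ M) Qubits))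

/-- A receiver that outputs one of its qubits. -/
structure QubitReceiver (M : Type) : Type 1 extends Receiver M where
  out : Qubits

/-- A receiver that outputs a bit. -/
structure Adversary (M : Type) : Type 1 extends Receiver M where
  guess : Bits

attribute [instance] Sender.decBits Receiver.decBits Receiver.decQubits Receiver.finQubits

/-- The size of an interactive circuit: the number of its gates plus the number of its turns. -/
def turnsSize {I : Type} (t : List (List I)) : ℕ := (t.map fun c => c.length + 1).sum

/-- The gates of both parties in the order in which they are executed. -/
def interleave {I : Type} : List (List I) → List (List I) → List I
  | [], rs => rs.flatten
  | ss, [] => ss.flatten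
  | s :: ss, r :: rs => s ++ (r ++ interleave ss rs)

/-- The classical wires of a sender and a receiver together: the sender's bits, the messages,
and the receiver's bits. -/
abbrev JointBits {M : Type} (S : Sender M) (R : Receiver M) : Type := S.Bits ⊕ (M ⊕ R.Bits)

/-- The sender's gates as gates of the joint system. -/
def senderTurns {M : Type} (S : Sender M) (R : Receiver M) :
    List (List (Instr (JointBits S R) R.Qubits)) :=
  S.turns.map fun c => c.map fun g =>
    Instr.bit (g.map (Sum.elim Sum.inl (fun m => Sum.inr (Sum.inl m))))

/-- The receiver's gates as gates of the joint system. -/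
def receiverTurns {M : Type} (S : Sender M) (R : Receiver M) :
    List (List (Instr (JointBits S R) R.Qubits)) :=
  R.turns.map fun c => c.map fun i =>
    i.map (Sum.elim (fun w => Sum.inr (Sum.inr w)) (fun m => Sum.inr (Sum.inl m)))

/-- The initial branch: the sender's input wire carries `b`, all other bits are `0`, and all
qubits are in the state `|0⟩`. -/
def initBranch {M : Type} [DecidableEq M] (S : Sender M) (R : Receiver M) (b : Bool) :
    Branch (JointBits S R) R.Qubits where
  store := Function.update (fun _ => false) (Sum.inl S.inp) b
  amp := fun x => if x = fun _ => false then 1 else 0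

/-- The possible branches of the interaction of `S`, on input `b`, with `R`. -/
def run {M : Type} [DecidableEq M] (S : Sender M) (R : Receiver M) (b : Bool) :
    List (Branch (JointBits S R) R.Qubits) :=
  exec (interleave (senderTurns S R) (receiverTurns S R)) (initBranch S R b)

/-! ### Single-qubit states and projections -/

/-- A vector in the state space of one qubit. -/
abbrev Ket : Type := Bool → ℂ

/-- The standard basis state `|s⟩`. -/
def basisKet (s : Bool) : Ket := fun y => if y = s then 1 else 0

/-- `H |v⟩`. -/
def hadamardKet (v : Ket) : Ket := fun y => (v false + sgn y * v true) / (Real.sqrt 2 : ℂ)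

/-- `Z |v⟩`. -/
def zKet (v : Ket) : Ket := fun y => sgn y * v y

/-- `|+_θ⟩ = (|0⟩ + e^{iθ} |1⟩) / √2`. -/
def plusKet (θ : ℝ) : Ket := fun y =>
  (if y then Complex.exp (Complex.I * (θ : ℂ)) else 1) / (Real.sqrt 2 : ℂ)

/-- `H ^ b |s⟩`. -/
def stdKet (b s : Bool) : Ket := if b then hadamardKet (basisKet s) else basisKet s

/-- `Z ^ s |+_{b ε π / 2}⟩`. -/
def angleKet (ε : ℝ) (b s : Bool) : Ket :=
  let v := plusKet (if b then ε * Real.pi / 2 else 0)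
  if s then zKet v else v

/-- The operator `|v⟩⟨v|` acting on the qubit `q`, tensored with the identity on the others. -/
def projOn {Q : Type} [DecidableEq Q] (q : Q) (v : Ket) (ψ : Amp Q) : Amp Q := fun x =>
  v (x q) * ∑ y : Bool, star (v y) * ψ (Function.update x q y)

/-! ### Protocols -/

/-- The expectation of `‖Π |s⟩|ψ⟩‖` over the sender's output `s` and the receiver's final state
`|ψ⟩`, where `Π = ∑ s, |s⟩⟨s| ⊗ |v s⟩⟨v s|` acts on the sender's output bit and the receiver's
output qubit. A branch `φ` contributes `‖φ‖² * ‖Π (φ / ‖φ‖)‖ = ‖φ‖ * ‖Π φ‖`. -/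
def correctness {M : Type} [DecidableEq M] (S : Sender M) (R : QubitReceiver M) (b : Bool)
    (v : Bool → Ket) : ℝ :=
  ((run S R.toReceiver b).map fun β =>
    stateNorm β.amp * stateNorm (projOn R.out (v (β.store (Sum.inl S.out))) β.amp)).sum

/-- The probability that the adversary outputs `0` in the interaction with `S` on input `b`. -/
def probGuessZero {M : Type} [DecidableEq M] (S : Sender M) (A : Adversary M) (b : Bool) : ℝ :=
  ((run S A.toReceiver b).map fun β =>
    if β.store (Sum.inr (Sum.inr A.guess)) = false then normSq β.amp else 0).sum

/-- A protocol between a probabilistic polynomial-size sender with an input bit and an output bit,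
and a quantum polynomial-size receiver that outputs a qubit. -/
structure Protocol : Type 1 where
  Msg : ℕ → Type
  [decMsg : ∀ n, DecidableEq (Msg n)]
  sender : ∀ n, Sender (Msg n)
  receiver : ∀ n, QubitReceiver (Msg n)
  sender_poly : PolyBounded fun n => turnsSize (sender n).turns
  receiver_poly : PolyBounded fun n => turnsSize (receiver n).turns

attribute [instance] Protocol.decMsg

/-- Correctness with respect to the target states `v n b s`: for each input `b`, except with
negligible error, the receiver ends up with `v n b s`, where `s` is the sender's output. -/
def Protocol.Correct (P : Protocol) (v : ℕ → Bool → Bool → Ket) : Prop :=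
  ∀ b : Bool, Negligible fun n => 1 - correctness (P.sender n) (P.receiver n) b (v n b)

/-- Security: no polynomial-size quantum adversary distinguishes the sender's two inputs. -/
def Protocol.Secure (P : Protocol) : Prop :=
  ∀ A : ∀ n, Adversary (P.Msg n), PolyBounded (fun n => turnsSize (A n).turns) →
    Negligible fun n =>
      |probGuessZero (P.sender n) (A n) false - probGuessZero (P.sender n) (A n) true|

/-- Oblivious state preparation, with target states `H ^ b |s⟩`. -/
def Protocol.IsOSP (P : Protocol) : Prop :=
  P.Correct (fun _ b s => stdKet b s) ∧ P.Secure

/-- `ε`-OSP, with target states `Z ^ s |+_{b ε π / 2}⟩`; `ε` may depend on the security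
parameter. -/
def Protocol.IsEpsOSP (P : Protocol) (ε : ℕ → ℝ) : Prop :=
  P.Correct (fun n b s => angleKet (ε n) b s) ∧ P.Secure

end OSP

end

open scoped BigOperators
set_option linter.unusedSectionVars false

noncomputable section

namespace OSP

/-! ### Expectations over the branches of a circuit -/

section Basics

variable {W Q : Type} [DecidableEq W] [DecidableEq Q]

/-! Run `m + 1` independent sessions of the given protocol in parallel, all with the same input `b`.
Put `w = exp(i b ε π / 2)`. Ideally, session `j` leaves the receiver with `|0⟩ + (-1)^(s_j) w |1⟩`
and the sender with `s_j`. The receiver prepares an accumulator in `|+⟩`, applies a CNOT from it to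
the next session qubit and measures that qubit. Up to normalization, an accumulator `|0⟩ + α |1⟩`
meeting `|0⟩ + z |1⟩` becomes `|0⟩ + α z |1⟩` or `|0⟩ + α z⁻¹ |1⟩`, each with probability 1/2
(`Phase.cnot_restrictTo`, `normSq_cnot_restrictTo`). Apart from signs, the exponent of `w` therefore
performs a simple random walk on the integers, which is stopped at `±d`. With `ε = c / d` and `c`
odd, `w ^ (±d)` is `±i` when `b = 1` and `1` when `b = 0` (`exists_angle_zpow`), so the accumulator
ends as `|0⟩ ± |1⟩` or `|0⟩ ± i |1⟩` according to `b`. The gates `H`, `T`, `T` turn this into `H^b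
|s⟩` (`rotate_eq`).

The receiver does not know `s`, but the history of the walk, which does not depend on secrets, is
written on message wires. From it the sender computes `s` as a sum modulo 2 of products of a private
bit (`s_j` or `b`) with a public bit: the `s_j` used before absorption, and a correction by `b` if
the walk stopped at the wrong end (`charge`, `prod_signPairs`).

The potential `(2 d² - k²) / d²` contracts by the factor `1 - 1 / (2 d²)` on average
(`potential_move_add`), so `2 d² n + 1` steps leave the walk unabsorbed with probability at most `2
exp(-n)` (`val_walk_le`). This is a polynomial number of sessions when `d` is polynomially bounded.

For correctness with imperfect sessions, all error measures are kept as nonnegative quadratic forms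
in the amplitudes (`IsQuad`). Such forms are preserved when pulled back through circuits, and gates
outside a subsystem do not change them (`Restricts.val_eq`). Hence each session has the same error
as if run alone. Projecting all session qubits on their ideal states costs at most the sum of these
errors (`normSq_sub_projAll_le`), and the projected state is handled by `val_combine_le`; the result
is `one_sub_correctness_copies_le`.

For security, the sender's final computation touches only private wires and the walk history goes
from receiver to sender, so the adversary sees exactly `m + 1` parallel sessions. A hybrid argument
changes their inputs one at a time, and an adversary against one session simulates the senders of
the others (`probGuessZero_reduction`, `exists_reduction`). Both halves meet in `exists_isOSP`. -/

/-- The sum of `F` over the final branches of the circuit `c` started in `β`. -/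
def val (c : List (Instr W Q)) (F : Branch W Q → ℝ) (β : Branch W Q) : ℝ :=
  ((exec c β).map F).sum

@[simp] theorem val_nil (F : Branch W Q → ℝ) : val [] F = F := by
  funext β; simp [val, exec]

theorem val_cons (i : Instr W Q) (c : List (Instr W Q)) (F : Branch W Q → ℝ) (β : Branch W Q) :
    val (i :: c) F β = ((i.step β).map (val c F)).sum := by
  simp only [val, exec, List.map_flatMap]
  induction i.step β with
  | nil => simp
  | cons a l ih => simp [ih, val]

theorem exec_append (c c' : List (Instr W Q)) (β : Branch W Q) :
    exec (c ++ c') β = (exec c β).flatMap (exec c') := by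
  induction c generalizing β with
  | nil => simp [exec]
  | cons i c ih =>
    simp only [List.cons_append, exec, List.flatMap_assoc]
    congr 1; funext γ; exact ih γ

/-- This is the Heisenberg picture: circuits act backwards on functionals of branches, which lets a
tail of the circuit be absorbed into the functional. -/
theorem val_append (c c' : List (Instr W Q)) (F : Branch W Q → ℝ) :
    val (c ++ c') F = val c (val c' F) := by
  induction c with
  | nil => simp
  | cons i c ih => funext β; simp only [List.cons_append, val_cons, ih]

theorem val_of_exec_eq {c : List (Instr W Q)} {β γ : Branch W Q} (h : exec c β = [γ])
    (F : Branch W Q → ℝ) : val c F β = F γ := by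
  simp [val, h]

theorem val_mono_on (c : List (Instr W Q)) {F G : Branch W Q → ℝ} {β : Branch W Q}
    (h : ∀ γ ∈ exec c β, F γ ≤ G γ) : val c F β ≤ val c G β :=
  List.sum_le_sum h

theorem val_mono (c : List (Instr W Q)) {F G : Branch W Q → ℝ} (h : ∀ γ, F γ ≤ G γ)
    (β : Branch W Q) : val c F β ≤ val c G β :=
  val_mono_on c fun γ _ => h γ

theorem val_add (c : List (Instr W Q)) (F G : Branch W Q → ℝ) (β : Branch W Q) :
    val c (fun γ => F γ + G γ) β = val c F β + val c G β := by
  simp [val, List.sum_map_add]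

theorem val_const_mul (c : List (Instr W Q)) (r : ℝ) (F : Branch W Q → ℝ) (β : Branch W Q) :
    val c (fun γ => r * F γ) β = r * val c F β := by
  simp [val, List.sum_map_mul_left]

theorem val_finset_sum {ι : Type*} (c : List (Instr W Q)) (s : Finset ι)
    (F : ι → Branch W Q → ℝ) (β : Branch W Q) :
    val c (fun γ => ∑ j ∈ s, F j γ) β = ∑ j ∈ s, val c (F j) β := by
  classical
  induction s using Finset.induction_on with
  | empty => simp [val]
  | insert a s ha ih => simp only [Finset.sum_insert ha, val_add, ih]

theorem exec_invariant (I : Branch W Q → Prop) {c : List (Instr W Q)}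
    (h : ∀ i ∈ c, ∀ β, I β → ∀ γ ∈ i.step β, I γ) {β : Branch W Q} (hβ : I β) :
    ∀ γ ∈ exec c β, I γ := by
  induction c generalizing β with
  | nil => simpa [exec] using hβ
  | cons i c ih =>
    intro γ hγ
    simp only [exec, List.mem_flatMap] at hγ
    obtain ⟨δ, hδ, hγ⟩ := hγ
    exact ih (fun j hj => h j (List.mem_cons_of_mem _ hj))
      (h i List.mem_cons_self β hβ δ hδ) γ hγ

end Basics

/-! ### Quadratic functionals of branches -/

section Quadratic

variable {W Q : Type} [DecidableEq W] [DecidableEq Q]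

theorem QubitGate.apply_add (u : QubitGate Q) (a b : Amp Q) :
    u.apply (a + b) = u.apply a + u.apply b := by
  cases u <;> funext x <;> simp only [QubitGate.apply, Pi.add_apply] <;> ring

theorem QubitGate.apply_smul (u : QubitGate Q) (z : ℂ) (a : Amp Q) :
    u.apply (z • a) = z • u.apply a := by
  cases u <;> funext x <;> simp only [QubitGate.apply, Pi.smul_apply, smul_eq_mul] <;> ring

/-- Functionals that are nonnegative quadratic forms in the amplitudes. -/
structure IsQuad (F : Branch W Q → ℝ) : Prop where
  nonneg : ∀ β, 0 ≤ F β
  parallelogram : ∀ s a b, F ⟨s, a + b⟩ + F ⟨s, a - b⟩ = 2 * F ⟨s, a⟩ + 2 * F ⟨s, b⟩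
  smul : ∀ s (z : ℂ) a, F ⟨s, z • a⟩ = ‖z‖ ^ 2 * F ⟨s, a⟩

/-- The parallelogram law with one nonnegative term dropped. It splits a state into its ideal part
and an error part at the cost of a factor 2. -/
theorem IsQuad.add_le {F : Branch W Q → ℝ} (hF : IsQuad F) (s : W → Bool) (a b : Amp Q) :
    F ⟨s, a + b⟩ ≤ 2 * F ⟨s, a⟩ + 2 * F ⟨s, b⟩ := by
  have := hF.parallelogram s a b
  have := hF.nonneg ⟨s, a - b⟩
  linarith

theorem IsQuad.zero {F : Branch W Q → ℝ} (hF : IsQuad F) (s : W → Bool) : F ⟨s, 0⟩ = 0 := by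
  simpa using hF.smul s 0 0

theorem IsQuad.add {F G : Branch W Q → ℝ} (hF : IsQuad F) (hG : IsQuad G) :
    IsQuad fun β => F β + G β where
  nonneg β := add_nonneg (hF.nonneg β) (hG.nonneg β)
  parallelogram s a b := by
    have := hF.parallelogram s a b
    have := hG.parallelogram s a b
    linarith
  smul s z a := by rw [hF.smul, hG.smul]; ring

/-- Precomposition with a transformation that is linear in the amplitudes. -/
theorem IsQuad.comp {W' Q' : Type} {F : Branch W Q → ℝ} (hF : IsQuad F)
    (f : (W' → Bool) → W → Bool)
    (L : (W' → Bool) → Amp Q' →ₗ[ℂ] Amp Q) :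
    IsQuad fun β : Branch W' Q' => F ⟨f β.store, L β.store β.amp⟩ where
  nonneg β := hF.nonneg _
  parallelogram s a b := by simpa using hF.parallelogram (f s) (L s a) (L s b)
  smul s z a := by simpa using hF.smul (f s) z (L s a)

/-- A unitary gate as a linear map. -/
def QubitGate.lin (u : QubitGate Q) : Amp Q →ₗ[ℂ] Amp Q where
  toFun := u.apply
  map_add' := u.apply_add
  map_smul' := u.apply_smul

/-- The restriction of the amplitudes to the basis states in which `q` has the value `o`. -/
def restrictTo (q : Q) (o : Bool) : Amp Q →ₗ[ℂ] Amp Q where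
  toFun a := fun x => if x q = o then a x else 0
  map_add' a b := by funext x; by_cases h : x q = o <;> simp [h]
  map_smul' z a := by funext x; by_cases h : x q = o <;> simp [h]

/-- The amplitudes after a coin flip. -/
def halve : Amp Q →ₗ[ℂ] Amp Q where
  toFun a := fun x => a x / (Real.sqrt 2 : ℂ)
  map_add' a b := by funext x; simp [add_div]
  map_smul' z a := by funext x; simp [mul_div_assoc]

theorem halve_eq (a : Amp Q) : halve a = ((Real.sqrt 2 : ℂ)⁻¹) • a := by
  funext x; simp [halve, div_eq_inv_mul]

theorem IsQuad.halve {F : Branch W Q → ℝ} (hF : IsQuad F) (s : W → Bool) (a : Amp Q) :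
    F ⟨s, fun x => a x / (Real.sqrt 2 : ℂ)⟩ = F ⟨s, a⟩ / 2 := by
  have h : (fun x => a x / (Real.sqrt 2 : ℂ)) = ((Real.sqrt 2 : ℂ)⁻¹) • a := halve_eq a
  rw [h, hF.smul]
  rw [norm_inv, Complex.norm_real, inv_pow, Real.norm_eq_abs, sq_abs,
    Real.sq_sqrt (by norm_num)]
  ring

/-- In every branch of a gate the new store depends only on the old store, and the new amplitudes
depend linearly on the old ones. -/
theorem IsQuad.step {F : Branch W Q → ℝ} (hF : IsQuad F) (i : Instr W Q) :
    IsQuad fun β => ((i.step β).map F).sum := by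
  rcases i with (⟨w, v⟩ | ⟨u, v, w⟩ | ⟨w⟩) | u | ⟨w, u⟩ | ⟨q, w⟩
  · simpa [Instr.step, BitGate.step] using
      hF.comp (fun s => Function.update s w v) (fun _ => LinearMap.id)
  · simpa [Instr.step, BitGate.step] using
      hF.comp (fun s => Function.update s w (!(s u && s v))) (fun _ => LinearMap.id)
  · simp only [Instr.step, BitGate.step, List.map_cons, List.map_nil, List.sum_cons,
      List.sum_nil, add_zero]
    exact (hF.comp (fun s => Function.update s w false) (fun _ => OSP.halve)).add
        (hF.comp (fun s => Function.update s w true) (fun _ => OSP.halve))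
  · simp only [Instr.step, List.map_cons, List.map_nil, List.sum_cons, List.sum_nil, add_zero]
    exact hF.comp (fun s => s) (fun _ => u.lin)
  · have := hF.comp (fun s => s) (fun s => if s w then u.lin else LinearMap.id)
    convert this using 3 with β
    simp only [Instr.step, List.map_cons, List.map_nil, List.sum_cons, List.sum_nil, add_zero]
    cases β.store w <;> rfl
  · simp only [Instr.step, List.map_cons, List.map_nil, List.sum_cons, List.sum_nil, add_zero]
    exact (hF.comp (fun s => Function.update s w false) (fun _ => restrictTo q false)).add
        (hF.comp (fun s => Function.update s w true) (fun _ => restrictTo q true))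

theorem IsQuad.val {F : Branch W Q → ℝ} (hF : IsQuad F) (c : List (Instr W Q)) :
    IsQuad (val c F) := by
  induction c with
  | nil => simpa using hF
  | cons i c ih =>
    have : OSP.val (i :: c) F = fun β => ((i.step β).map (OSP.val c F)).sum :=
      funext fun β => val_cons i c F β
    rw [this]; exact ih.step i

theorem isQuad_normSq [Fintype Q] : IsQuad fun β : Branch W Q => normSq β.amp where
  nonneg β := Finset.sum_nonneg fun _ _ => by positivity
  parallelogram s a b := by
    simp only [normSq, Finset.mul_sum, ← Finset.sum_add_distrib]
    refine Finset.sum_congr rfl fun x _ => ?_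
    have := parallelogram_law_with_norm ℝ (a x) (b x)
    simp only [Pi.add_apply, Pi.sub_apply]
    linarith
  smul s z a := by
    simp only [normSq, Finset.mul_sum]
    refine Finset.sum_congr rfl fun x _ => ?_
    simp [mul_pow]

end Quadratic

/-! ### Subsystems -/

section Subsystem

variable {W Q W' Q' : Type} [DecidableEq W] [DecidableEq Q] [DecidableEq W'] [DecidableEq Q']

/-- Renaming of the qubits of a unitary gate. -/
def QubitGate.ren (g : Q ↪ Q') : QubitGate Q → QubitGate Q'
  | .hadamard q => .hadamard (g q)
  | .tGate q => .tGate (g q)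
  | .cnot p q h => .cnot (g p) (g q) fun e => h (g.injective e)

/-- Renaming of all the wires of a gate. -/
def Instr.ren (f : W → W') (g : Q ↪ Q') : Instr W Q → Instr W' Q'
  | .bit u => .bit (u.map f)
  | .gate u => .gate (u.ren g)
  | .gateIf w u => .gateIf (f w) (u.ren g)
  | .measure q w => .measure (g q) (f w)

theorem Instr.ren_id (i : Instr W Q) : i.ren id (Function.Embedding.refl Q) = i := by
  rcases i with (_ | _ | _) | (_ | _ | _) | ⟨_, (_ | _ | _)⟩ | _ <;> rfl

/-- The amplitudes of the qubits in the range of `g` when the others are in the basis state `y`. -/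
def slice (g : Q ↪ Q') (y : Q' → Bool) (a : Amp Q') : Amp Q := fun x => a (Function.extend g x y)

/-- The part of a branch that belongs to a subsystem, when the qubits outside the subsystem are in
the basis state `y`. -/
def Branch.slice (f : W → W') (g : Q ↪ Q') (y : Q' → Bool) (β : Branch W' Q') : Branch W Q :=
  ⟨β.store ∘ f, OSP.slice g y β.amp⟩

theorem extend_update (g : Q ↪ Q') (x : Q → Bool) (y : Q' → Bool) (q : Q) (v : Bool) :
    Function.update (Function.extend g x y) (g q) v =
      Function.extend g (Function.update x q v) y := by
  funext p
  by_cases hp : ∃ r, g r = p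
  · obtain ⟨r, rfl⟩ := hp
    rw [g.injective.extend_apply]
    by_cases h : r = q
    · subst h; simp
    · rw [Function.update_of_ne (fun e => h (g.injective e)), g.injective.extend_apply,
        Function.update_of_ne h]
  · rw [Function.extend_apply' _ _ _ hp, Function.update_of_ne, Function.extend_apply' _ _ _ hp]
    rintro rfl; exact hp ⟨q, rfl⟩

theorem extend_update_right (g : Q ↪ Q') (x : Q → Bool) (y : Q' → Bool) {q : Q'}
    (hq : ∀ r, g r ≠ q) (v : Bool) :
    Function.update (Function.extend g x y) q v =
      Function.extend g x (Function.update y q v) := by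
  funext p
  by_cases hp : ∃ r, g r = p
  · obtain ⟨r, rfl⟩ := hp
    rw [g.injective.extend_apply, Function.update_of_ne (hq r), g.injective.extend_apply]
  · rw [Function.extend_apply' _ _ _ hp]
    by_cases h : p = q
    · subst h; simp
    · rw [Function.update_of_ne h, Function.update_of_ne h, Function.extend_apply' _ _ _ hp]

theorem slice_apply_ren (g : Q ↪ Q') (y : Q' → Bool) (u : QubitGate Q) (a : Amp Q') :
    slice g y ((u.ren g).apply a) = u.apply (slice g y a) := by
  cases u <;> funext x <;>
    simp [slice, QubitGate.ren, QubitGate.apply, extend_update, g.injective.extend_apply]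

theorem update_comp_injective {f : W → W'} (hf : Function.Injective f) (s : W' → Bool) (w : W)
    (v : Bool) : Function.update s (f w) v ∘ f = Function.update (s ∘ f) w v :=
  Function.update_comp_eq_of_injective s hf w v

theorem update_comp_of_ne {f : W → W'} {w : W'} (hw : ∀ u, f u ≠ w) (s : W' → Bool) (v : Bool) :
    Function.update s w v ∘ f = s ∘ f :=
  Function.update_comp_eq_of_notMem_range s v (by rintro ⟨u, rfl⟩; exact hw u rfl)

theorem step_ren_slice {f : W → W'} (hf : Function.Injective f) (g : Q ↪ Q') (y : Q' → Bool)
    (i : Instr W Q) (β : Branch W' Q') :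
    ((i.ren f g).step β).map (Branch.slice f g y) = i.step (β.slice f g y) := by
  rcases i with (⟨w, v⟩ | ⟨u, v, w⟩ | ⟨w⟩) | u | ⟨w, u⟩ | ⟨q, w⟩
  · simp [Instr.ren, Instr.step, BitGate.step, Branch.slice, BitGate.map,
      update_comp_injective hf]
  · simp [Instr.ren, Instr.step, BitGate.step, Branch.slice, BitGate.map,
      update_comp_injective hf]
  · simp only [Instr.ren, Instr.step, BitGate.step, Branch.slice, BitGate.map, List.map_cons,
      List.map_nil, update_comp_injective hf]
    rfl
  · simp [Instr.ren, Instr.step, Branch.slice, slice_apply_ren]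
  · simp only [Instr.ren, Instr.step, Branch.slice, List.map_cons, List.map_nil,
      Function.comp_apply]
    by_cases h : β.store (f w) <;> simp [h, slice_apply_ren]
  · have : ∀ o, (OSP.slice g y fun x => if x (g q) = o then β.amp x else 0) =
        fun x => if x q = o then OSP.slice g y β.amp x else 0 := by
      intro o; funext x; simp [OSP.slice, g.injective.extend_apply]
    simp only [Instr.ren, Instr.step, Branch.slice, List.map_cons, List.map_nil,
      update_comp_injective hf, this]

variable [Fintype Q']

theorem sum_flip (q : Q') (h : (Q' → Bool) → ℝ) :
    ∑ y, h (Function.update y q (!y q)) = ∑ y, h y := by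
  have hi : Function.Involutive fun y : Q' → Bool => Function.update y q (!y q) := by
    intro y; simp
  exact (Equiv.sum_comp hi.toPerm h)

theorem sum_cnot {p q : Q'} (hpq : p ≠ q) (h : (Q' → Bool) → ℝ) :
    ∑ y, h (Function.update y q (xor (y p) (y q))) = ∑ y, h y := by
  have hi : Function.Involutive fun y : Q' → Bool => Function.update y q (xor (y p) (y q)) := by
    intro y; simp [hpq]
  exact (Equiv.sum_comp hi.toPerm h)

theorem sum_update_add (q : Q') (h : (Q' → Bool) → ℝ) :
    ∑ y, (h (Function.update y q false) + h (Function.update y q true)) = 2 * ∑ y, h y := by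
  have : ∀ y : Q' → Bool, h (Function.update y q false) + h (Function.update y q true) =
      h y + h (Function.update y q (!y q)) := by
    intro y
    rcases hy : y q with _ | _
    · have : Function.update y q false = y := by rw [← hy]; simp
      rw [this]; simp
    · have : Function.update y q true = y := by rw [← hy]; simp
      rw [this]; simp [add_comm]
  rw [Finset.sum_congr rfl fun y _ => this y, Finset.sum_add_distrib, sum_flip]
  ring

/-- Summing over slices plays the role of a partial trace. A Hadamard outside the subsystem replaces
a pair of slices `a`, `b` by `(a ± b) / √2`, which the parallelogram law makes invisible; `T`
multiplies slices by unit scalars; CNOT permutes them. -/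
theorem sum_slice_apply_of_disjoint {F : Branch W Q → ℝ} (hF : IsQuad F) (s : W → Bool)
    (g : Q ↪ Q') {Q₂ : Type} (g₂ : Q₂ ↪ Q') (hg : ∀ a b, g a ≠ g₂ b) (u : QubitGate Q₂)
    (a : Amp Q') :
    ∑ y, F ⟨s, slice g y ((u.ren g₂).apply a)⟩ = ∑ y, F ⟨s, slice g y a⟩ := by
  have hval : ∀ q (x : Q → Bool) (y : Q' → Bool), Function.extend g x y (g₂ q) = y (g₂ q) := by
    intro q x y
    exact Function.extend_apply' _ _ _ (by rintro ⟨r, hr⟩; exact hg r q hr)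
  rcases u with q | q | ⟨p, q, h⟩
  · set h : (Q' → Bool) → ℝ := fun y => F ⟨s, slice g y a⟩ with hh
    have h2 := sum_update_add (g₂ q) fun y => F ⟨s, slice g y (((QubitGate.hadamard q).ren g₂).apply a)⟩
    have h3 := sum_update_add (g₂ q) h
    have key : ∀ y : Q' → Bool,
        F ⟨s, slice g (Function.update y (g₂ q) false) (((QubitGate.hadamard q).ren g₂).apply a)⟩ +
        F ⟨s, slice g (Function.update y (g₂ q) true) (((QubitGate.hadamard q).ren g₂).apply a)⟩ =
        h (Function.update y (g₂ q) false) + h (Function.update y (g₂ q) true) := by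
      intro y
      have e0 : slice g (Function.update y (g₂ q) false)
          (((QubitGate.hadamard q).ren g₂).apply a) = fun x =>
            (slice g (Function.update y (g₂ q) false) a +
              slice g (Function.update y (g₂ q) true) a) x / (Real.sqrt 2 : ℂ) := by
        funext x
        simp [slice, QubitGate.ren, QubitGate.apply,
          extend_update_right g _ _ (fun r => hg r q), hval, sgn]
      have e1 : slice g (Function.update y (g₂ q) true)
          (((QubitGate.hadamard q).ren g₂).apply a) = fun x =>
            (slice g (Function.update y (g₂ q) false) a -
              slice g (Function.update y (g₂ q) true) a) x / (Real.sqrt 2 : ℂ) := by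
        funext x
        simp [slice, QubitGate.ren, QubitGate.apply,
          extend_update_right g _ _ (fun r => hg r q), hval, sgn, sub_eq_add_neg]
      rw [e0, e1, hF.halve, hF.halve]
      have := hF.parallelogram s (slice g (Function.update y (g₂ q) false) a)
        (slice g (Function.update y (g₂ q) true) a)
      simp only [hh]
      linarith
    rw [Finset.sum_congr rfl fun y _ => key y] at h2
    linarith
  · refine Finset.sum_congr rfl fun y _ => ?_
    have : slice g y (((QubitGate.tGate q).ren g₂).apply a) =
        (if y (g₂ q) then Complex.exp (Complex.I * (Real.pi / 4 : ℝ)) else 1) • slice g y a := by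
      funext x
      simp [slice, QubitGate.ren, QubitGate.apply, hval]
    rw [this, hF.smul]
    have : ‖(if y (g₂ q) then Complex.exp (Complex.I * (Real.pi / 4 : ℝ)) else 1 : ℂ)‖ = 1 := by
      split_ifs
      · rw [mul_comm]; exact Complex.norm_exp_ofReal_mul_I _
      · simp
    rw [this]; simp
  · rw [← sum_cnot (fun e => h (g₂.injective e)) fun y => F ⟨s, slice g y a⟩]
    refine Finset.sum_congr rfl fun y _ => ?_
    congr 2
    funext x
    simp [slice, QubitGate.ren, QubitGate.apply, extend_update_right g _ _ (fun r => hg r q), hval]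

/-- Besides unitary gates, an outside coin yields two copies of half weight, and an outside
measurement distributes the slices among the two branches. -/
theorem sum_step_slice_of_disjoint {F : Branch W Q → ℝ} (hF : IsQuad F) (f : W → W') (g : Q ↪ Q')
    {W₂ Q₂ : Type} (f₂ : W₂ → W') (g₂ : Q₂ ↪ Q')
    (hf : ∀ a b, f a ≠ f₂ b) (hg : ∀ a b, g a ≠ g₂ b) (i : Instr W₂ Q₂) (β : Branch W' Q') :
    (((i.ren f₂ g₂).step β).map fun γ => ∑ y, F (γ.slice f g y)).sum =
      ∑ y, F (β.slice f g y) := by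
  have hup : ∀ w (s : W' → Bool) v, Function.update s (f₂ w) v ∘ f = s ∘ f := fun w s v =>
    update_comp_of_ne (fun u => hf u w) s v
  rcases i with (⟨w, v⟩ | ⟨u, v, w⟩ | ⟨w⟩) | u | ⟨w, u⟩ | ⟨q, w⟩
  · simp [Instr.ren, Instr.step, BitGate.step, Branch.slice, BitGate.map, hup]
  · simp [Instr.ren, Instr.step, BitGate.step, Branch.slice, BitGate.map, hup]
  · simp only [Instr.ren, Instr.step, BitGate.step, Branch.slice, BitGate.map, List.map_cons,
      List.map_nil, hup, List.sum_cons, List.sum_nil, add_zero, ← Finset.sum_add_distrib]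
    refine Finset.sum_congr rfl fun y _ => ?_
    have := hF.halve (β.store ∘ f) (OSP.slice g y β.amp)
    have e : (OSP.slice g y fun x => β.amp x / (Real.sqrt 2 : ℂ)) =
      fun x => OSP.slice g y β.amp x / (Real.sqrt 2 : ℂ) := rfl
    rw [e, this]; ring
  · simpa [Instr.ren, Instr.step, Branch.slice] using
      sum_slice_apply_of_disjoint hF _ g g₂ hg u β.amp
  · simp only [Instr.ren, Instr.step, Branch.slice, List.map_cons, List.map_nil,
      List.sum_cons, List.sum_nil, add_zero]
    cases β.store (f₂ w)
    · rfl
    · simpa using sum_slice_apply_of_disjoint hF _ g g₂ hg u β.amp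
  · simp only [Instr.ren, Instr.step, Branch.slice, List.map_cons, List.map_nil, hup,
      List.sum_cons, List.sum_nil, add_zero, ← Finset.sum_add_distrib]
    refine Finset.sum_congr rfl fun y _ => ?_
    have hval : ∀ (x : Q → Bool), Function.extend g x y (g₂ q) = y (g₂ q) := by
      intro x
      exact Function.extend_apply' _ _ _ (by rintro ⟨r, hr⟩; exact hg r q hr)
    have hz := hF.zero (β.store ∘ f)
    have e : ∀ o, (OSP.slice g y fun x => if x (g₂ q) = o then β.amp x else 0) =
        if y (g₂ q) = o then OSP.slice g y β.amp else 0 := by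
      intro o; funext x
      simp only [OSP.slice, hval]
      split_ifs <;> rfl
    simp only [e]
    by_cases h : y (g₂ q) <;> simp [h, hz]

/-- `Restricts f g c' c`: the circuit `c'` consists of the gates of `c`, renamed along `f` and `g`,
and of gates on wires outside the ranges of `f` and `g`. -/
inductive Restricts (f : W → W') (g : Q ↪ Q') :
    List (Instr W' Q') → List (Instr W Q) → Prop
  | nil : Restricts f g [] []
  | keep (i : Instr W Q) {c' c} : Restricts f g c' c → Restricts f g (i.ren f g :: c') (i :: c)
  | drop {W₂ Q₂ : Type} (f₂ : W₂ → W') (g₂ : Q₂ ↪ Q') (hf : ∀ a b, f a ≠ f₂ b)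
      (hg : ∀ a b, g a ≠ g₂ b) (i : Instr W₂ Q₂) {c' c} :
      Restricts f g c' c → Restricts f g (i.ren f₂ g₂ :: c') c

theorem Restricts.append {f : W → W'} {g : Q ↪ Q'} {c₁' c₁ c₂' c₂}
    (h₁ : Restricts f g c₁' c₁) (h₂ : Restricts f g c₂' c₂) :
    Restricts f g (c₁' ++ c₂') (c₁ ++ c₂) := by
  induction h₁ with
  | nil => simpa using h₂
  | keep i _ ih => exact .keep i ih
  | drop f₂ g₂ hf hg i _ ih => exact .drop f₂ g₂ hf hg i ih

theorem Restricts.map_ren (f : W → W') (g : Q ↪ Q') (c : List (Instr W Q)) :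
    Restricts f g (c.map (Instr.ren f g)) c := by
  induction c with
  | nil => exact .nil
  | cons i c ih => exact .keep i ih

theorem Restricts.map_ren_of_disjoint {f : W → W'} {g : Q ↪ Q'} {W₂ Q₂ : Type} {f₂ : W₂ → W'}
    {g₂ : Q₂ ↪ Q'} (hf : ∀ a b, f a ≠ f₂ b) (hg : ∀ a b, g a ≠ g₂ b) (c : List (Instr W₂ Q₂)) :
    Restricts f g (c.map (Instr.ren f₂ g₂)) [] := by
  induction c with
  | nil => exact .nil
  | cons i c ih => exact .drop f₂ g₂ hf hg i ih

theorem list_sum_finset_sum {α ι : Type*} (l : List α) (s : Finset ι) (h : α → ι → ℝ) :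
    (l.map fun a => ∑ y ∈ s, h a y).sum = ∑ y ∈ s, (l.map fun a => h a y).sum := by
  induction l with
  | nil => simp
  | cons a l ih => simp [ih, Finset.sum_add_distrib]

/-- Gates outside of a subsystem do not affect the statistics of the subsystem. -/
theorem Restricts.val_eq {f : W → W'} (hf : Function.Injective f) {g : Q ↪ Q'} {c' c}
    (h : Restricts f g c' c) {F : Branch W Q → ℝ} (hF : IsQuad F) (β : Branch W' Q') :
    val c' (fun γ => ∑ y, F (γ.slice f g y)) β = ∑ y, val c F (β.slice f g y) := by
  induction h generalizing β with
  | nil => simp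
  | keep i _ ih =>
    rw [val_cons, List.map_congr_left fun γ _ => ih γ, list_sum_finset_sum]
    refine Finset.sum_congr rfl fun y _ => ?_
    rw [val_cons, ← step_ren_slice hf, List.map_map]
    rfl
  | drop f₂ g₂ hf' hg i _ ih =>
    rw [val_cons, List.map_congr_left fun γ _ => ih γ]
    exact sum_step_slice_of_disjoint (hF.val _) f g f₂ g₂ hf' hg i β

/-- Conservation of total probability, as the case of the empty subsystem: every gate lies outside
it, and its slices are the individual amplitudes. -/
theorem val_normSq (c : List (Instr W' Q')) (β : Branch W' Q') :
    val c (fun γ => normSq γ.amp) β = normSq β.amp := by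
  have hR : Restricts (Empty.elim : Empty → W') (Function.Embedding.ofIsEmpty : Empty ↪ Q') c
      [] := by
    have := Restricts.map_ren_of_disjoint (f := (Empty.elim : Empty → W'))
      (g := (Function.Embedding.ofIsEmpty : Empty ↪ Q')) (f₂ := id)
      (g₂ := Function.Embedding.refl Q') (fun a => a.elim) (fun a => a.elim) c
    have e : c.map (Instr.ren id (Function.Embedding.refl Q')) = c := by
      conv_rhs => rw [← List.map_id c]
      exact List.map_congr_left fun i _ => i.ren_id
    rwa [e] at this
  have hs : ∀ γ : Branch W' Q', ∑ y, normSq (γ.slice (Empty.elim : Empty → W')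
      (Function.Embedding.ofIsEmpty : Empty ↪ Q') y).amp = normSq γ.amp := by
    intro γ
    refine Finset.sum_congr rfl fun y _ => ?_
    simp only [normSq, Branch.slice, slice, Fintype.sum_unique]
    congr 3
    funext q
    exact Function.extend_apply' _ _ _ (by rintro ⟨r, _⟩; exact r.elim)
  have := hR.val_eq (fun a => a.elim) isQuad_normSq β
  simpa [hs] using this

/-- The index `y` runs over assignments to all of `Q'`, while a slice ignores its values on the
range of `g`; this overcounting gives the factor. -/
theorem sum_normSq_slice [Fintype Q] (g : Q ↪ Q') (a : Amp Q') :
    ∑ y, normSq (slice g y a) = (Fintype.card (Q → Bool) : ℝ) * normSq a := by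
  -- The involution that exchanges `x` with the values of `y` on the range of `g`.
  let e : (Q' → Bool) × (Q → Bool) ≃ (Q' → Bool) × (Q → Bool) :=
    { toFun := fun p => (Function.extend g p.2 p.1, p.1 ∘ g)
      invFun := fun p => (Function.extend g p.2 p.1, p.1 ∘ g)
      left_inv := by
        rintro ⟨y, x⟩
        ext q
        · by_cases hq : ∃ r, g r = q
          · obtain ⟨r, rfl⟩ := hq; simp [g.injective.extend_apply]
          · simp [Function.extend_apply' _ _ _ hq]
        · simp [g.injective.extend_apply]
      right_inv := by
        rintro ⟨y, x⟩
        ext q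
        · by_cases hq : ∃ r, g r = q
          · obtain ⟨r, rfl⟩ := hq; simp [g.injective.extend_apply]
          · simp [Function.extend_apply' _ _ _ hq]
        · simp [g.injective.extend_apply] }
  have h := Equiv.sum_comp e fun p => ‖a p.1‖ ^ 2
  simp only [Fintype.sum_prod_type, Finset.sum_const, Finset.card_univ, nsmul_eq_mul,
    ← Finset.mul_sum] at h
  exact h

end Subsystem

/-! ### Projections and relative phases -/

section Phase

variable {W Q : Type} [DecidableEq W] [DecidableEq Q]

/-- `projOn` as a linear map. -/
def projLin (q : Q) (v : Ket) : Amp Q →ₗ[ℂ] Amp Q where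
  toFun := projOn q v
  map_add' a b := by
    funext x; simp only [projOn, Fintype.sum_bool, Pi.add_apply]; ring
  map_smul' z a := by
    funext x; simp only [projOn, Fintype.sum_bool, Pi.smul_apply, smul_eq_mul, RingHom.id_apply]
    ring

theorem projOn_sub (q : Q) (v : Ket) (a b : Amp Q) :
    projOn q v (a - b) = projOn q v a - projOn q v b :=
  (projLin q v).map_sub a b

/-- The states in which the qubit `q` is in the state `|0⟩ + z |1⟩`, up to normalization. -/
def Phase (q : Q) (z : ℂ) (a : Amp Q) : Prop :=
  ∀ x, a (Function.update x q true) = z * a (Function.update x q false)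

theorem phase_projOn {q : Q} {v : Ket} {z : ℂ} (hv : v true = z * v false) (a : Amp Q) :
    Phase q z (projOn q v a) := by
  intro x
  simp only [projOn, Function.update_self, Function.update_idem, hv]
  ring

theorem Phase.projOn_of_ne {q q' : Q} (h : q ≠ q') {z : ℂ} {a : Amp Q} (ha : Phase q z a)
    (v : Ket) : Phase q z (projOn q' v a) := by
  intro x
  have : ∀ y, a (Function.update (Function.update x q true) q' y) =
      z * a (Function.update (Function.update x q false) q' y) := by
    intro y
    rw [Function.update_comm h, ha, Function.update_comm h.symm]
  simp only [projOn, Function.update_of_ne h.symm, this, Fintype.sum_bool]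
  ring

theorem Phase.hadamard_of_ne {q q' : Q} (h : q ≠ q') {z : ℂ} {a : Amp Q} (ha : Phase q z a) :
    Phase q z ((QubitGate.hadamard q').apply a) := by
  intro x
  have : ∀ y, a (Function.update (Function.update x q true) q' y) =
      z * a (Function.update (Function.update x q false) q' y) := by
    intro y
    rw [Function.update_comm h, ha, Function.update_comm h.symm]
  simp only [QubitGate.apply, Function.update_of_ne h.symm, this]
  ring

theorem Phase.restrictTo_of_ne {q q' : Q} (h : q ≠ q') {z : ℂ} {a : Amp Q} (ha : Phase q z a)
    (o : Bool) : Phase q z (restrictTo q' o a) := by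
  intro x
  simp only [restrictTo, LinearMap.coe_mk, AddHom.coe_mk, Function.update_of_ne h.symm, ha x]
  split_ifs <;> simp

theorem Phase.cnot_of_ne {q q' acc : Q} (h : q ≠ q') (hacc : q ≠ acc) (hne : acc ≠ q') {z : ℂ}
    {a : Amp Q} (ha : Phase q z a) : Phase q z ((QubitGate.cnot acc q' hne).apply a) := by
  intro x
  simp only [QubitGate.apply, Function.update_of_ne h.symm, Function.update_of_ne hacc.symm]
  rw [Function.update_comm h, ha, Function.update_comm h.symm]

/-- CNOT takes `(|0⟩ + α|1⟩)(|0⟩ + z|1⟩)` to a state whose `|0⟩` part on `q` is `|0⟩ + αz|1⟩` and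
whose `|1⟩` part is `z|0⟩ + α|1⟩`, that is, `z (|0⟩ + αz⁻¹|1⟩)`. -/
theorem Phase.cnot_restrictTo {q acc : Q} (hne : acc ≠ q) {α z : ℂ} (hz : z ≠ 0)
    {a : Amp Q} (hacc : Phase acc α a) (hq : Phase q z a) (o : Bool) :
    Phase acc (α * if o then z⁻¹ else z)
      (restrictTo q o ((QubitGate.cnot acc q hne).apply a)) := by
  intro x
  simp only [restrictTo, LinearMap.coe_mk, AddHom.coe_mk, QubitGate.apply,
    Function.update_of_ne hne.symm, Function.update_self]
  rcases o with _ | _ <;> rcases hx : x q with _ | _ <;>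
    simp only [Bool.true_xor, Bool.false_xor, Bool.not_false, Bool.not_true, if_true, if_false,
      mul_zero, reduceCtorEq]
  · rw [hq, Function.update_comm hne, hacc, Function.update_comm hne.symm]
    ring
  · rw [hq (Function.update x acc false), Function.update_comm hne, hacc,
      Function.update_comm hne.symm]
    field_simp

theorem Phase.hadamard_self {q : Q} {a : Amp Q} (ha : Phase q 0 a) :
    Phase q 1 ((QubitGate.hadamard q).apply a) := by
  intro x
  simp [QubitGate.apply, ha x]

variable [Fintype Q]

theorem normSq_apply (u : QubitGate Q) (a : Amp Q) : normSq (u.apply a) = normSq a := by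
  have := val_normSq (W' := Empty) [Instr.gate u] ⟨fun _ => false, a⟩
  simpa [val_cons, Instr.step] using this

theorem normSq_nonneg (a : Amp Q) : 0 ≤ normSq a :=
  Finset.sum_nonneg fun _ _ => by positivity

theorem normSq_restrictTo_add (q : Q) (o : Bool) (a : Amp Q) :
    normSq (restrictTo q o a) + normSq (restrictTo q (!o) a) = normSq a := by
  simp only [normSq, ← Finset.sum_add_distrib]
  refine Finset.sum_congr rfl fun x _ => ?_
  simp only [restrictTo, LinearMap.coe_mk, AddHom.coe_mk]
  rcases o with _ | _ <;> rcases x q with _ | _ <;> simp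

/-- Since `|z| = 1`, flipping `q` preserves the moduli of the amplitudes, before and after the CNOT,
so the outcomes are equally likely. The walk is thus unbiased and its history carries no information
about `z`. -/
theorem normSq_cnot_restrictTo {q acc : Q} (hne : acc ≠ q) {z : ℂ} (hz : ‖z‖ = 1) {a : Amp Q}
    (hq : Phase q z a) (o : Bool) :
    normSq (restrictTo q o ((QubitGate.cnot acc q hne).apply a)) = normSq a / 2 := by
  have hflip : ∀ x : Q → Bool, ‖a (Function.update x q (!x q))‖ = ‖a x‖ := by
    intro x
    have h := hq x
    have h' : ‖a (Function.update x q true)‖ = ‖a (Function.update x q false)‖ := by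
      rw [h, norm_mul, hz, one_mul]
    rcases hx : x q with _ | _
    · have : Function.update x q false = x := by rw [← hx]; simp
      rw [this] at h'; simpa using h'
    · have : Function.update x q true = x := by rw [← hx]; simp
      rw [this] at h'; simpa using h'.symm
  set c := (QubitGate.cnot acc q hne).apply a with hc
  have hcflip : ∀ x : Q → Bool, ‖c (Function.update x q (!x q))‖ = ‖c x‖ := by
    intro x
    have := hflip (Function.update x q (xor (x acc) (x q)))
    simp only [hc, QubitGate.apply, Function.update_self, Function.update_idem,
      Function.update_of_ne hne, Bool.xor_not] at this ⊢
    exact this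
  have heq : normSq (restrictTo q o c) = normSq (restrictTo q (!o) c) := by
    simp only [normSq]
    rw [← sum_flip q]
    refine Finset.sum_congr rfl fun x _ => ?_
    simp only [restrictTo, LinearMap.coe_mk, AddHom.coe_mk, Function.update_self]
    have := hcflip x
    rcases o with _ | _ <;> rcases hx : x q with _ | _ <;> simp [hx] at this ⊢ <;> rw [this]
  have h1 := normSq_restrictTo_add q o c
  have h2 : normSq c = normSq a := normSq_apply _ a
  linarith

/-- Pythagoras. -/
theorem normSq_projOn_add {v : Ket} (hv : ‖v false‖ ^ 2 + ‖v true‖ ^ 2 = 1) (q : Q) (a : Amp Q) :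
    normSq (projOn q v a) + normSq (a - projOn q v a) = normSq a := by
  have key : ∀ A B : ℂ,
      (‖v false * (star (v true) * B + star (v false) * A)‖ ^ 2 +
        ‖A - v false * (star (v true) * B + star (v false) * A)‖ ^ 2) +
      (‖v true * (star (v true) * B + star (v false) * A)‖ ^ 2 +
        ‖B - v true * (star (v true) * B + star (v false) * A)‖ ^ 2) =
      ‖A‖ ^ 2 + ‖B‖ ^ 2 := by
    intro A B
    apply Complex.ofReal_injective
    have hv' := congrArg (fun r : ℝ => (r : ℂ)) hv
    push_cast at hv' ⊢
    simp only [← Complex.conj_mul', map_mul, map_add, map_sub, Complex.star_def,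
      Complex.conj_conj] at hv' ⊢
    -- The two sides differ by `2 |s|² (‖v‖² - 1)`, where `s` is the inner product of `v` with `(A,
    -- B)`.
    linear_combination (2 * (((starRingEnd ℂ) (v true) * B + (starRingEnd ℂ) (v false) * A)) *
      (v true * (starRingEnd ℂ) B + v false * (starRingEnd ℂ) A)) * hv'
  have h2 : ∀ h : (Q → Bool) → ℝ, 2 * ∑ x, h x =
      ∑ x, (h (Function.update x q false) + h (Function.update x q true)) := fun h =>
    (sum_update_add q h).symm
  have : 2 * (normSq (projOn q v a) + normSq (a - projOn q v a)) = 2 * normSq a := by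
    simp only [normSq, ← Finset.sum_add_distrib]
    rw [h2, h2]
    refine Finset.sum_congr rfl fun x _ => ?_
    have := key (a (Function.update x q false)) (a (Function.update x q true))
    simpa [projOn] using this
  linarith

/-- The composition of several projections. -/
def projAll (l : List (Q × Ket)) (a : Amp Q) : Amp Q := l.foldr (fun p b => projOn p.1 p.2 b) a

/-- A union bound for projections. With `P` the first projection and `P'` the rest, `a - P P' a` is
the orthogonal sum of `P (a - P' a)` and `a - P a`. No commutation of the projections is needed. -/
theorem normSq_sub_projAll_le (l : List (Q × Ket))
    (hl : ∀ p ∈ l, ‖p.2 false‖ ^ 2 + ‖p.2 true‖ ^ 2 = 1) (a : Amp Q) :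
    normSq (a - projAll l a) ≤ (l.map fun p => normSq (a - projOn p.1 p.2 a)).sum := by
  induction l with
  | nil => simp [projAll, normSq]
  | cons p l ih =>
    have hp := hl p List.mem_cons_self
    have e1 : projOn p.1 p.2 (a - projAll (p :: l) a) = projOn p.1 p.2 (a - projAll l a) := by
      have h := normSq_projOn_add hp p.1 (projOn p.1 p.2 (projAll l a))
      have idem : ∀ b : Amp Q, projOn p.1 p.2 (projOn p.1 p.2 b) = projOn p.1 p.2 b := by
        intro b; funext x
        have hv' := congrArg (fun r : ℝ => (r : ℂ)) hp
        push_cast at hv'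
        simp only [← Complex.conj_mul'] at hv'
        simp only [projOn, Fintype.sum_bool, Function.update_self, Function.update_idem,
          Complex.star_def]
        linear_combination (p.2 (x p.1) * ((starRingEnd ℂ) (p.2 true) *
          b (Function.update x p.1 true) + (starRingEnd ℂ) (p.2 false) *
          b (Function.update x p.1 false))) * hv'
      simp only [projAll, List.foldr_cons] at *
      rw [projOn_sub, idem, projOn_sub]
    have e2 : a - projAll (p :: l) a - projOn p.1 p.2 (a - projAll (p :: l) a) =
        a - projOn p.1 p.2 a := by
      rw [e1, projOn_sub]
      simp only [projAll, List.foldr_cons]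
      abel
    have h1 := normSq_projOn_add hp p.1 (a - projAll (p :: l) a)
    rw [e2, e1] at h1
    have h2 := normSq_projOn_add hp p.1 (a - projAll l a)
    have h3 := normSq_nonneg (a - projAll l a - projOn p.1 p.2 (a - projAll l a))
    have h4 := ih fun r hr => hl r (List.mem_cons_of_mem _ hr)
    simp only [List.map_cons, List.sum_cons]
    linarith

theorem normSq_projAll_le (l : List (Q × Ket))
    (hl : ∀ p ∈ l, ‖p.2 false‖ ^ 2 + ‖p.2 true‖ ^ 2 = 1) (a : Amp Q) :
    normSq (projAll l a) ≤ normSq a := by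
  induction l with
  | nil => simp [projAll]
  | cons p l ih =>
    have h1 := normSq_projOn_add (hl p List.mem_cons_self) p.1 (projAll l a)
    have h2 := normSq_nonneg (projAll l a - projOn p.1 p.2 (projAll l a))
    have h3 := ih fun r hr => hl r (List.mem_cons_of_mem _ hr)
    simp only [projAll, List.foldr_cons] at *
    linarith

theorem Phase.projAll_of_notMem {q : Q} {z : ℂ} {a : Amp Q} (ha : Phase q z a)
    (l : List (Q × Ket)) (hl : ∀ p ∈ l, q ≠ p.1) : Phase q z (projAll l a) := by
  induction l with
  | nil => exact ha
  | cons p l ih =>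
    exact (ih fun r hr => hl r (List.mem_cons_of_mem _ hr)).projOn_of_ne
      (hl p List.mem_cons_self) _

/-- The projection belonging to `p` creates the product form, and those applied after it act on
other qubits because the list has no repeated qubit. -/
theorem phase_projAll {l : List (Q × Ket)} (hl : (l.map Prod.fst).Nodup) {p : Q × Ket}
    (hp : p ∈ l) {z : ℂ} (hz : p.2 true = z * p.2 false) (a : Amp Q) :
    Phase p.1 z (projAll l a) := by
  induction l with
  | nil => simp at hp
  | cons r l ih =>
    rw [List.map_cons, List.nodup_cons] at hl
    rcases List.mem_cons.1 hp with rfl | hp'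
    · exact phase_projOn hz _
    · refine (ih hl.2 hp').projOn_of_ne ?_ _
      intro e
      exact hl.1 (e ▸ List.mem_map_of_mem hp')

end Phase

/-! ### The absorbing random walk -/

/-- The classical wires of the receiver's combination circuit: `cell t k` says that the walk is at
`k` at time `t`, `meas t` and `nmeas t` are the measurement outcome at time `t` and its negation. -/
inductive Ctl : Type
  | cell (t : ℕ) (k : ℤ)
  | left (t : ℕ) (k : ℤ)
  | right (t : ℕ) (k : ℤ)
  | meas (t : ℕ)
  | nmeas (t : ℕ)
  | zero
  deriving DecidableEq

/-- The positions strictly between `-d` and `d`. -/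
def interior (d : ℕ) : List ℤ := (Finset.Ioo (-(d : ℤ)) d).toList

/-- The positions from `-d` to `d`. -/
def positions (d : ℕ) : List ℤ := (Finset.Icc (-(d : ℤ)) d).toList

theorem mem_interior {d : ℕ} {k : ℤ} : k ∈ interior d ↔ |k| < d := by
  simp [interior, abs_lt]

theorem mem_positions {d : ℕ} {k : ℤ} : k ∈ positions d ↔ |k| ≤ d := by
  simp [positions, abs_le]

/-- The wire that says whether the walk is at `k` at time `t`, and not absorbed. -/
def Ctl.live (d t : ℕ) (k : ℤ) : Ctl := if |k| < d then .cell t k else .zero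

section Walk

variable {W Q : Type} [DecidableEq W] [DecidableEq Q]

/-- The gates that compute `cell (t + 1) k`. -/
def moveCell (κ : Ctl → W) (d t : ℕ) (k : ℤ) : List (Instr W Q) :=
  [.bit (.nand (κ (.live d t (k - 1))) (κ (.nmeas t)) (κ (.left t k))),
   .bit (.nand (κ (.live d t (k + 1))) (κ (.meas t)) (κ (.right t k))),
   .bit (.nand (κ (.left t k)) (κ (.right t k)) (κ (.cell (t + 1) k)))]

/-- One step of the walk: if it is not absorbed, the relative phase of the qubit `q` is added to or
subtracted from the relative phase of the qubit `acc`, depending on a measurement outcome. -/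
def walkStep (κ : Ctl → W) (acc q : Q) (h : acc ≠ q) (d t : ℕ) : List (Instr W Q) :=
  ((interior d).map fun k => Instr.gateIf (κ (.cell t k)) (.cnot acc q h)) ++
    (.measure q (κ (.meas t)) ::
      .bit (.nand (κ (.meas t)) (κ (.meas t)) (κ (.nmeas t))) ::
        (positions d).flatMap (moveCell κ d t))

/-- `n` steps of the walk, starting at time `t`. -/
def walk (κ : Ctl → W) (acc : Q) (q : ℕ → Q) (h : ∀ t, acc ≠ q t) (d : ℕ) :
    ℕ → ℕ → List (Instr W Q)
  | _, 0 => []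
  | t, n + 1 => walkStep κ acc (q t) (h t) d t ++ walk κ acc q h d (t + 1) n

/-- The wires read belong to time `t` or carry the constant 0, whereas those written are the cells
of time `t + 1` and scratch wires private to one `k`; the updates for different `k` therefore do not
interfere. -/
theorem exec_moveCell {κ : Ctl → W} (hκ : Function.Injective κ) (d t : ℕ) (l : List ℤ)
    (σ : W → Bool) (a : Amp Q) :
    ∃ σ', exec (l.flatMap (moveCell κ d t)) ⟨σ, a⟩ = [⟨σ', a⟩] ∧
      (∀ k ∈ l, σ' (κ (.cell (t + 1) k)) =
        (σ (κ (.live d t (k - 1))) && σ (κ (.nmeas t)) ||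
          σ (κ (.live d t (k + 1))) && σ (κ (.meas t)))) ∧
      (∀ w, (∀ k ∈ l, w ≠ κ (.cell (t + 1) k)) → (∀ k, w ≠ κ (.left t k)) →
        (∀ k, w ≠ κ (.right t k)) → σ' w = σ w) := by
  induction l generalizing σ with
  | nil => exact ⟨σ, by simp [exec], by simp, by simp⟩
  | cons k l ih =>
    let σ₁ := Function.update σ (κ (.left t k)) (!(σ (κ (.live d t (k - 1))) && σ (κ (.nmeas t))))
    let σ₂ := Function.update σ₁ (κ (.right t k))
      (!(σ₁ (κ (.live d t (k + 1))) && σ₁ (κ (.meas t))))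
    let σ₃ := Function.update σ₂ (κ (.cell (t + 1) k))
      (!(σ₂ (κ (.left t k)) && σ₂ (κ (.right t k))))
    obtain ⟨σ', hexec, hcell, hframe⟩ := ih σ₃
    have hl : ∀ j (c : Ctl), (c = .left t k ∨ c = .right t k ∨ c = .cell (t + 1) k) →
        Ctl.live d t j ≠ c := by
      rintro j c (rfl | rfl | rfl) <;> unfold Ctl.live <;> split_ifs <;> simp
    have h₃ : ∀ w, w ≠ κ (.cell (t + 1) k) → w ≠ κ (.left t k) → w ≠ κ (.right t k) →
        σ₃ w = σ w := by
      intro w h1 h2 h3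
      simp only [σ₃, σ₂, σ₁, Function.update_of_ne h1, Function.update_of_ne h2,
        Function.update_of_ne h3]
    have hlive : ∀ j, σ₃ (κ (.live d t j)) = σ (κ (.live d t j)) := fun j =>
      h₃ _ (hκ.ne (hl j _ (by simp))) (hκ.ne (hl j _ (by simp))) (hκ.ne (hl j _ (by simp)))
    have hm : σ₃ (κ (.meas t)) = σ (κ (.meas t)) :=
      h₃ _ (hκ.ne (by simp)) (hκ.ne (by simp)) (hκ.ne (by simp))
    have hn : σ₃ (κ (.nmeas t)) = σ (κ (.nmeas t)) :=
      h₃ _ (hκ.ne (by simp)) (hκ.ne (by simp)) (hκ.ne (by simp))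
    refine ⟨σ', ?_, ?_, ?_⟩
    · rw [List.flatMap_cons, exec_append]
      have : exec (moveCell κ d t k) ⟨σ, a⟩ = [⟨σ₃, a⟩] := by
        simp [moveCell, exec, Instr.step, BitGate.step, σ₃, σ₂, σ₁]
      rw [this]; simpa using hexec
    · intro j hj
      by_cases hjl : j ∈ l
      · rw [hcell j hjl, hlive, hlive, hm, hn]
      · obtain rfl : j = k := by simpa [hjl] using hj
        rw [hframe _ (fun i hi e => hjl (by
          have := hκ e; simp only [Ctl.cell.injEq, true_and] at this; exact this ▸ hi))
          (fun i => hκ.ne (by simp)) (fun i => hκ.ne (by simp))]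
        have e1 : σ₁ (κ (.live d t (j + 1))) = σ (κ (.live d t (j + 1))) :=
          Function.update_of_ne (hκ.ne (hl _ _ (by simp))) _ _
        have e2 : σ₁ (κ (.meas t)) = σ (κ (.meas t)) :=
          Function.update_of_ne (hκ.ne (by simp)) _ _
        have e3 : σ₂ (κ (.left t j)) = σ₁ (κ (.left t j)) :=
          Function.update_of_ne (hκ.ne (by simp)) _ _
        simp only [σ₃, Function.update_self, e3]
        simp only [σ₂, Function.update_self, e1, e2]
        simp only [σ₁, Function.update_self]
        simp
    · intro w h1 h2 h3
      rw [hframe w (fun j hj => h1 j (List.mem_cons_of_mem _ hj)) h2 h3,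
        h₃ w (h1 k List.mem_cons_self) (h2 k) (h3 k)]

/-- With at most one control set, a sequence of controlled gates is one gate controlled by the
disjunction. This avoids computing a separate bit for "not yet absorbed". -/
theorem exec_gateIf_list {ι : Type*} (c : ι → W) (u : QubitGate Q) (l : List ι) (hl : l.Nodup)
    (σ : W → Bool) (hσ : ∀ i ∈ l, ∀ j ∈ l, σ (c i) = true → σ (c j) = true → i = j) (a : Amp Q) :
    exec (l.map fun k => Instr.gateIf (c k) u) ⟨σ, a⟩ =
      [⟨σ, open Classical in if ∃ k ∈ l, σ (c k) = true then u.apply a else a⟩] := by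
  induction l generalizing a with
  | nil => simp [exec]
  | cons k l ih =>
    rw [List.nodup_cons] at hl
    have ih' := ih hl.2 fun i hi j hj => hσ i (List.mem_cons_of_mem _ hi) j
      (List.mem_cons_of_mem _ hj)
    simp only [List.map_cons, exec, Instr.step, List.flatMap_cons, List.flatMap_nil,
      List.append_nil]
    rw [ih']
    by_cases hk : σ (c k) = true
    · have : ¬ ∃ j ∈ l, σ (c j) = true := by
        rintro ⟨j, hj, hj'⟩
        have := hσ k List.mem_cons_self j (List.mem_cons_of_mem _ hj) hk hj'
        exact hl.1 (this ▸ hj)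
      simp [hk, this]
    · simp [hk]

end Walk

/-! ### Analysis of the walk: accumulated phase, invariant and absorption -/

section WalkAnalysis

theorem sgn_xor (a b : Bool) : sgn (xor a b) = sgn a * sgn b := by
  cases a <;> cases b <;> simp [sgn]

theorem sgn_ne_zero (a : Bool) : sgn a ≠ 0 := by
  cases a <;> simp [sgn]

theorem norm_sgn (a : Bool) : ‖sgn a‖ = 1 := by
  cases a <;> simp [sgn]

theorem sgn_inv (a : Bool) : (sgn a)⁻¹ = sgn a := by
  cases a <;> simp [sgn]

/-- The walk with state `none` or `some k`, `|k| ≥ d`, is absorbed. -/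
def Alive (d : ℕ) (p : Option ℤ) : Prop := ∃ k : ℤ, p = some k ∧ |k| < d

/-- The next state of the walk after the measurement outcome `o`. -/
def move (d : ℕ) (p : Option ℤ) (o : Bool) : Option ℤ :=
  p.bind fun k => if |k| < d then some (if o then k - 1 else k + 1) else none

theorem move_of_lt {d : ℕ} {k : ℤ} (h : |k| < d) (o : Bool) :
    move d (some k) o = some (if o then k - 1 else k + 1) := by
  simp [move, h]

theorem move_of_not_alive {d : ℕ} {p : Option ℤ} (h : ¬ Alive d p) (o : Bool) :
    move d p o = none := by
  rcases p with _ | k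
  · rfl
  · have : ¬ |k| < d := fun hk => h ⟨k, rfl, hk⟩
    simp [move, this]

/-- The angle part of the relative phase that the walk has accumulated. -/
def phaseAt (d : ℕ) (w u : ℂ) (p : Option ℤ) : ℂ :=
  p.elim u fun k => if |k| < d then w ^ k else u

theorem phaseAt_of_not_alive {d : ℕ} {p : Option ℤ} (h : ¬ Alive d p) (w u : ℂ) :
    phaseAt d w u p = u := by
  rcases p with _ | k
  · rfl
  · have : ¬ |k| < d := fun hk => h ⟨k, rfl, hk⟩
    simp [phaseAt, this]

/-- A bound for the probability that the walk is not absorbed. -/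
def potential (d : ℕ) (p : Option ℤ) : ℝ :=
  p.elim 0 fun k => if |k| < d then (2 * (d : ℝ) ^ 2 - (k : ℝ) ^ 2) / (d : ℝ) ^ 2 else 0

theorem potential_of_not_alive {d : ℕ} {p : Option ℤ} (h : ¬ Alive d p) : potential d p = 0 := by
  rcases p with _ | k
  · rfl
  · have : ¬ |k| < d := fun hk => h ⟨k, rfl, hk⟩
    simp [potential, this]

theorem abs_cast_sq_le {d : ℕ} {k : ℤ} (h : |k| ≤ d) : (k : ℝ) ^ 2 ≤ (d : ℝ) ^ 2 := by
  have : |(k : ℝ)| ≤ |(d : ℝ)| := by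
    rw [Nat.abs_cast]; exact_mod_cast h
  exact sq_le_sq.2 this

/-- Hence the expected potential dominates the probability of not being absorbed. -/
theorem one_le_potential {d : ℕ} {p : Option ℤ} (h : Alive d p) : 1 ≤ potential d p := by
  obtain ⟨k, rfl, hk⟩ := h
  have hd : (0 : ℝ) < d := by
    have : (0 : ℤ) < d := (abs_nonneg k).trans_lt hk
    exact_mod_cast this
  have := abs_cast_sq_le hk.le
  simp only [potential, Option.elim, hk, if_true]
  rw [le_div_iff₀ (by positivity)]
  linarith

/-- The mean of `2d² - (k ± 1)²` is `2d² - k² - 1`, and since `2d² - k² ≤ 2d²` the loss of 1 is at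
least the fraction `1 / (2d²)`. -/
theorem potential_move_add {d : ℕ} {p : Option ℤ} (h : Alive d p) :
    potential d (move d p false) + potential d (move d p true) ≤
      2 * (1 - 1 / (2 * (d : ℝ) ^ 2)) * potential d p := by
  obtain ⟨k, rfl, hk⟩ := h
  have hd : (0 : ℝ) < d := by
    have : (0 : ℤ) < d := (abs_nonneg k).trans_lt hk
    exact_mod_cast this
  -- At the boundary the potential is 0, below the parabola; the inequality allows the same formula
  -- for both neighbours.
  have hle : ∀ j : ℤ, |j| ≤ d →
      potential d (some j) ≤ (2 * (d : ℝ) ^ 2 - (j : ℝ) ^ 2) / (d : ℝ) ^ 2 := by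
    intro j hj
    simp only [potential, Option.elim]
    split_ifs
    · exact le_rfl
    · have := abs_cast_sq_le hj
      exact div_nonneg (by linarith [sq_nonneg (d : ℝ)]) (by positivity)
  have h1 := hle (k + 1) (by rw [abs_lt] at hk; rw [abs_le]; omega)
  have h2 := hle (k - 1) (by rw [abs_lt] at hk; rw [abs_le]; omega)
  rw [move_of_lt hk, move_of_lt hk]
  simp only [Bool.false_eq_true, if_false, if_true]
  refine (add_le_add h1 h2).trans ?_
  simp only [potential, Option.elim, hk, if_true]
  rw [← add_div, ← mul_div_assoc]
  gcongr
  have e : (1 : ℝ) / (2 * (d : ℝ) ^ 2) * (2 * (d : ℝ) ^ 2) = 1 := by field_simp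
  have e2 : (0 : ℝ) ≤ 1 / (2 * (d : ℝ) ^ 2) * (k : ℝ) ^ 2 := by positivity
  push_cast
  nlinarith

variable {W Q : Type} [DecidableEq W] [DecidableEq Q]

/-- The sign of the relative phase that the walk has accumulated up to time `t`, where `s j` is the
sign of the `j`-th state. A correction is included if `b₀` is set and the walk was absorbed in
`e`. -/
def charge (κ : Ctl → W) (s : ℕ → W) (b₀ : W) (d : ℕ) (e : ℤ) (t : ℕ) (σ : W → Bool) : ℂ :=
  ∏ j ∈ Finset.range t, (∏ k ∈ Finset.Ioo (-(d : ℤ)) d, sgn (σ (s j) && σ (κ (.cell j k)))) *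
    sgn (σ b₀ && σ (κ (.cell (j + 1) e)))

/-- The invariant of the walk at time `t` in the state `p`. -/
structure WalkInv (κ : Ctl → W) (acc : Q) (q : ℕ → Q) (s : ℕ → W) (b₀ : W) (b : Bool) (d K : ℕ)
    (e : ℤ) (w u : ℂ) (t : ℕ) (p : Option ℤ) (β : Branch W Q) : Prop where
  qubit : ∀ j, t ≤ j → j < K → Phase (q j) (sgn (β.store (s j)) * w) β.amp
  cell : ∀ k : ℤ, |k| ≤ d → β.store (κ (.cell t k)) = decide (p = some k)
  zero : β.store (κ .zero) = false
  bit : β.store b₀ = b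
  acc : Phase acc (charge κ s b₀ d e t β.store * phaseAt d w u p) β.amp

variable {κ : Ctl → W} {acc : Q} {q : ℕ → Q} {s : ℕ → W} {b₀ : W} {b : Bool} {d K : ℕ}
  {e : ℤ} {w u : ℂ}

theorem exec_measured (hκ : Function.Injective κ) (t : ℕ) (σ : W → Bool) (o : Bool) (a : Amp Q) :
    ∃ σ', exec (Instr.bit (.nand (κ (.meas t)) (κ (.meas t)) (κ (.nmeas t))) ::
        (positions d).flatMap (moveCell κ d t)) ⟨Function.update σ (κ (.meas t)) o, a⟩ =
          [⟨σ', a⟩] ∧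
      (∀ k : ℤ, |k| ≤ d → σ' (κ (.cell (t + 1) k)) =
        if o then σ (κ (.live d t (k + 1))) else σ (κ (.live d t (k - 1)))) ∧
      (∀ v, (∀ k, v ≠ κ (.cell (t + 1) k)) → (∀ k, v ≠ κ (.left t k)) →
        (∀ k, v ≠ κ (.right t k)) → v ≠ κ (.meas t) → v ≠ κ (.nmeas t) → σ' v = σ v) := by
  let σ₁ := Function.update σ (κ (.meas t)) o
  let σ₂ := Function.update σ₁ (κ (.nmeas t)) (!(σ₁ (κ (.meas t)) && σ₁ (κ (.meas t))))
  obtain ⟨σ', hexec, hcell, hframe⟩ := exec_moveCell (Q := Q) hκ d t (positions d) σ₂ a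
  have hl : ∀ j, Ctl.live d t j ≠ .meas t ∧ Ctl.live d t j ≠ .nmeas t := by
    intro j; unfold Ctl.live; split_ifs <;> simp
  have hlive : ∀ j, σ₂ (κ (.live d t j)) = σ (κ (.live d t j)) := by
    intro j
    simp only [σ₂, σ₁, Function.update_of_ne (hκ.ne (hl j).1), Function.update_of_ne (hκ.ne (hl j).2)]
  have hm : σ₂ (κ (.meas t)) = o := by
    simp only [σ₂, σ₁]
    rw [Function.update_of_ne (hκ.ne (by simp)), Function.update_self]
  have hn : σ₂ (κ (.nmeas t)) = !o := by simp [σ₂, σ₁]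
  refine ⟨σ', ?_, ?_, ?_⟩
  · exact (List.append_nil _).trans hexec
  · intro k hk
    rw [hcell k (mem_positions.2 hk), hlive, hlive, hm, hn]
    cases o <;> simp
  · intro v h1 h2 h3 h4 h5
    rw [hframe v (fun k _ => h1 k) h2 h3]
    simp only [σ₂, σ₁, Function.update_of_ne h4, Function.update_of_ne h5]

theorem WalkInv.live {t : ℕ} {p : Option ℤ} {β : Branch W Q}
    (hI : WalkInv κ acc q s b₀ b d K e w u t p β) (k : ℤ) :
    β.store (κ (.live d t k)) = decide (p = some k ∧ |k| < d) := by
  unfold Ctl.live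
  split_ifs with h
  · rw [hI.cell k h.le]; simp [h]
  · rw [hI.zero]; simp [h]

/-- The interior cells contain at most one 1, and contain one exactly if the walk is alive, so the
product selects the sign of a session precisely when that session is used. -/
theorem WalkInv.prod_live {t : ℕ} {p : Option ℤ} {β : Branch W Q}
    (hI : WalkInv κ acc q s b₀ b d K e w u t p β) (v : Bool) :
    ∏ k ∈ Finset.Ioo (-(d : ℤ)) d, sgn (v && β.store (κ (.cell t k))) =
      open Classical in if Alive d p then sgn v else 1 := by
  classical
  have hc : ∀ k ∈ Finset.Ioo (-(d : ℤ)) d, sgn (v && β.store (κ (.cell t k))) =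
      if p = some k then sgn v else 1 := by
    intro k hk
    rw [Finset.mem_Ioo] at hk
    rw [hI.cell k (abs_le.2 ⟨hk.1.le, hk.2.le⟩)]
    split_ifs with h <;> simp [h, sgn]
  rw [Finset.prod_congr rfl hc]
  split_ifs with h
  · obtain ⟨k, rfl, hk⟩ := h
    simp only [Option.some.injEq]
    rw [Finset.prod_ite_eq, if_pos (Finset.mem_Ioo.2 (abs_lt.1 hk))]
  · refine Finset.prod_eq_one fun k hk => if_neg ?_
    rintro rfl
    exact h ⟨k, rfl, abs_lt.2 (Finset.mem_Ioo.1 hk)⟩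

theorem charge_congr {t : ℕ} {σ σ' : W → Bool} (hs : ∀ j < t, σ' (s j) = σ (s j))
    (hb : σ' b₀ = σ b₀) (hc : ∀ j ≤ t, ∀ k, σ' (κ (.cell j k)) = σ (κ (.cell j k))) :
    charge κ s b₀ d e t σ' = charge κ s b₀ d e t σ := by
  refine Finset.prod_congr rfl fun j hj => ?_
  rw [Finset.mem_range] at hj
  rw [hb, hc (j + 1) hj]
  congr 1
  refine Finset.prod_congr rfl fun k _ => ?_
  rw [hs j hj, hc j hj.le]

variable [Fintype Q]

/-- The hypothesis `hwu` says that both absorbing ends give the target phase `u`, up to a sign at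
the end `e` which matters only if `b` is set. A walk that reaches `±d` occupies that cell for one
time only and then moves to `none`, so the correction is charged once. -/
theorem exec_walkStep (hκ : Function.Injective κ) (hs : ∀ j c, s j ≠ κ c) (hb : ∀ c, b₀ ≠ κ c)
    (hq : ∀ t, acc ≠ q t) (hinj : ∀ i j, i < j → j < K → q i ≠ q j) (he : |e| = d)
    (hw : ‖w‖ = 1) (hwu : ∀ k : ℤ, |k| = d → w ^ k = sgn (b && decide (k = e)) * u)
    {t : ℕ} (ht : t < K) {p : Option ℤ} {β : Branch W Q}
    (hI : WalkInv κ acc q s b₀ b d K e w u t p β) :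
    ∃ β₀ β₁, exec (walkStep κ acc (q t) (hq t) d t) β = [β₀, β₁] ∧
      WalkInv κ acc q s b₀ b d K e w u (t + 1) (move d p false) β₀ ∧
      WalkInv κ acc q s b₀ b d K e w u (t + 1) (move d p true) β₁ ∧
      (Alive d p → normSq β₀.amp = normSq β.amp / 2 ∧ normSq β₁.amp = normSq β.amp / 2) := by
  classical
  have hw0 : w ≠ 0 := by rintro rfl; simp at hw
  obtain ⟨σ, a⟩ := β
  set z := sgn (σ (s t)) * w with hz
  have hz0 : z ≠ 0 := mul_ne_zero (sgn_ne_zero _) hw0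
  have hz1 : ‖z‖ = 1 := by rw [hz, norm_mul, norm_sgn, hw, one_mul]
  have hqt : Phase (q t) z a := hI.qubit t le_rfl ht
  -- After absorption the session qubit is still measured, but without the CNOT, so the accumulator
  -- is untouched.
  set a' : Amp Q := if Alive d p then (QubitGate.cnot acc (q t) (hq t)).apply a else a with ha'
  have hgate : exec ((interior d).map fun k =>
      Instr.gateIf (κ (.cell t k)) (.cnot acc (q t) (hq t))) ⟨σ, a⟩ = [⟨σ, a'⟩] := by
    rw [exec_gateIf_list (fun k => κ (.cell t k)) _ (interior d) (Finset.nodup_toList _)]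
    · congr 2
      have hiff : (∃ k ∈ interior d, σ (κ (.cell t k)) = true) ↔ Alive d p := by
        constructor
        · rintro ⟨k, hk, h⟩
          rw [mem_interior] at hk
          have h' := hI.cell k hk.le
          simp only [h, Bool.true_eq, decide_eq_true_eq] at h'
          exact ⟨k, h', hk⟩
        · rintro ⟨k, rfl, hk⟩
          exact ⟨k, mem_interior.2 hk, by simpa using hI.cell k hk.le⟩
      simp only [hiff, ha']
    · intro i hi j hj h1 h2
      rw [mem_interior] at hi hj
      have h1' := hI.cell i hi.le
      have h2' := hI.cell j hj.le
      simp only [h1, h2, Bool.true_eq, decide_eq_true_eq] at h1' h2'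
      rw [h1'] at h2'
      exact Option.some.inj h2'
  choose τ hexec hcell hframe using fun o =>
    exec_measured (d := d) hκ t σ o (restrictTo (q t) o a')
  have hinv : ∀ o, WalkInv κ acc q s b₀ b d K e w u (t + 1) (move d p o)
      ⟨τ o, restrictTo (q t) o a'⟩ := by
    intro o
    have fr : ∀ v, (∀ c, v ≠ κ c) → τ o v = σ v := fun v hv =>
      hframe o v (fun _ => hv _) (fun _ => hv _) (fun _ => hv _) (hv _) (hv _)
    have frc : ∀ j ≤ t, ∀ k, τ o (κ (.cell j k)) = σ (κ (.cell j k)) := by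
      intro j hj k
      refine hframe o _ (fun i => hκ.ne ?_) (fun i => hκ.ne (by simp)) (fun i => hκ.ne (by simp))
        (hκ.ne (by simp)) (hκ.ne (by simp))
      intro h
      simp only [Ctl.cell.injEq] at h
      omega
    have hlive : ∀ k : ℤ, σ (κ (.live d t k)) = decide (p = some k ∧ |k| < d) := hI.live
    have hcells : ∀ k : ℤ, |k| ≤ d → τ o (κ (.cell (t + 1) k)) = decide (move d p o = some k) := by
      intro k hk
      rw [hcell o k hk, hlive, hlive]
      by_cases hp : Alive d p
      · obtain ⟨i, rfl, hi⟩ := hp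
        rw [move_of_lt hi]
        cases o <;>
          simp only [Bool.false_eq_true, if_false, if_true, Option.some.injEq, decide_eq_decide]
        · constructor
          · rintro ⟨h, -⟩; omega
          · intro h; obtain rfl : i = k - 1 := by omega
            exact ⟨rfl, hi⟩
        · constructor
          · rintro ⟨h, -⟩; omega
          · intro h; obtain rfl : i = k + 1 := by omega
            exact ⟨rfl, hi⟩
      · rw [move_of_not_alive hp]
        have : ∀ j : ℤ, ¬ (p = some j ∧ |j| < d) := fun j hj => hp ⟨j, hj.1, hj.2⟩
        simp [this]
    have hch : charge κ s b₀ d e (t + 1) (τ o) = charge κ s b₀ d e t σ *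
        ((if Alive d p then sgn (σ (s t)) else 1) * sgn (b && decide (move d p o = some e))) := by
      rw [charge, Finset.prod_range_succ]
      congr 1
      · exact charge_congr (fun j _ => fr _ (hs j)) (fr _ hb) frc
      · rw [fr _ hb, hcells e he.le, show σ b₀ = b from hI.bit, fr _ (hs t)]
        congr 1
        rw [← hI.prod_live (σ (s t))]
        exact Finset.prod_congr rfl fun k _ => by rw [frc t le_rfl]
    refine ⟨?_, hcells, ?_, ?_, ?_⟩
    · intro j hj hjK
      have hne : q j ≠ q t := (hinj t j (by omega) hjK).symm
      have h0 := hI.qubit j (by omega) hjK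
      simp only [fr _ (hs j)]
      refine Phase.restrictTo_of_ne hne ?_ o
      rw [ha']
      split_ifs
      · exact h0.cnot_of_ne hne (hq j).symm _
      · exact h0
    · exact (hframe o _ (fun i => hκ.ne (by simp)) (fun i => hκ.ne (by simp))
        (fun i => hκ.ne (by simp)) (hκ.ne (by simp)) (hκ.ne (by simp))).trans hI.zero
    · exact (fr _ hb).trans hI.bit
    · have hacc := hI.acc
      simp only [hch]
      by_cases hp : Alive d p
      · simp only [hp, if_true] at ha' ⊢
        rw [ha']
        obtain ⟨k, rfl, hk⟩ := hp
        have h1 := hacc.cnot_restrictTo (hq t) hz0 hqt o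
        convert h1 using 1
        rw [move_of_lt hk]
        set k' := if o then k - 1 else k + 1 with hk'
        -- A sign is its own inverse, so the session's sign enters in the same way for both
        -- outcomes; only the power of `w` depends on `o`.
        have hzk : w ^ k * (if o then z⁻¹ else z) = sgn (σ (s t)) * w ^ k' := by
          rw [hk', hz]
          cases o
          · simp [zpow_add₀ hw0]; ring
          · simp [zpow_sub₀ hw0, sgn_inv]; ring
        have hk'd : |k'| ≤ d := by
          rw [abs_lt] at hk; rw [abs_le, hk']; split_ifs <;> omega
        -- In the interior the correction is absent because `|e| = d`; at the boundary this is
        -- `hwu`.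
        have hph : sgn (b && decide (some k' = some e)) * phaseAt d w u (some k') = w ^ k' := by
          simp only [phaseAt, Option.elim]
          split_ifs with h
          · have : k' ≠ e := by rintro h'; rw [h', he] at h; exact lt_irrefl _ h
            simp [this, sgn]
          · rw [hwu k' (le_antisymm hk'd (not_lt.1 h))]
            simp
        have hpk : phaseAt d w u (some k) = w ^ k := by simp [phaseAt, hk]
        simp only [hpk]
        linear_combination (charge κ s b₀ d e t σ) * sgn (σ (s t)) * hph -
          (charge κ s b₀ d e t σ) * hzk
      · simp only [hp, if_false] at ha' ⊢
        rw [ha', move_of_not_alive hp]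
        rw [phaseAt_of_not_alive hp] at hacc
        have : phaseAt d w u none = u := rfl
        simpa [this, sgn] using hacc.restrictTo_of_ne (hq t) o
  refine ⟨_, _, ?_, hinv false, hinv true, ?_⟩
  · rw [walkStep, exec_append, hgate]
    simp only [List.flatMap_cons, List.flatMap_nil, List.append_nil]
    rw [exec]
    simp only [Instr.step, List.map_cons, List.map_nil, List.flatMap_cons, List.flatMap_nil,
      List.append_nil]
    have h0 := hexec false
    have h1 := hexec true
    simp only [restrictTo, LinearMap.coe_mk, AddHom.coe_mk] at h0 h1 ⊢
    rw [h0, h1]; rfl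
  · intro hp
    simp only [ha', hp, if_true]
    exact ⟨normSq_cnot_restrictTo _ hz1 hqt _, normSq_cnot_restrictTo _ hz1 hqt _⟩

/-- The walk is absorbed except with exponentially small probability. -/
theorem val_walk_le (hκ : Function.Injective κ) (hs : ∀ j c, s j ≠ κ c) (hb : ∀ c, b₀ ≠ κ c)
    (hq : ∀ t, acc ≠ q t) (hinj : ∀ i j, i < j → j < K → q i ≠ q j) (he : |e| = d)
    (hw : ‖w‖ = 1) (hwu : ∀ k : ℤ, |k| = d → w ^ k = sgn (b && decide (k = e)) * u)
    (hd : 1 ≤ d) {F : Branch W Q → ℝ} (hF : ∀ β, F β ≤ normSq β.amp)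
    (hF0 : ∀ p β, WalkInv κ acc q s b₀ b d K e w u K p β → ¬ Alive d p → F β ≤ 0)
    (n t : ℕ) (hnt : t + n = K) (p : Option ℤ) (β : Branch W Q)
    (hI : WalkInv κ acc q s b₀ b d K e w u t p β) :
    val (walk κ acc q hq d t n) F β ≤
      potential d p * (1 - 1 / (2 * (d : ℝ) ^ 2)) ^ n * normSq β.amp := by
  have hρ : (0 : ℝ) ≤ 1 - 1 / (2 * (d : ℝ) ^ 2) := by
    have : (1 : ℝ) ≤ d := by exact_mod_cast hd
    rw [sub_nonneg, div_le_one (by positivity)]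
    nlinarith
  induction n generalizing t p β with
  | zero =>
    obtain rfl : t = K := by omega
    simp only [walk, val_nil, pow_zero, mul_one]
    by_cases hp : Alive d p
    · refine (hF β).trans ?_
      exact le_mul_of_one_le_left (normSq_nonneg _) (one_le_potential hp)
    · rw [potential_of_not_alive hp, zero_mul]; exact hF0 p β hI hp
  | succ n ih =>
    obtain ⟨β₀, β₁, hexec, h0, h1, hn⟩ :=
      exec_walkStep hκ hs hb hq hinj he hw hwu (by omega : t < K) hI
    have e0 := ih (t + 1) (by omega) _ β₀ h0
    have e1 := ih (t + 1) (by omega) _ β₁ h1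
    rw [walk, val_append]
    have : val (walkStep κ acc (q t) (hq t) d t) (val (walk κ acc q hq d (t + 1) n) F) β =
        val (walk κ acc q hq d (t + 1) n) F β₀ + val (walk κ acc q hq d (t + 1) n) F β₁ := by
      conv_lhs => rw [val, hexec]
      simp
    rw [this]
    refine (add_le_add e0 e1).trans ?_
    by_cases hp : Alive d p
    · obtain ⟨n0, n1⟩ := hn hp
      rw [n0, n1]
      have := potential_move_add hp
      have hpos : 0 ≤ (1 - 1 / (2 * (d : ℝ) ^ 2)) ^ n * (normSq β.amp / 2) :=
        mul_nonneg (pow_nonneg hρ n) (by linarith [normSq_nonneg β.amp])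
      have := mul_le_mul_of_nonneg_right this hpos
      rw [pow_succ (1 - 1 / (2 * (d : ℝ) ^ 2)) n]
      linarith
    · rw [move_of_not_alive hp, move_of_not_alive hp, potential_of_not_alive hp]
      simp [potential]

end WalkAnalysis

/-! ### The error of a protocol -/

section ErrorFn

variable {W Q : Type} [DecidableEq W] [DecidableEq Q] [Fintype Q]

/-- The squared norm of the component of the qubit `q` orthogonal to `v s`, where `s` is the value
of the wire `o`. -/
def errorFn (q : Q) (v : Bool → Ket) (o : W) (β : Branch W Q) : ℝ :=
  normSq (β.amp - projOn q (v (β.store o)) β.amp)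

theorem isQuad_errorFn (q : Q) (v : Bool → Ket) (o : W) : IsQuad (errorFn q v o) := by
  have h := (isQuad_normSq (W := W) (Q := Q)).comp (fun s : W → Bool => s)
    (fun s => LinearMap.id - projLin q (v (s o)))
  simp only [LinearMap.sub_apply, LinearMap.id_apply] at h
  exact h

theorem errorFn_le {v : Bool → Ket} (hv : ∀ s, ‖v s false‖ ^ 2 + ‖v s true‖ ^ 2 = 1) (q : Q)
    (o : W) (β : Branch W Q) : errorFn q v o β ≤ normSq β.amp := by
  have := normSq_projOn_add (hv (β.store o)) q β.amp
  have := normSq_nonneg (projOn q (v (β.store o)) β.amp)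
  unfold errorFn
  linarith

/-- For norms `q ≤ p` of the projected and the full state, `q² ≤ p q`. The correctness measure is
not quadratic, and this inequality returns to it from the quadratic error. -/
theorem normSq_sub_errorFn_le {v : Bool → Ket} (hv : ∀ s, ‖v s false‖ ^ 2 + ‖v s true‖ ^ 2 = 1)
    (q : Q) (o : W) (β : Branch W Q) :
    normSq β.amp - errorFn q v o β ≤
      stateNorm β.amp * stateNorm (projOn q (v (β.store o)) β.amp) := by
  have h1 := normSq_projOn_add (hv (β.store o)) q β.amp
  have h2 := errorFn_le hv q o β
  have h3 : normSq (projOn q (v (β.store o)) β.amp) ≤ normSq β.amp := by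
    linarith [normSq_nonneg (β.amp - projOn q (v (β.store o)) β.amp)]
  have h4 : normSq β.amp - errorFn q v o β = normSq (projOn q (v (β.store o)) β.amp) := by
    unfold errorFn; linarith
  rw [h4]
  conv_lhs => rw [← Real.mul_self_sqrt (normSq_nonneg (projOn q (v (β.store o)) β.amp))]
  exact mul_le_mul_of_nonneg_right (Real.sqrt_le_sqrt h3) (Real.sqrt_nonneg _)

/-- The opposite comparison: `p² - q² ≤ 2 (p² - p q)`, because `(p - q)² ≥ 0`. -/
theorem errorFn_add_le {v : Bool → Ket} (hv : ∀ s, ‖v s false‖ ^ 2 + ‖v s true‖ ^ 2 = 1)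
    (q : Q) (o : W) (β : Branch W Q) :
    errorFn q v o β + 2 * (stateNorm β.amp * stateNorm (projOn q (v (β.store o)) β.amp)) ≤
      2 * normSq β.amp := by
  have h1 := normSq_projOn_add (hv (β.store o)) q β.amp
  have h2 : errorFn q v o β = normSq β.amp - normSq (projOn q (v (β.store o)) β.amp) := by
    unfold errorFn; linarith
  have e1 := Real.mul_self_sqrt (normSq_nonneg (projOn q (v (β.store o)) β.amp))
  have e2 := Real.mul_self_sqrt (normSq_nonneg β.amp)
  rw [h2]
  unfold stateNorm
  nlinarith [sq_nonneg (Real.sqrt (normSq β.amp) -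
    Real.sqrt (normSq (projOn q (v (β.store o)) β.amp)))]

theorem errorFn_eq_zero {v : Bool → Ket} (hv : ∀ s, ‖v s false‖ ^ 2 + ‖v s true‖ ^ 2 = 1)
    {q : Q} {o : W} {β : Branch W Q}
    (h : ∀ x, ∃ c, ∀ y, β.amp (Function.update x q y) = v (β.store o) y * c) :
    errorFn q v o β = 0 := by
  have : β.amp - projOn q (v (β.store o)) β.amp = 0 := by
    funext x
    obtain ⟨c, hc⟩ := h x
    have hx : β.amp x = v (β.store o) (x q) * c := by rw [← hc]; simp
    have hv' := congrArg (fun r : ℝ => (r : ℂ)) (hv (β.store o))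
    push_cast at hv'
    simp only [← Complex.conj_mul'] at hv'
    simp only [Pi.sub_apply, projOn, Fintype.sum_bool, hc, hx, Pi.zero_apply, Complex.star_def]
    linear_combination (-(v (β.store o) (x q) * c)) * hv'
  rw [errorFn, this]
  simp [normSq]

end ErrorFn

/-! ### The target states -/

theorem norm_one_div_sqrt_two_sq : ‖(1 : ℂ) / (Real.sqrt 2 : ℂ)‖ ^ 2 = 1 / 2 := by
  rw [norm_div, Complex.norm_real, div_pow, Real.norm_eq_abs, sq_abs, Real.sq_sqrt (by norm_num)]
  simp

theorem stdKet_unit (b s : Bool) : ‖stdKet b s false‖ ^ 2 + ‖stdKet b s true‖ ^ 2 = 1 := by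
  cases b <;> cases s <;> simp [stdKet, hadamardKet, basisKet, sgn, -norm_div] <;> norm_num

/-- The relative phase of `angleKet ε b`. -/
def angle (ε : ℝ) (b : Bool) : ℂ :=
  Complex.exp (((if b then ε * Real.pi / 2 else 0 : ℝ) : ℂ) * Complex.I)

theorem norm_angle (ε : ℝ) (b : Bool) : ‖angle ε b‖ = 1 :=
  Complex.norm_exp_ofReal_mul_I _

theorem angleKet_false (ε : ℝ) (b s : Bool) : angleKet ε b s false = 1 / (Real.sqrt 2 : ℂ) := by
  cases s <;> simp [angleKet, plusKet, zKet, sgn]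

theorem angleKet_true (ε : ℝ) (b s : Bool) :
    angleKet ε b s true = sgn s * angle ε b * angleKet ε b s false := by
  rw [angleKet_false]
  cases s <;> simp [angleKet, plusKet, zKet, sgn, angle, mul_comm Complex.I] <;> ring

theorem angleKet_unit (ε : ℝ) (b s : Bool) :
    ‖angleKet ε b s false‖ ^ 2 + ‖angleKet ε b s true‖ ^ 2 = 1 := by
  rw [angleKet_true, norm_mul, norm_mul, norm_sgn, norm_angle, angleKet_false,
    one_mul, one_mul, norm_one_div_sqrt_two_sq]
  norm_num

/-- The angles at which the walk is absorbed. -/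
theorem exists_angle_zpow {c d : ℕ} (hc : Odd c) (hd : 1 ≤ d) :
    ∃ e : ℤ, |e| = d ∧ ∀ b (k : ℤ), |k| = d →
      angle ((c : ℝ) / (d : ℝ)) b ^ k =
        sgn (b && decide (k = e)) * if b then Complex.I else 1 := by
  obtain ⟨j, rfl⟩ := hc
  have hd0 : (d : ℂ) ≠ 0 := by exact_mod_cast (by omega : d ≠ 0)
  -- After `d` steps the total angle is `c π / 2 = j π + π / 2`; this is where oddness of `c`
  -- enters.
  have hpow : angle (((2 * j + 1 : ℕ) : ℝ) / (d : ℝ)) true ^ d = (-1) ^ j * Complex.I := by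
    rw [angle, ← Complex.exp_nat_mul]
    have : (d : ℂ) * (((if true then ((2 * j + 1 : ℕ) : ℝ) / (d : ℝ) * Real.pi / 2 else 0 : ℝ) : ℂ) *
        Complex.I) = (j : ℂ) * (Real.pi * Complex.I) + Real.pi / 2 * Complex.I := by
      simp only [if_true]; push_cast; field_simp
    rw [this, Complex.exp_add, Complex.exp_nat_mul, Complex.exp_pi_mul_I,
      Complex.exp_pi_div_two_mul_I]
  -- The end at which the phase is `-i` instead of `i`.
  refine ⟨if Even j then -(d : ℤ) else d, by split_ifs <;> simp, ?_⟩
  intro b k hk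
  cases b
  · simp [angle, sgn]
  · have hk' : k = d ∨ k = -(d : ℤ) := (abs_eq (by positivity)).1 hk
    have hne : (d : ℤ) ≠ -(d : ℤ) := by omega
    rcases hk' with rfl | rfl
    · rw [zpow_natCast, hpow]
      by_cases hj : Even j
      · simp [hj, hne, sgn]
      · simp [hj, sgn, Nat.not_even_iff_odd.1 hj]
    · rw [zpow_neg, zpow_natCast, hpow]
      by_cases hj : Even j
      · simp [hj, sgn]
      · simp [hj, hne.symm, sgn, Nat.not_even_iff_odd.1 hj]

/-! ### The classical computations of the sender -/

/-- Additional wires of the sender: its input and output, and auxiliary wires. -/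
inductive Aux : Type
  | inp
  | neg
  | out
  | tmp (i : Fin 5)
  deriving DecidableEq

section SenderCircuits

variable {W Q : Type} [DecidableEq W] [DecidableEq Q]

/-- `out := out xor (p.1 ∧ p.2)` -/
def xorAnd (η : Aux → W) (p : W × W) : List (BitGate W) :=
  [.nand p.1 p.2 (η (.tmp 0)),
   .nand (η (.tmp 0)) (η (.tmp 0)) (η (.tmp 1)),
   .nand (η .out) (η (.tmp 1)) (η (.tmp 2)),
   .nand (η .out) (η (.tmp 2)) (η (.tmp 3)),
   .nand (η (.tmp 1)) (η (.tmp 2)) (η (.tmp 4)),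
   .nand (η (.tmp 3)) (η (.tmp 4)) (η .out)]

/-- `out` becomes the sum modulo `2` of `p.1 ∧ p.2` over the pairs `p` in the list. -/
def sumAnd (η : Aux → W) (l : List (W × W)) : List (BitGate W) :=
  .set (η .out) false :: l.flatMap (xorAnd η)

/-- Sets the wires in the list `l` to the value of `inp`. -/
def copyInput (η : Aux → W) (l : List W) : List (BitGate W) :=
  .nand (η .inp) (η .inp) (η .neg) :: l.map fun w => .nand (η .neg) (η .neg) w

theorem map_sumAnd {W' : Type} (f : W → W') (η : Aux → W) (l : List (W × W)) :
    (sumAnd η l).map (BitGate.map f) = sumAnd (f ∘ η) (l.map (Prod.map f f)) := by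
  simp only [sumAnd, List.map_cons, List.map_flatMap, List.flatMap_map]
  rfl

theorem map_copyInput {W' : Type} (f : W → W') (η : Aux → W) (l : List W) :
    (copyInput η l).map (BitGate.map f) = copyInput (f ∘ η) (l.map f) := by
  simp only [copyInput, List.map_cons, List.map_map]
  rfl

/-- The standard four-NAND exclusive or. The frame condition includes the input wire, which is never
written and may itself occur in a pair. -/
theorem exec_xorAnd {η : Aux → W} (hη : Function.Injective η) (p : W × W)
    (σ : W → Bool) (a : Amp Q) :
    ∃ σ', exec ((xorAnd η p).map Instr.bit) ⟨σ, a⟩ = [⟨σ', a⟩] ∧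
      σ' (η .out) = xor (σ (η .out)) (σ p.1 && σ p.2) ∧
      (∀ v, (∀ c, c ≠ .inp → v ≠ η c) → σ' v = σ v) := by
  let σ₁ := Function.update σ (η (.tmp 0)) (!(σ p.1 && σ p.2))
  let σ₂ := Function.update σ₁ (η (.tmp 1)) (!(σ₁ (η (.tmp 0)) && σ₁ (η (.tmp 0))))
  let σ₃ := Function.update σ₂ (η (.tmp 2)) (!(σ₂ (η .out) && σ₂ (η (.tmp 1))))
  let σ₄ := Function.update σ₃ (η (.tmp 3)) (!(σ₃ (η .out) && σ₃ (η (.tmp 2))))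
  let σ₅ := Function.update σ₄ (η (.tmp 4)) (!(σ₄ (η (.tmp 1)) && σ₄ (η (.tmp 2))))
  let σ₆ := Function.update σ₅ (η .out) (!(σ₅ (η (.tmp 3)) && σ₅ (η (.tmp 4))))
  refine ⟨σ₆, rfl, ?_, ?_⟩
  · simp [σ₆, σ₅, σ₄, σ₃, σ₂, σ₁, hη.eq_iff]
    cases σ (η .out) <;> cases σ p.1 <;> cases σ p.2 <;> rfl
  · intro v hv
    simp [σ₆, σ₅, σ₄, σ₃, σ₂, σ₁, Function.update_apply, hv]

theorem exec_flatMap_xorAnd {η : Aux → W} (hη : Function.Injective η) (l : List (W × W))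
    (hl : ∀ p ∈ l, ∀ c, c ≠ .inp → p.1 ≠ η c ∧ p.2 ≠ η c) (σ : W → Bool) (a : Amp Q) :
    ∃ σ', exec ((l.flatMap (xorAnd η)).map Instr.bit) ⟨σ, a⟩ = [⟨σ', a⟩] ∧
      sgn (σ' (η .out)) = sgn (σ (η .out)) * (l.map fun p => sgn (σ p.1 && σ p.2)).prod := by
  induction l generalizing σ with
  | nil => exact ⟨σ, by simp [exec], by simp⟩
  | cons p l ih =>
    obtain ⟨σ₁, h1, h2, h3⟩ := exec_xorAnd (Q := Q) hη p σ a
    obtain ⟨σ', h4, h5⟩ := ih (fun r hr => hl r (List.mem_cons_of_mem _ hr)) σ₁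
    refine ⟨σ', ?_, ?_⟩
    · rw [List.flatMap_cons, List.map_append, exec_append, h1]
      simpa using h4
    · have : (l.map fun p => sgn (σ₁ p.1 && σ₁ p.2)) = l.map fun p => sgn (σ p.1 && σ p.2) := by
        refine List.map_congr_left fun r hr => ?_
        rw [h3 r.1 fun c hc => (hl r (List.mem_cons_of_mem _ hr) c hc).1,
          h3 r.2 fun c hc => (hl r (List.mem_cons_of_mem _ hr) c hc).2]
      rw [h5, this, h2, sgn_xor, List.map_cons, List.prod_cons, mul_assoc]

theorem exec_sumAnd {η : Aux → W} (hη : Function.Injective η) (l : List (W × W))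
    (hl : ∀ p ∈ l, ∀ c, c ≠ .inp → p.1 ≠ η c ∧ p.2 ≠ η c) (σ : W → Bool) (a : Amp Q) :
    ∃ σ', exec ((sumAnd η l).map Instr.bit) ⟨σ, a⟩ = [⟨σ', a⟩] ∧
      sgn (σ' (η .out)) = (l.map fun p => sgn (σ p.1 && σ p.2)).prod := by
  obtain ⟨σ', h1, h2⟩ := exec_flatMap_xorAnd (Q := Q) hη l hl (Function.update σ (η .out) false) a
  refine ⟨σ', ?_, ?_⟩
  · simpa [sumAnd, exec, Instr.step, BitGate.step] using h1
  · rw [h2]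
    have : (l.map fun p => sgn (Function.update σ (η .out) false p.1 &&
        Function.update σ (η .out) false p.2)) = l.map fun p => sgn (σ p.1 && σ p.2) := by
      refine List.map_congr_left fun r hr => ?_
      obtain ⟨e1, e2⟩ := hl r hr .out (by simp)
      rw [Function.update_of_ne e1, Function.update_of_ne e2]
    rw [this]; simp [sgn]

/-- There is no copy gate, so the bit is copied by two negations, the first stored in `neg`. -/
theorem exec_copyInput (η : Aux → W) (l : List W)
    (hl : ∀ v ∈ l, v ≠ η .neg) (σ : W → Bool) (a : Amp Q) :
    ∃ σ', exec ((copyInput η l).map Instr.bit) ⟨σ, a⟩ = [⟨σ', a⟩] ∧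
      (∀ v ∈ l, σ' v = σ (η .inp)) ∧ (∀ v, v ∉ l → v ≠ η .neg → σ' v = σ v) := by
  have key : ∀ τ : W → Bool, ∃ σ', exec ((l.map fun w =>
      BitGate.nand (η .neg) (η .neg) w).map Instr.bit) ⟨τ, a⟩ = [⟨σ', a⟩] ∧
      (∀ v ∈ l, σ' v = !τ (η .neg)) ∧ (∀ v, v ∉ l → σ' v = τ v) := by
    induction l with
    | nil => intro τ; exact ⟨τ, by simp [exec], by simp, by simp⟩
    | cons w l ih =>
      intro τ
      have hw := hl w List.mem_cons_self
      obtain ⟨σ', h1, h2, h3⟩ := ih (fun v hv => hl v (List.mem_cons_of_mem _ hv))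
        (Function.update τ w (!(τ (η .neg) && τ (η .neg))))
      refine ⟨σ', ?_, ?_, ?_⟩
      · simpa [exec, Instr.step, BitGate.step] using h1
      · intro v hv
        by_cases hvl : v ∈ l
        · rw [h2 v hvl, Function.update_of_ne hw.symm]
        · obtain rfl : v = w := by simpa [hvl] using hv
          rw [h3 v hvl]; simp
      · intro v hv
        rw [List.mem_cons, not_or] at hv
        rw [h3 v hv.2, Function.update_of_ne hv.1]
  obtain ⟨σ', h1, h2, h3⟩ := key (Function.update σ (η .neg) (!(σ (η .inp) && σ (η .inp))))
  refine ⟨σ', ?_, ?_, ?_⟩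
  · simpa [copyInput, exec, Instr.step, BitGate.step] using h1
  · intro v hv; rw [h2 v hv]; simp
  · intro v hv hv'; rw [h3 v hv, Function.update_of_ne hv']

end SenderCircuits

/-! ### The combination circuit -/

section Combine

variable {W Q : Type} [DecidableEq W] [DecidableEq Q]

/-- The receiver's circuit that combines the states of the qubits `q 0, …, q (K - 1)`. -/
def combine (κ : Ctl → W) (acc : Q) (q : ℕ → Q) (h : ∀ t, acc ≠ q t) (d K : ℕ) :
    List (Instr W Q) :=
  .bit (.set (κ (.cell 0 0)) true) :: .gate (.hadamard acc) ::
    (walk κ acc q h d 0 K ++ [.gate (.hadamard acc), .gate (.tGate acc), .gate (.tGate acc)])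

/-- The wires that the sender uses to compute its output. -/
def signPairs (κ : Ctl → W) (s : ℕ → W) (b₀ : W) (d K : ℕ) (e : ℤ) : List (W × W) :=
  (List.range K).flatMap fun t =>
    ((interior d).map fun k => (s t, κ (.cell t k))) ++ [(b₀, κ (.cell (t + 1) e))]

/-- Identifies the sign in the accumulated phase with a sum modulo 2 of conjunctions, which the
classical sender can compute. -/
theorem prod_signPairs (κ : Ctl → W) (s : ℕ → W) (b₀ : W) (d K : ℕ) (e : ℤ) (σ : W → Bool) :
    ((signPairs κ s b₀ d K e).map fun p => sgn (σ p.1 && σ p.2)).prod =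
      charge κ s b₀ d e K σ := by
  induction K with
  | zero => simp [signPairs, charge]
  | succ K ih =>
    rw [charge, Finset.prod_range_succ, ← charge, ← ih]
    simp only [signPairs, List.range_succ, List.flatMap_append, List.map_append, List.prod_append,
      List.flatMap_cons, List.flatMap_nil, List.append_nil, List.map_map, List.map_cons,
      List.map_nil, List.prod_cons, List.prod_nil, mul_one, interior]
    congr 2
    rw [← Finset.prod_map_toList]
    rfl

theorem map_signPairs {W' : Type} (f : W → W') (κ : Ctl → W) (s : ℕ → W) (b₀ : W) (d K : ℕ)
    (e : ℤ) : (signPairs κ s b₀ d K e).map (Prod.map f f) =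
      signPairs (f ∘ κ) (f ∘ s) (f b₀) d K e := by
  simp [signPairs, List.map_flatMap, Function.comp_def]

theorem mem_signPairs {κ : Ctl → W} {s : ℕ → W} {b₀ : W} {d K : ℕ} {e : ℤ} {p : W × W}
    (h : p ∈ signPairs κ s b₀ d K e) : ((∃ t, p.1 = s t) ∨ p.1 = b₀) ∧ ∃ c, p.2 = κ c := by
  simp only [signPairs, List.mem_flatMap, List.mem_append, List.mem_map, List.mem_singleton] at h
  obtain ⟨t, -, ⟨k, -, rfl⟩ | rfl⟩ := h
  · exact ⟨.inl ⟨t, rfl⟩, _, rfl⟩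
  · exact ⟨.inr rfl, _, rfl⟩

variable {κ : Ctl → W} {acc : Q} {q : ℕ → Q} {s : ℕ → W} {b₀ : W} {b : Bool} {d K : ℕ}
  {e : ℤ} {w : ℂ}

theorem exp_quarter_sq : Complex.exp (Complex.I * (Real.pi / 4 : ℝ)) *
    Complex.exp (Complex.I * (Real.pi / 4 : ℝ)) = Complex.I := by
  rw [← Complex.exp_add]
  have : Complex.I * ((Real.pi / 4 : ℝ) : ℂ) + Complex.I * ((Real.pi / 4 : ℝ) : ℂ) =
      Real.pi / 2 * Complex.I := by push_cast; ring
  rw [this, Complex.exp_pi_div_two_mul_I]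

/-- The final rotation takes `|0⟩ ± |1⟩` to the standard basis and `|0⟩ ± i |1⟩` to the Hadamard
basis. -/
theorem rotate_eq {a : Amp Q} {o : Bool}
    (ha : Phase acc (sgn o * if b then Complex.I else 1) a) (x : Q → Bool) :
    ∃ c, ∀ y, (QubitGate.tGate acc).apply ((QubitGate.tGate acc).apply
      ((QubitGate.hadamard acc).apply a)) (Function.update x acc y) = stdKet b o y * c := by
  have hx := ha x
  set A := a (Function.update x acc false) with hA
  have hval : ∀ y, (QubitGate.tGate acc).apply ((QubitGate.tGate acc).apply
      ((QubitGate.hadamard acc).apply a)) (Function.update x acc y) =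
      (if y then Complex.I else 1) *
        ((1 + sgn y * (sgn o * if b then Complex.I else 1)) * A / (Real.sqrt 2 : ℂ)) := by
    intro y
    simp only [QubitGate.apply, Function.update_self, Function.update_idem, hx, ← hA]
    rw [← mul_assoc]
    congr 1
    · cases y
      · simp
      · simpa using exp_quarter_sq
    · ring
  have hI := Complex.I_mul_I
  cases b <;> cases o
  · refine ⟨2 * A / (Real.sqrt 2 : ℂ), fun y => ?_⟩
    rw [hval]
    cases y <;> norm_num [stdKet, basisKet, sgn]
  · refine ⟨Complex.I * (2 * A / (Real.sqrt 2 : ℂ)), fun y => ?_⟩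
    rw [hval]
    cases y <;> norm_num [stdKet, basisKet, sgn]
  · refine ⟨(1 + Complex.I) * A, fun y => ?_⟩
    rw [hval]
    cases y <;> simp [stdKet, hadamardKet, basisKet, sgn]
    · ring
    · linear_combination (-A * (Real.sqrt 2 : ℂ)⁻¹) * hI
  · refine ⟨(1 - Complex.I) * A, fun y => ?_⟩
    rw [hval]
    cases y <;> simp [stdKet, hadamardKet, basisKet, sgn]
    · ring
    · linear_combination (A * (Real.sqrt 2 : ℂ)⁻¹) * hI

variable [Fintype Q]

/-- With ideal session qubits the only source of error is a walk that is never absorbed; once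
absorbed, the final rotation produces exactly the state matching the sender's output. -/
theorem val_combine_le {η : Aux → W} (hη : Function.Injective η) (hκη : ∀ c c', κ c ≠ η c')
    (hsη : ∀ j c, s j ≠ η c)
    (hκ : Function.Injective κ) (hs : ∀ j c, s j ≠ κ c)
    (hq : ∀ t, acc ≠ q t) (hinj : ∀ i j, i < j → j < K → q i ≠ q j) (he : |e| = d)
    (hw : ‖w‖ = 1)
    (hwu : ∀ k : ℤ, |k| = d → w ^ k = sgn (b && decide (k = e)) * if b then Complex.I else 1)
    (hd : 1 ≤ d) {σ : W → Bool} {a : Amp Q} (hσκ : ∀ c, σ (κ c) = false)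
    (hσb : σ (η .inp) = b) (hacc : Phase acc 0 a)
    (hphase : ∀ j < K, Phase (q j) (sgn (σ (s j)) * w) a) :
    val (combine κ acc q hq d K ++
      (sumAnd η (signPairs κ s (η .inp) d K e)).map Instr.bit)
        (errorFn acc (stdKet b) (η .out)) ⟨σ, a⟩ ≤
      2 * (1 - 1 / (2 * (d : ℝ) ^ 2)) ^ K * normSq a := by
  set fin : List (Instr W Q) := (sumAnd η (signPairs κ s (η .inp) d K e)).map Instr.bit with hfin
  set post : List (Instr W Q) :=
    [.gate (.hadamard acc), .gate (.tGate acc), .gate (.tGate acc)] with hpost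
  -- The error seen at the end of the walk: it vanishes on absorbed branches and is at most their
  -- weight on the others.
  set F : Branch W Q → ℝ := val (post ++ fin) (errorFn acc (stdKet b) (η .out)) with hF
  have hd0 : (0 : ℝ) < d := by exact_mod_cast hd
  have hFle : ∀ β, F β ≤ normSq β.amp := fun β => by
    rw [hF, ← val_normSq (post ++ fin) β]
    exact val_mono _ (errorFn_le (stdKet_unit b) acc (η .out)) β
  have hF0 : ∀ p β, WalkInv κ acc q s (η .inp) b d K e w (if b then Complex.I else 1) K p β →
      ¬ Alive d p → F β ≤ 0 := by
    rintro p ⟨τ, a'⟩ hI hp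
    have h1 := hI.acc
    rw [phaseAt_of_not_alive hp] at h1
    obtain ⟨τ', hexec, hout⟩ := exec_sumAnd (Q := Q) hη (signPairs κ s (η .inp) d K e) (by
      intro p hp c hc
      obtain ⟨⟨t, h⟩ | h, c', h'⟩ := mem_signPairs hp
      · exact ⟨h ▸ hsη t c, h' ▸ hκη c' c⟩
      · exact ⟨h ▸ hη.ne hc.symm, h' ▸ hκη c' c⟩) τ
      ((QubitGate.tGate acc).apply ((QubitGate.tGate acc).apply
        ((QubitGate.hadamard acc).apply a')))
    rw [prod_signPairs] at hout
    have hex : exec (post ++ fin) ⟨τ, a'⟩ = [⟨τ', (QubitGate.tGate acc).apply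
        ((QubitGate.tGate acc).apply ((QubitGate.hadamard acc).apply a'))⟩] := by
      rw [exec_append]
      simpa [hpost, exec, Instr.step] using hexec
    rw [hF, val_of_exec_eq hex]
    refine (errorFn_eq_zero (stdKet_unit b) ?_).le
    intro x
    rw [← hout] at h1
    exact rotate_eq h1 x
  have hI0 : WalkInv κ acc q s (η .inp) b d K e w (if b then Complex.I else 1) 0 (some 0)
      ⟨Function.update σ (κ (.cell 0 0)) true, (QubitGate.hadamard acc).apply a⟩ := by
    refine ⟨?_, ?_, ?_, ?_, ?_⟩
    · intro j _ hj
      simp only [Function.update_of_ne (hs j _)]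
      exact (hphase j hj).hadamard_of_ne (hq j).symm
    · intro k _
      by_cases hk : k = 0
      · subst hk; simp
      · simp only
        rw [Function.update_of_ne (hκ.ne (by simpa using hk)), hσκ]
        simp [Ne.symm hk]
    · simp only
      rw [Function.update_of_ne (hκ.ne (by simp)), hσκ]
    · simp only
      rw [Function.update_of_ne (hκη _ _).symm, hσb]
    · have : 0 < d := hd
      simpa [charge, phaseAt, this] using hacc.hadamard_self
  have hmain := val_walk_le hκ hs (fun c => (hκη c .inp).symm) hq hinj he hw hwu hd hFle hF0
    K 0 (by simp) (some 0) _ hI0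
  -- The factor 2 in the bound is the potential at the starting point.
  have hpot : potential d (some 0) = 2 := by
    have : (0 : ℤ) < d := by exact_mod_cast hd
    simp only [potential, Option.elim, abs_zero, this, if_true]
    field_simp; simp
  rw [hpot, normSq_apply] at hmain
  have hcirc : combine κ acc q hq d K ++ fin = .bit (.set (κ (.cell 0 0)) true) ::
      .gate (.hadamard acc) :: (walk κ acc q hq d 0 K ++ (post ++ fin)) := by
    simp [combine, hpost]
  rw [hcirc, val_cons]
  simp only [Instr.step, BitGate.step, List.map_cons, List.map_nil, List.sum_cons, List.sum_nil,
    add_zero, val_cons]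
  rw [val_append]
  exact hmain

end Combine

/-! ### Interleaving -/

section Interleave

variable {I : Type}

theorem interleave_nil_right (ss : List (List I)) : interleave ss [] = ss.flatten := by
  cases ss <;> rfl

/-- Padding with empty turns gives both parties a common number of rounds, so that parallel sessions
can be compared round by round. -/
theorem interleave_eq_flatMap (L : ℕ) (ss rs : List (List I)) (hs : ss.length ≤ L)
    (hr : rs.length ≤ L) :
    interleave ss rs = (List.range L).flatMap fun t => ss.getD t [] ++ rs.getD t [] := by
  induction L generalizing ss rs with
  | zero =>
    obtain rfl := List.length_eq_zero_iff.1 (Nat.le_zero.1 hs)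
    obtain rfl := List.length_eq_zero_iff.1 (Nat.le_zero.1 hr)
    rfl
  | succ L ih =>
    rw [List.range_succ_eq_map, List.flatMap_cons, List.flatMap_map]
    rcases ss with _ | ⟨s, ss⟩ <;> rcases rs with _ | ⟨r, rs⟩
    · have := ih [] [] (by simp) (by simp)
      simpa using this
    · have := ih [] rs (by simp) (by simpa using hr)
      simp only [List.getD_nil, List.getD_cons_zero, List.getD_cons_succ] at this ⊢
      rw [← this]
      rfl
    · have := ih ss [] (by simpa using hs) (by simp)
      simp only [List.getD_nil, List.getD_cons_zero, List.getD_cons_succ] at this ⊢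
      rw [← this, interleave_nil_right, interleave_nil_right]
      simp
    · have := ih ss rs (by simpa using hs) (by simpa using hr)
      simp only [List.getD_cons_zero, List.getD_cons_succ] at this ⊢
      rw [← this]
      simp [interleave]

theorem interleave_map_range_append (L : ℕ) (B C : ℕ → List I) (ss rs : List (List I)) :
    interleave ((List.range L).map B ++ ss) ((List.range L).map C ++ rs) =
      ((List.range L).flatMap fun t => B t ++ C t) ++ interleave ss rs := by
  induction L generalizing B C with
  | zero => simp
  | succ L ih =>
    have := ih (fun t => B (t + 1)) (fun t => C (t + 1))
    simp only [List.range_succ_eq_map, List.map_cons, List.map_map, List.cons_append, interleave,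
      List.flatMap_cons, List.flatMap_map, Function.comp_def, Nat.succ_eq_add_one, this,
      List.append_assoc]

end Interleave

/-! ### Parallel repetition -/

theorem BitGate.map_map {W W' W'' : Type} (f : W → W') (f' : W' → W'') (g : BitGate W) :
    (g.map f).map f' = g.map (f' ∘ f) := by
  cases g <;> rfl

theorem Instr.map_map {W W' W'' Q : Type} (f : W → W') (f' : W' → W'') (i : Instr W Q) :
    (i.map f).map f' = i.map (f' ∘ f) := by
  cases i <;> simp [Instr.map, BitGate.map_map]

theorem Instr.map_ren {W W' W'' Q Q' : Type} (f : W → W') (g : Q ↪ Q') (f' : W' → W'')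
    (i : Instr W Q) : (i.ren f g).map f' = i.ren (f' ∘ f) g := by
  cases i <;> simp [Instr.map, Instr.ren, BitGate.map_map]

theorem Instr.ren_map {W W' W'' Q Q' : Type} (f : W → W') (g : Q ↪ Q') (f' : W' → W'')
    (i : Instr W Q) : (i.map f).ren f' g = i.ren (f' ∘ f) g := by
  cases i <;> simp [Instr.map, Instr.ren, BitGate.map_map]

section Copies

variable {M : Type}

/-- The messages of `m + 1` parallel sessions, and the control wires of the receiver. -/
abbrev CopyMsg (M : Type) (m : ℕ) : Type := (Fin (m + 1) × M) ⊕ Ctl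

/-- The wires of the `j`-th session. -/
def copyWire {A B M : Type} {m : ℕ} (f : Fin (m + 1) × A → B) (j : Fin (m + 1)) :
    A ⊕ M → B ⊕ CopyMsg M m :=
  Sum.map (fun w => f (j, w)) (fun x => .inl (j, x))

/-- The sender's gates in turn `t` of `m + 1` parallel sessions. -/
def Sender.block (S : Sender M) (m t : ℕ) :
    List (BitGate (((Fin (m + 1) × S.Bits) ⊕ Aux) ⊕ CopyMsg M m)) :=
  (List.finRange (m + 1)).flatMap fun j =>
    (S.turns.getD t []).map (BitGate.map (copyWire Sum.inl j))

/-- The sender of `m + 1` parallel sessions. At the end, it combines its outputs. -/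
def Sender.copies (S : Sender M) (m d : ℕ) (e : ℤ) (L : ℕ) : Sender (CopyMsg M m) where
  Bits := (Fin (m + 1) × S.Bits) ⊕ Aux
  inp := .inr .inp
  out := .inr .out
  turns :=
    (copyInput (fun c => .inl (.inr c))
        ((List.finRange (m + 1)).map fun j => .inl (.inl (j, S.inp))) ++ S.block m 0) ::
      ((List.range L).map (fun t => S.block m (t + 1)) ++
        [[], sumAnd (fun c => .inl (.inr c))
          (signPairs (fun c => .inr (.inr c)) (fun t => .inl (.inl (Fin.ofNat (m + 1) t, S.out)))
            (.inl (.inr .inp)) d (m + 1) e)])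

/-- The embedding of the qubits of the `j`-th session. -/
def copyQubit (Q : Type) {m : ℕ} (j : Fin (m + 1)) : Q ↪ Option (Fin (m + 1) × Q) :=
  ⟨fun q => some (j, q), fun a b h => by simpa using h⟩

/-- The receiver's gates in turn `t` of `m + 1` parallel sessions. -/
def Receiver.block (R : Receiver M) (m t : ℕ) :
    List (Instr ((Fin (m + 1) × R.Bits) ⊕ CopyMsg M m) (Option (Fin (m + 1) × R.Qubits))) :=
  (List.finRange (m + 1)).flatMap fun j =>
    (R.turns.getD t []).map (Instr.ren (copyWire id j) (copyQubit R.Qubits j))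

/-- The receiver of `m + 1` parallel sessions. At the end, it combines its output qubits. -/
def QubitReceiver.copies (R : QubitReceiver M) (m d L : ℕ) : QubitReceiver (CopyMsg M m) where
  Bits := Fin (m + 1) × R.Bits
  Qubits := Option (Fin (m + 1) × R.Qubits)
  turns :=
    R.block m 0 :: ((List.range L).map (fun t => R.block m (t + 1)) ++
      [combine (fun c => .inr (.inr c)) none (fun t => some (Fin.ofNat (m + 1) t, R.out))
        (fun _ => by simp) d (m + 1)])
  out := none

variable [DecidableEq M] (S : Sender M) (R : QubitReceiver M) (m d : ℕ) (e : ℤ) (L : ℕ)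

/-- The wires of the `j`-th session in the joint system. -/
def jointWire (j : Fin (m + 1)) : JointBits S R.toReceiver →
    JointBits (S.copies m d e L) (R.copies m d L).toReceiver :=
  Sum.map (fun w => .inl (j, w)) (Sum.map (fun x => .inl (j, x)) (fun w => (j, w)))

theorem copyMap_ne {A B C D E : Type} {m : ℕ} {i j : Fin (m + 1)} (h : i ≠ j)
    (a b : A ⊕ (B ⊕ C)) :
    Sum.map (fun w => (Sum.inl (i, w) : (Fin (m + 1) × A) ⊕ D))
      (Sum.map (fun x => (Sum.inl (i, x) : (Fin (m + 1) × B) ⊕ E)) fun w => (i, w)) a ≠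
    Sum.map (fun w => (Sum.inl (j, w) : (Fin (m + 1) × A) ⊕ D))
      (Sum.map (fun x => (Sum.inl (j, x) : (Fin (m + 1) × B) ⊕ E)) fun w => (j, w)) b := by
  rcases a with a | a | a <;> rcases b with b | b | b <;> simp [h]

theorem jointWire_injective (j : Fin (m + 1)) :
    Function.Injective (jointWire S R m d e L j) :=
  Function.Injective.sumMap (fun a b h => by simpa using Sum.inl.inj h)
    (Function.Injective.sumMap (fun a b h => by simpa using h)
      (fun a b h => (Prod.mk.inj h).2))

theorem jointWire_ne {i j : Fin (m + 1)} (h : i ≠ j) (a b) :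
    jointWire S R m d e L i a ≠ jointWire S R m d e L j b :=
  copyMap_ne h a b

/-- The qubits of the `j`-th session. -/
def sessionQubit (j : Fin (m + 1)) : R.Qubits ↪ (R.copies m d L).Qubits := copyQubit R.Qubits j

/-- The gates of `m + 1` parallel sessions. -/
def sessions : List (Instr (JointBits (S.copies m d e L) (R.copies m d L).toReceiver)
    (R.copies m d L).Qubits) :=
  (List.range (L + 1)).flatMap fun t =>
    ((List.finRange (m + 1)).flatMap fun j =>
      ((senderTurns S R.toReceiver).getD t []).map
        (Instr.ren (jointWire S R m d e L j) (sessionQubit R m d L j))) ++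
    (List.finRange (m + 1)).flatMap fun j =>
      ((receiverTurns S R.toReceiver).getD t []).map
        (Instr.ren (jointWire S R m d e L j) (sessionQubit R m d L j))

theorem getD_map {α β : Type} (F : α → β) (l : List (List α)) (t : ℕ) :
    (l.map fun c => c.map F).getD t [] = (l.getD t []).map F := by
  have := List.getD_map (l := l) (n := t) (d := []) (f := fun c => c.map F)
  simpa using this

theorem map_senderBlock (t : ℕ) :
    (S.block m t).map (fun g => (Instr.bit (g.map (Sum.elim Sum.inl fun m => Sum.inr (Sum.inl m))) :
        Instr (JointBits (S.copies m d e L) (R.copies m d L).toReceiver)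
          (R.copies m d L).Qubits)) =
      (List.finRange (m + 1)).flatMap fun j =>
        ((senderTurns S R.toReceiver).getD t []).map
          (Instr.ren (jointWire S R m d e L j) (sessionQubit R m d L j)) := by
  simp only [Sender.block, senderTurns, getD_map, List.map_flatMap, List.map_map]
  congr 1; funext j
  congr 1; funext g
  simp only [Function.comp_apply, Instr.ren, BitGate.map_map]
  refine (congrArg Instr.bit (BitGate.map_map _ _ g)).trans
    (congrArg (fun f => Instr.bit (g.map f)) ?_)
  funext w
  rcases w with w | w <;> rfl

theorem map_receiverBlock (t : ℕ) :
    (R.block m t).map (fun i => (i.map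
        (Sum.elim (fun w => Sum.inr (Sum.inr w)) fun m => Sum.inr (Sum.inl m)) :
        Instr (JointBits (S.copies m d e L) (R.copies m d L).toReceiver)
          (R.copies m d L).Qubits)) =
      (List.finRange (m + 1)).flatMap fun j =>
        ((receiverTurns S R.toReceiver).getD t []).map
          (Instr.ren (jointWire S R m d e L j) (sessionQubit R m d L j)) := by
  simp only [Receiver.block, receiverTurns, getD_map, List.map_flatMap, List.map_map]
  congr 1; funext j
  congr 1; funext i
  refine (Instr.map_ren _ _ _ i).trans
    ((congrArg (fun f => i.ren f (sessionQubit R m d L j)) ?_).trans (Instr.ren_map _ _ _ i).symm)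
  funext w
  rcases w with w | w <;> rfl

end Copies

/-! ### The joint circuit of the repeated protocol -/

theorem map_walk {W W' Q : Type} [DecidableEq Q] (f : W → W') (κ : Ctl → W) (acc : Q) (q : ℕ → Q)
    (h : ∀ t, acc ≠ q t) (d t n : ℕ) :
    (walk κ acc q h d t n).map (Instr.map f) = walk (f ∘ κ) acc q h d t n := by
  induction n generalizing t with
  | zero => rfl
  | succ n ih =>
    simp only [walk, walkStep, List.map_append, List.map_cons, List.map_map, List.map_flatMap, ih]
    rfl

theorem map_combine {W W' Q : Type} [DecidableEq Q] (f : W → W') (κ : Ctl → W) (acc : Q)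
    (q : ℕ → Q) (h : ∀ t, acc ≠ q t) (d K : ℕ) :
    (combine κ acc q h d K).map (Instr.map f) = combine (f ∘ κ) acc q h d K := by
  simp only [combine, List.map_cons, List.map_append, map_walk]
  rfl

theorem map_senderTurns {α β : Type} {S : ℕ → List α} {c f : List α} {S' : ℕ → List β}
    {c' f' : List β} (F : α → β) (hc : c.map F = c') (hS : ∀ t, (S t).map F = S' t)
    (hf : f.map F = f') (L : ℕ) :
    ((c ++ S 0) :: ((List.range L).map (fun t => S (t + 1)) ++ [[], f])).map (List.map F) =
      (c' ++ S' 0) :: ((List.range L).map (fun t => S' (t + 1)) ++ [[], f']) := by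
  simp [← hc, ← hS, ← hf]

theorem map_receiverTurns {α β : Type} {R : ℕ → List α} {c : List α} {R' : ℕ → List β}
    {c' : List β} (F : α → β) (hR : ∀ t, (R t).map F = R' t) (hc : c.map F = c') (L : ℕ) :
    (R 0 :: ((List.range L).map (fun t => R (t + 1)) ++ [c])).map (List.map F) =
      R' 0 :: ((List.range L).map (fun t => R' (t + 1)) ++ [c']) := by
  simp [← hc, ← hR]

section Correctness

variable {M : Type} [DecidableEq M] (S : Sender M) (R : QubitReceiver M) (m d : ℕ) (e : ℤ) (L : ℕ)

/-- The additional wires of the sender in the joint system. -/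
def auxWire (c : Aux) : JointBits (S.copies m d e L) (R.copies m d L).toReceiver := .inl (.inr c)

/-- The control wires of the receiver in the joint system. -/
def ctlWire (c : Ctl) : JointBits (S.copies m d e L) (R.copies m d L).toReceiver :=
  .inr (.inl (.inr c))

/-- The sender's output in the session `t` in the joint system. -/
def outWire (t : ℕ) : JointBits (S.copies m d e L) (R.copies m d L).toReceiver :=
  .inl (.inl (Fin.ofNat (m + 1) t, S.out))

/-- The receiver's output qubit in the session `t`. -/
def outQubit (t : ℕ) : (R.copies m d L).Qubits := some (Fin.ofNat (m + 1) t, R.out)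

theorem out_ne_outQubit (t : ℕ) : (R.copies m d L).out ≠ outQubit R m d L t := by
  intro h; cases h

/-- The sender's inputs in all the sessions in the joint system. -/
def inputWires : List (JointBits (S.copies m d e L) (R.copies m d L).toReceiver) :=
  (List.finRange (m + 1)).map fun j => .inl (.inl (j, S.inp))

/-- The empty turn of the sender is paired with the receiver's combination turn. Hence the sender
sums up its signs only after the walk history is on the message wires. -/
theorem interleave_copies :
    interleave (senderTurns (S.copies m d e L) (R.copies m d L).toReceiver)
      (receiverTurns (S.copies m d e L) (R.copies m d L).toReceiver) =
    (copyInput (auxWire S R m d e L) (inputWires S R m d e L)).map Instr.bit ++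
      (sessions S R m d e L ++
        (combine (ctlWire S R m d e L) (R.copies m d L).out (outQubit R m d L)
          (out_ne_outQubit R m d L) d (m + 1) ++
        (sumAnd (auxWire S R m d e L) (signPairs (ctlWire S R m d e L) (outWire S R m d e L)
          (auxWire S R m d e L .inp) d (m + 1) e)).map Instr.bit)) := by
  have hS : senderTurns (S.copies m d e L) (R.copies m d L).toReceiver =
      ((copyInput (auxWire S R m d e L) (inputWires S R m d e L)).map Instr.bit ++
        (List.finRange (m + 1)).flatMap fun j =>
        ((senderTurns S R.toReceiver).getD 0 []).map
          (Instr.ren (jointWire S R m d e L j) (sessionQubit R m d L j))) ::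
      ((List.range L).map (fun t => (List.finRange (m + 1)).flatMap fun j =>
        ((senderTurns S R.toReceiver).getD (t + 1) []).map
          (Instr.ren (jointWire S R m d e L j) (sessionQubit R m d L j))) ++
      [[], (sumAnd (auxWire S R m d e L) (signPairs (ctlWire S R m d e L) (outWire S R m d e L)
          (auxWire S R m d e L .inp) d (m + 1) e)).map Instr.bit]) := by
    refine map_senderTurns (S := S.block m) _ ?_ (map_senderBlock S R m d e L) ?_ L
    · refine (List.map_map (g := Instr.bit)).symm.trans (congrArg (List.map Instr.bit) ?_)
      exact (map_copyInput _ _ _).trans (congrArg _ List.map_map)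
    · refine (List.map_map (g := Instr.bit)).symm.trans (congrArg (List.map Instr.bit) ?_)
      exact (map_sumAnd _ _ _).trans (congrArg _ (map_signPairs _ _ _ _ _ _ _))
  have hR : receiverTurns (S.copies m d e L) (R.copies m d L).toReceiver =
      ((List.finRange (m + 1)).flatMap fun j =>
        ((receiverTurns S R.toReceiver).getD 0 []).map
          (Instr.ren (jointWire S R m d e L j) (sessionQubit R m d L j))) ::
      ((List.range L).map (fun t => (List.finRange (m + 1)).flatMap fun j =>
        ((receiverTurns S R.toReceiver).getD (t + 1) []).map
          (Instr.ren (jointWire S R m d e L j) (sessionQubit R m d L j))) ++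
      [combine (ctlWire S R m d e L) (R.copies m d L).out (outQubit R m d L)
          (out_ne_outQubit R m d L) d (m + 1)]) := by
    exact map_receiverTurns (R := R.toReceiver.block m) _ (map_receiverBlock S R m d e L)
      (map_combine _ _ _ _ _ _ _) L
  rw [hS, hR, interleave, interleave_map_range_append]
  simp only [interleave, sessions, List.range_succ_eq_map, List.flatMap_cons, List.flatMap_map,
    List.nil_append, List.flatten_cons, List.flatten_nil, List.append_nil, List.append_assoc,
    Nat.succ_eq_add_one]

end Correctness

/-! ### Independence of the sessions -/

section RestrictsSessions

variable {W Q W' Q' : Type} [DecidableEq W] [DecidableEq Q] [DecidableEq W'] [DecidableEq Q']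
  [Fintype Q']

theorem Restricts.flatMap {ι : Type*} {f : W → W'} {g : Q ↪ Q'} {X : ι → List (Instr W' Q')}
    {Y : ι → List (Instr W Q)} (h : ∀ t, Restricts f g (X t) (Y t)) (l : List ι) :
    Restricts f g (l.flatMap X) (l.flatMap Y) := by
  induction l with
  | nil => exact .nil
  | cons t l ih => exact (h t).append ih

/-- From the viewpoint of copy `j` the gates of all other copies act outside, so of a
repetition-free list of copies exactly one survives. -/
theorem restricts_copies {ι : Type*} [DecidableEq ι] {f : ι → W → W'} {g : ι → Q ↪ Q'}
    (hf : ∀ i j, i ≠ j → ∀ a b, f i a ≠ f j b) (hg : ∀ i j, i ≠ j → ∀ a b, g i a ≠ g j b)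
    (c : List (Instr W Q)) (j : ι) {l : List ι} (hl : l.Nodup) :
    Restricts (f j) (g j) (l.flatMap fun i => c.map (Instr.ren (f i) (g i)))
      (if j ∈ l then c else []) := by
  induction l with
  | nil => exact .nil
  | cons i l ih =>
    rw [List.nodup_cons] at hl
    have ih' := ih hl.2
    rw [List.flatMap_cons]
    by_cases h : j = i
    · subst h
      rw [if_neg hl.1] at ih'
      simpa using (Restricts.map_ren (f j) (g j) c).append ih'
    · have := (Restricts.map_ren_of_disjoint (hf j i h) (hg j i h) c).append ih'
      simpa [h] using this

theorem sum_errorFn_slice [Fintype Q] (f : W → W') (g : Q ↪ Q') (q : Q) (v : Bool → Ket) (o : W)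
    (γ : Branch W' Q') :
    ∑ y, errorFn q v o (γ.slice f g y) =
      (Fintype.card (Q → Bool) : ℝ) * errorFn (g q) v (f o) γ := by
  rw [errorFn, ← sum_normSq_slice g]
  refine Finset.sum_congr rfl fun y _ => ?_
  have : ∀ a, slice g y (projOn (g q) (v (γ.store (f o))) a) =
      projOn q (v (γ.store (f o))) (slice g y a) := by
    intro a; funext x
    simp [slice, projOn, extend_update, g.injective.extend_apply]
  simp only [errorFn, Branch.slice, Function.comp_apply, ← this]
  rfl

/-- The initial state is a product state, so all its slices are multiples of the initial state of
the subsystem. -/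
theorem slice_init [Fintype Q] (g : Q ↪ Q') (y : Q' → Bool) :
    ∃ c : ℂ, slice g y (fun x : Q' → Bool => if x = fun _ => false then 1 else 0) =
      c • fun x : Q → Bool => if x = fun _ => false then 1 else 0 := by
  refine ⟨if ∀ p, (∀ q, g q ≠ p) → y p = false then 1 else 0, ?_⟩
  funext x
  have hiff : (Function.extend g x y = fun _ => false) ↔
      (x = fun _ => false) ∧ ∀ p, (∀ q, g q ≠ p) → y p = false := by
    constructor
    · intro h
      refine ⟨?_, ?_⟩
      · funext q
        rw [← g.injective.extend_apply x y q, h]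
      · intro p hp
        rw [← congrFun h p, Function.extend_apply' _ _ _ (by rintro ⟨q, hq⟩; exact hp q hq)]
    · rintro ⟨rfl, h⟩
      funext p
      by_cases hp : ∃ q, g q = p
      · obtain ⟨q, rfl⟩ := hp
        rw [g.injective.extend_apply]
      · rw [Function.extend_apply' _ _ _ hp]
        exact h p fun q hq => hp ⟨q, hq⟩
  simp only [slice, hiff, Pi.smul_apply, smul_eq_mul]
  split_ifs <;> simp_all

theorem normSq_init : normSq (fun x : Q' → Bool => if x = fun _ => false then 1 else 0) = 1 := by
  unfold normSq
  rw [Finset.sum_eq_single (fun _ => false)]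
  · simp
  · intro x _ hx; simp [hx]
  · simp

/-- A subsystem that starts in its initial state behaves as if it were alone. -/
theorem Restricts.val_errorFn [Fintype Q] {f : W → W'} (hf : Function.Injective f) {g : Q ↪ Q'}
    {c' c} (h : Restricts f g c' c) (q : Q) (v : Bool → Ket) (o : W) (σ : W' → Bool) :
    val c' (errorFn (g q) v (f o)) ⟨σ, fun x => if x = fun _ => false then 1 else 0⟩ =
      val c (errorFn q v o) ⟨σ ∘ f, fun x => if x = fun _ => false then 1 else 0⟩ := by
  have hcard : (Fintype.card (Q → Bool) : ℝ) ≠ 0 := by exact_mod_cast Fintype.card_ne_zero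
  have h1 := h.val_eq hf (isQuad_errorFn q v o)
    ⟨σ, fun x => if x = fun _ => false then 1 else 0⟩
  simp only [sum_errorFn_slice, val_const_mul] at h1
  choose z hz using fun y => slice_init g y
  have h2 := sum_normSq_slice g (fun x => if x = fun _ => false then 1 else 0)
  simp only [hz, normSq_init, mul_one] at h2
  have h3 : ∀ y, normSq (z y • fun x : Q → Bool => if x = fun _ => false then (1 : ℂ) else 0) =
      ‖z y‖ ^ 2 := by
    intro y
    have := (isQuad_normSq (W := W) (Q := Q)).smul (fun _ => false) (z y)
      (fun x => if x = fun _ => false then 1 else 0)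
    rw [this, normSq_init, mul_one]
  simp only [h3] at h2
  simp only [Branch.slice, hz, ((isQuad_errorFn q v o).val c).smul, ← Finset.sum_mul, h2] at h1
  exact mul_left_cancel₀ hcard h1

theorem Phase.tGate_of_ne {q q' : Q} (h : q ≠ q') {z : ℂ} {a : Amp Q} (ha : Phase q z a) :
    Phase q z ((QubitGate.tGate q').apply a) := by
  intro x
  simp only [QubitGate.apply, Function.update_of_ne h.symm, ha x]
  ring

theorem Phase.apply_ren {q : Q'} {z : ℂ} {a : Amp Q'} (ha : Phase q z a) {g : Q ↪ Q'}
    (hg : ∀ p, g p ≠ q) (u : QubitGate Q) : Phase q z ((u.ren g).apply a) := by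
  cases u with
  | hadamard p => exact ha.hadamard_of_ne (hg p).symm
  | tGate p => exact ha.tGate_of_ne (hg p).symm
  | cnot p p' h => exact ha.cnot_of_ne (hg p').symm (hg p).symm _

/-- Used to see that the sessions leave the control wires at 0, the sender's input in place and the
accumulator in `|0⟩`. -/
theorem step_ren_invariant {f : W → W'} {g : Q ↪ Q'} (i : Instr W Q) {β γ : Branch W' Q'}
    (hγ : γ ∈ (i.ren f g).step β) :
    (∀ w, (∀ u, f u ≠ w) → γ.store w = β.store w) ∧
      ∀ q z, (∀ p, g p ≠ q) → Phase q z β.amp → Phase q z γ.amp := by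
  have hup : ∀ (s : W' → Bool) w v u, (∀ u, f u ≠ w) → Function.update s (f u) v w = s w :=
    fun s w v u h => Function.update_of_ne (h u).symm _ _
  rcases i with (⟨w, v⟩ | ⟨u, v, w⟩ | ⟨w⟩) | u | ⟨w, u⟩ | ⟨q, w⟩ <;>
    simp only [Instr.ren, Instr.step, BitGate.step, BitGate.map, List.map_cons, List.map_nil,
      List.mem_cons, List.not_mem_nil, or_false] at hγ
  · subst hγ
    exact ⟨fun w' h => hup _ _ _ _ h, fun _ _ _ h => h⟩
  · subst hγ
    exact ⟨fun w' h => hup _ _ _ _ h, fun _ _ _ h => h⟩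
  · have hc : ∀ q z (a : Amp Q'), Phase q z a →
        Phase q z (fun x => a x / (Real.sqrt 2 : ℂ)) := by
      intro q z a h x
      simp only [h x, mul_div_assoc]
    rcases hγ with rfl | rfl
    · exact ⟨fun w' h => hup _ _ _ _ h, fun _ _ _ h => hc _ _ _ h⟩
    · exact ⟨fun w' h => hup _ _ _ _ h, fun _ _ _ h => hc _ _ _ h⟩
  · subst hγ
    exact ⟨fun _ _ => rfl, fun _ _ hq h => h.apply_ren hq u⟩
  · subst hγ
    refine ⟨fun _ _ => rfl, fun _ _ hq h => ?_⟩
    simp only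
    split_ifs
    · exact h.apply_ren hq u
    · exact h
  · rcases hγ with rfl | rfl
    · exact ⟨fun w' h => hup _ _ _ _ h, fun _ _ hq h => h.restrictTo_of_ne (hq q).symm false⟩
    · exact ⟨fun w' h => hup _ _ _ _ h, fun _ _ hq h => h.restrictTo_of_ne (hq q).symm true⟩

end RestrictsSessions

/-! ### From the errors of the sessions to the error of the repeated protocol -/

section Correctness

variable {M : Type} [DecidableEq M]

theorem correctness_le_one (S : Sender M) (R : QubitReceiver M) (b : Bool) {v : Bool → Ket}
    (hv : ∀ s, ‖v s false‖ ^ 2 + ‖v s true‖ ^ 2 = 1) : correctness S R b v ≤ 1 := by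
  have h := val_normSq (interleave (senderTurns S R.toReceiver) (receiverTurns S R.toReceiver))
    (initBranch S R.toReceiver b)
  rw [show normSq (initBranch S R.toReceiver b).amp = 1 from normSq_init] at h
  rw [← h]
  refine val_mono _ (fun β => ?_) _
  have h1 := normSq_projOn_add (hv (β.store (Sum.inl S.out))) R.out β.amp
  have h2 := normSq_nonneg (β.amp - projOn R.out (v (β.store (Sum.inl S.out))) β.amp)
  have h3 := Real.mul_self_sqrt (normSq_nonneg β.amp)
  rw [← h3]
  exact mul_le_mul_of_nonneg_left (Real.sqrt_le_sqrt (by linarith)) (Real.sqrt_nonneg _)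

theorem val_errorFn_le (S : Sender M) (R : QubitReceiver M) (b : Bool) {v : Bool → Ket}
    (hv : ∀ s, ‖v s false‖ ^ 2 + ‖v s true‖ ^ 2 = 1) :
    val (interleave (senderTurns S R.toReceiver) (receiverTurns S R.toReceiver))
      (errorFn R.out v (Sum.inl S.out)) (initBranch S R.toReceiver b) ≤
        2 * (1 - correctness S R b v) := by
  have h := val_normSq (interleave (senderTurns S R.toReceiver) (receiverTurns S R.toReceiver))
    (initBranch S R.toReceiver b)
  rw [show normSq (initBranch S R.toReceiver b).amp = 1 from normSq_init] at h
  have h2 := val_mono (interleave (senderTurns S R.toReceiver) (receiverTurns S R.toReceiver))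
    (errorFn_add_le hv R.out (Sum.inl S.out)) (initBranch S R.toReceiver b)
  rw [val_add, val_const_mul, val_const_mul, h] at h2
  have h3 : correctness S R b v = val (interleave (senderTurns S R.toReceiver)
      (receiverTurns S R.toReceiver)) (fun β => stateNorm β.amp *
        stateNorm (projOn R.out (v (β.store (Sum.inl S.out))) β.amp))
      (initBranch S R.toReceiver b) := rfl
  rw [h3]
  linarith

theorem one_sub_correctness_le (S : Sender M) (R : QubitReceiver M) (b : Bool) {v : Bool → Ket}
    (hv : ∀ s, ‖v s false‖ ^ 2 + ‖v s true‖ ^ 2 = 1) :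
    1 - correctness S R b v ≤
      val (interleave (senderTurns S R.toReceiver) (receiverTurns S R.toReceiver))
        (errorFn R.out v (Sum.inl S.out)) (initBranch S R.toReceiver b) := by
  have h := val_normSq (interleave (senderTurns S R.toReceiver) (receiverTurns S R.toReceiver))
    (initBranch S R.toReceiver b)
  rw [show normSq (initBranch S R.toReceiver b).amp = 1 from normSq_init] at h
  have h2 := val_mono (interleave (senderTurns S R.toReceiver) (receiverTurns S R.toReceiver))
    (fun β => sub_le_iff_le_add'.1 (normSq_sub_errorFn_le hv R.out (Sum.inl S.out) β))
    (initBranch S R.toReceiver b)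
  rw [val_add, h] at h2
  have h3 : correctness S R b v = val (interleave (senderTurns S R.toReceiver)
      (receiverTurns S R.toReceiver)) (fun β => stateNorm β.amp *
        stateNorm (projOn R.out (v (β.store (Sum.inl S.out))) β.amp))
      (initBranch S R.toReceiver b) := rfl
  rw [h3]
  linarith

variable (S : Sender M) (R : QubitReceiver M) (m d : ℕ) (e : ℤ) (L : ℕ)

theorem sessionQubit_ne {i j : Fin (m + 1)} (h : i ≠ j) (a b : R.Qubits) :
    sessionQubit R m d L i a ≠ sessionQubit R m d L j b := fun hh =>
  h (Prod.mk.inj (Option.some.inj hh)).1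

theorem restricts_sessions (hS : S.turns.length ≤ L + 1) (hR : R.turns.length ≤ L + 1)
    (j : Fin (m + 1)) :
    Restricts (jointWire S R m d e L j) (sessionQubit R m d L j) (sessions S R m d e L)
      (interleave (senderTurns S R.toReceiver) (receiverTurns S R.toReceiver)) := by
  rw [interleave_eq_flatMap (L + 1) _ _ (by simpa [senderTurns] using hS)
    (by simpa [receiverTurns] using hR)]
  refine Restricts.flatMap (fun t => Restricts.append ?_ ?_) _
  · have := restricts_copies (f := jointWire S R m d e L) (g := sessionQubit R m d L)
      (fun i j h => jointWire_ne S R m d e L h) (fun i j h => sessionQubit_ne R m d L h)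
      ((senderTurns S R.toReceiver).getD t []) j (List.nodup_finRange (m + 1))
    simpa using this
  · have := restricts_copies (f := jointWire S R m d e L) (g := sessionQubit R m d L)
      (fun i j h => jointWire_ne S R m d e L h) (fun i j h => sessionQubit_ne R m d L h)
      ((receiverTurns S R.toReceiver).getD t []) j (List.nodup_finRange (m + 1))
    simpa using this

theorem sessions_invariant {β : Branch (JointBits (S.copies m d e L) (R.copies m d L).toReceiver)
      (R.copies m d L).Qubits} :
    ∀ γ ∈ exec (sessions S R m d e L) β,
      (∀ w, (∀ j u, jointWire S R m d e L j u ≠ w) → γ.store w = β.store w) ∧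
        ∀ q z, (∀ j p, sessionQubit R m d L j p ≠ q) → Phase q z β.amp → Phase q z γ.amp := by
  refine exec_invariant (fun γ =>
    (∀ w, (∀ j u, jointWire S R m d e L j u ≠ w) → γ.store w = β.store w) ∧
      ∀ q z, (∀ j p, sessionQubit R m d L j p ≠ q) → Phase q z β.amp → Phase q z γ.amp) ?_
    ⟨fun _ _ => rfl, fun _ _ _ h => h⟩
  intro i hi γ hγ δ hδ
  have hi' : ∃ j i₀, i = Instr.ren (jointWire S R m d e L j) (sessionQubit R m d L j) i₀ := by
    simp only [sessions, List.mem_flatMap, List.mem_append, List.mem_map] at hi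
    obtain ⟨t, -, ⟨j, -, i₀, -, rfl⟩ | ⟨j, -, i₀, -, rfl⟩⟩ := hi
    · exact ⟨j, i₀, rfl⟩
    · exact ⟨j, i₀, rfl⟩
  obtain ⟨j, i₀, rfl⟩ := hi'
  obtain ⟨h1, h2⟩ := step_ren_invariant i₀ hδ
  exact ⟨fun w hw => (h1 w (hw j)).trans (hγ.1 w hw),
    fun q z hq h => h2 q z (hq j) (hγ.2 q z hq h)⟩

end Correctness

theorem initBranch_store_inp {M : Type} [DecidableEq M] (S : Sender M) (R : Receiver M) (b : Bool) :
    (initBranch S R b).store (Sum.inl S.inp) = b := by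
  simp [initBranch]

theorem initBranch_store_of_ne {M : Type} [DecidableEq M] (S : Sender M) (R : Receiver M) (b : Bool)
    {w : JointBits S R} (hw : w ≠ Sum.inl S.inp) : (initBranch S R b).store w = false := by
  simp [initBranch, hw]

section Correctness

variable {M : Type} [DecidableEq M] (S : Sender M) (R : QubitReceiver M) (m d : ℕ) (e : ℤ) (L : ℕ)

theorem auxWire_injective : Function.Injective (auxWire S R m d e L) := fun _ _ h =>
  Sum.inr.inj (Sum.inl.inj h)

theorem ctlWire_injective : Function.Injective (ctlWire S R m d e L) := fun _ _ h =>
  Sum.inr.inj (Sum.inl.inj (Sum.inr.inj h))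

theorem jointWire_ne_auxWire (j : Fin (m + 1)) (u) (c : Aux) :
    jointWire S R m d e L j u ≠ auxWire S R m d e L c := by
  rcases u with u | u | u <;> intro h
  · exact Sum.inl_ne_inr (Sum.inl.inj h)
  · exact Sum.inr_ne_inl h
  · exact Sum.inr_ne_inl h

theorem jointWire_ne_ctlWire (j : Fin (m + 1)) (u) (c : Ctl) :
    jointWire S R m d e L j u ≠ ctlWire S R m d e L c := by
  rcases u with u | u | u <;> intro h
  · exact Sum.inl_ne_inr h
  · exact Sum.inl_ne_inr (Sum.inl.inj (Sum.inr.inj h))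
  · exact Sum.inr_ne_inl (Sum.inr.inj h)

theorem ofNat_ne_of_lt {i j : ℕ} (hij : i < j) (hj : j < m + 1) :
    Fin.ofNat (m + 1) i ≠ Fin.ofNat (m + 1) j := by
  intro h
  have := congrArg Fin.val h
  simp only [Fin.ofNat, Nat.mod_eq_of_lt hj, Nat.mod_eq_of_lt (hij.trans hj)] at this
  omega

/-- After the input has been copied, each session is in the initial state of the protocol. -/
theorem exec_copyInput_init (b : Bool) :
    ∃ σ, exec ((copyInput (auxWire S R m d e L) (inputWires S R m d e L)).map Instr.bit)
        (initBranch (S.copies m d e L) (R.copies m d L).toReceiver b) =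
        [⟨σ, (initBranch (S.copies m d e L) (R.copies m d L).toReceiver b).amp⟩] ∧
      (∀ j, σ ∘ jointWire S R m d e L j = (initBranch S R.toReceiver b).store) ∧
      (∀ c, σ (ctlWire S R m d e L c) = false) ∧
      σ (auxWire S R m d e L .inp) = b := by
  have hmem : ∀ v, v ∈ inputWires S R m d e L ↔
      ∃ j, jointWire S R m d e L j (Sum.inl S.inp) = v := by
    intro v
    simp only [inputWires, List.mem_map, List.mem_finRange, true_and]
    rfl
  obtain ⟨σ, h1, h2, h3⟩ := exec_copyInput (auxWire S R m d e L) (inputWires S R m d e L) (by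
    intro v hv
    obtain ⟨j, rfl⟩ := (hmem v).1 hv
    exact jointWire_ne_auxWire S R m d e L _ _ _)
    (initBranch (S.copies m d e L) (R.copies m d L).toReceiver b).store
    (initBranch (S.copies m d e L) (R.copies m d L).toReceiver b).amp
  have hb : (initBranch (S.copies m d e L) (R.copies m d L).toReceiver b).store
      (auxWire S R m d e L .inp) = b := initBranch_store_inp _ _ b
  have h0 : ∀ v, v ≠ auxWire S R m d e L .inp →
      (initBranch (S.copies m d e L) (R.copies m d L).toReceiver b).store v = false :=
    fun v hv => initBranch_store_of_ne _ _ b hv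
  refine ⟨σ, h1, ?_, ?_, ?_⟩
  · intro j
    funext u
    by_cases hu : u = Sum.inl S.inp
    · subst hu
      rw [Function.comp_apply, h2 _ ((hmem _).2 ⟨j, rfl⟩), hb]
      exact (initBranch_store_inp _ _ b).symm
    · rw [Function.comp_apply, h3, h0 _ (jointWire_ne_auxWire S R m d e L _ _ _)]
      · exact (initBranch_store_of_ne _ _ b hu).symm
      · intro h
        obtain ⟨i, hi⟩ := (hmem _).1 h
        by_cases hij : i = j
        · subst hij
          exact hu (jointWire_injective S R m d e L i hi).symm
        · exact jointWire_ne S R m d e L hij _ _ hi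
      · exact jointWire_ne_auxWire S R m d e L _ _ _
  · intro c
    have hca : ∀ c', ctlWire S R m d e L c ≠ auxWire S R m d e L c' := fun c' => Sum.inr_ne_inl
    rw [h3 _ _ (hca _), h0 _ (hca _)]
    intro h
    obtain ⟨i, hi⟩ := (hmem _).1 h
    exact jointWire_ne_ctlWire S R m d e L _ _ _ hi
  · rw [h3 _ _ ((auxWire_injective S R m d e L).ne (by simp)), hb]
    intro h
    obtain ⟨i, hi⟩ := (hmem _).1 h
    exact jointWire_ne_auxWire S R m d e L _ _ _ hi

theorem phase_init {Q : Type} [Fintype Q] [DecidableEq Q] (q : Q) :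
    Phase q 0 (fun x : Q → Bool => if x = fun _ => false then 1 else 0) := by
  intro x
  have : Function.update x q true ≠ fun _ => false := by
    intro h; simpa using congrFun h q
  simp [this]

/-- In each branch after the sessions, split the state into its projection on the ideal session
qubits and the rest. The first part is bounded by the absorption estimate, the second by the sum of
the session errors. -/
theorem one_sub_correctness_copies_le (hS : S.turns.length ≤ L + 1) (hR : R.turns.length ≤ L + 1)
    (hd : 1 ≤ d) (he : |e| = d) {ε : ℝ} (b : Bool)
    (hε : ∀ k : ℤ, |k| = d →
      angle ε b ^ k = sgn (b && decide (k = e)) * if b then Complex.I else 1) :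
    1 - correctness (S.copies m d e L) (R.copies m d L) b (stdKet b) ≤
      4 * (1 - 1 / (2 * (d : ℝ) ^ 2)) ^ (m + 1) +
        4 * (m + 1) * (1 - correctness S R b (angleKet ε b)) := by
  obtain ⟨σ, hcopy, hσj, hσc, hσb⟩ := exec_copyInput_init S R m d e L b
  refine (one_sub_correctness_le _ _ b (stdKet_unit b)).trans ?_
  rw [interleave_copies, val_append, val_of_exec_eq hcopy, val_append]
  set ρ : ℝ := (1 - 1 / (2 * (d : ℝ) ^ 2)) ^ (m + 1) with hρ
  set β₁ : Branch (JointBits (S.copies m d e L) (R.copies m d L).toReceiver)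
    (R.copies m d L).Qubits :=
    ⟨σ, (initBranch (S.copies m d e L) (R.copies m d L).toReceiver b).amp⟩ with hβ₁
  set tail := combine (ctlWire S R m d e L) (R.copies m d L).out (outQubit R m d L)
          (out_ne_outQubit R m d L) d (m + 1) ++
        (sumAnd (auxWire S R m d e L) (signPairs (ctlWire S R m d e L) (outWire S R m d e L)
          (auxWire S R m d e L .inp) d (m + 1) e)).map Instr.bit with htail
  set E := errorFn (W := JointBits (S.copies m d e L) (R.copies m d L).toReceiver)
    (R.copies m d L).out (stdKet b) (Sum.inl (S.copies m d e L).out) with hE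
  set err : Fin (m + 1) → Branch (JointBits (S.copies m d e L) (R.copies m d L).toReceiver)
    (R.copies m d L).Qubits → ℝ := fun j => errorFn (sessionQubit R m d L j R.out) (angleKet ε b)
      (jointWire S R m d e L j (Sum.inl S.out)) with herr
  have hGquad : IsQuad (val tail E) := (isQuad_errorFn _ _ _).val tail
  have hGle : ∀ γ, val tail E γ ≤ normSq γ.amp := fun γ => by
    rw [← val_normSq tail γ]
    exact val_mono _ (errorFn_le (stdKet_unit b) _ _) γ
  have hbranch : ∀ γ ∈ exec (sessions S R m d e L) β₁,
      val tail E γ ≤ 4 * ρ * normSq γ.amp + 2 * ∑ j, err j γ := by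
    intro γ hγ
    obtain ⟨hstore, hph⟩ := sessions_invariant S R m d e L γ hγ
    obtain ⟨τ, a⟩ := γ
    set l : List ((R.copies m d L).Qubits × Ket) := (List.finRange (m + 1)).map fun j =>
      (sessionQubit R m d L j R.out,
        angleKet ε b (τ (jointWire S R m d e L j (Sum.inl S.out)))) with hl
    have hlunit : ∀ p ∈ l, ‖p.2 false‖ ^ 2 + ‖p.2 true‖ ^ 2 = 1 := by
      intro p hp
      simp only [hl, List.mem_map] at hp
      obtain ⟨j, -, rfl⟩ := hp
      exact angleKet_unit ε b _
    have hlnodup : (l.map Prod.fst).Nodup := by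
      rw [hl, List.map_map]
      refine (List.nodup_finRange _).map fun i j h => ?_
      by_contra hij
      exact sessionQubit_ne R m d L hij _ _ h
    -- The projections use the sender's outputs recorded in this very branch, so every session qubit
    -- has the right sign and phase.
    have hideal : val tail E ⟨τ, projAll l a⟩ ≤ 2 * ρ * normSq (projAll l a) := by
      refine val_combine_le (b := b) (w := angle ε b) (auxWire_injective S R m d e L)
        (fun c c' => Sum.inr_ne_inl)
        (fun j c h => Sum.inl_ne_inr (Sum.inl.inj h)) (ctlWire_injective S R m d e L)
        (fun j c => Sum.inl_ne_inr) (out_ne_outQubit R m d L) ?_ he (norm_angle ε b) hε hd ?_ ?_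
        ?_ ?_
      · intro i j hij hj h
        exact ofNat_ne_of_lt m hij hj (Prod.mk.inj (Option.some.inj h)).1
      · intro c
        rw [← hσc c]
        exact hstore _ fun j u => jointWire_ne_ctlWire S R m d e L j u c
      · rw [← hσb]
        exact hstore _ fun j u => jointWire_ne_auxWire S R m d e L j u _
      · refine Phase.projAll_of_notMem (hph _ _ (fun j p h => ?_) (phase_init _)) l ?_
        · cases h
        · intro p hp h
          simp only [hl, List.mem_map] at hp
          obtain ⟨j, -, rfl⟩ := hp
          cases h
      · intro j _
        exact phase_projAll (p := (sessionQubit R m d L (Fin.ofNat (m + 1) j) R.out,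
          angleKet ε b (τ (jointWire S R m d e L (Fin.ofNat (m + 1) j) (Sum.inl S.out)))))
          hlnodup (by rw [hl]; exact List.mem_map_of_mem (List.mem_finRange _))
          (angleKet_true ε b _) a
    have hrest : normSq (a - projAll l a) ≤ ∑ j, err j ⟨τ, a⟩ := by
      refine (normSq_sub_projAll_le l hlunit a).trans_eq ?_
      rw [hl, List.map_map, Fin.sum_univ_def]
      rfl
    -- The error after the remaining circuit is quadratic in the amplitudes; splitting doubles both
    -- contributions.
    have h1 := hGquad.add_le τ (projAll l a) (a - projAll l a)
    rw [add_sub_cancel] at h1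
    have h2 := hGle ⟨τ, a - projAll l a⟩
    have h3 := normSq_projAll_le l hlunit a
    have hρ0 : 0 ≤ ρ := by
      have : (1 : ℝ) ≤ d := by exact_mod_cast hd
      refine pow_nonneg ?_ _
      rw [sub_nonneg, div_le_one (by positivity)]
      nlinarith
    have h4 := mul_le_mul_of_nonneg_left h3 hρ0
    simp only at h2 ⊢
    linarith
  refine (val_mono_on _ hbranch).trans ?_
  rw [val_add, val_const_mul, val_const_mul, val_finset_sum, val_normSq]
  have hone : normSq β₁.amp = 1 := normSq_init
  -- Session `j` behaves as a single run; the factor 2 is the passage from the correctness measure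
  -- to the quadratic error.
  have herrj : ∀ j, val (sessions S R m d e L) (err j) β₁ ≤
      2 * (1 - correctness S R b (angleKet ε b)) := by
    intro j
    have h := (restricts_sessions S R m d e L hS hR j).val_errorFn
      (jointWire_injective S R m d e L j) R.out (angleKet ε b) (Sum.inl S.out) σ
    rw [hσj] at h
    exact h.trans_le (val_errorFn_le S R b (angleKet_unit ε b))
  have hsum := Finset.sum_le_sum fun j (_ : j ∈ Finset.univ) => herrj j
  rw [Finset.sum_const, Finset.card_univ, Fintype.card_fin, nsmul_eq_mul] at hsum
  rw [hone]
  push_cast at hsum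
  linarith

end Correctness

/-! ### Circuits with the same statistics -/

section Equivalence

variable {W Q : Type} [DecidableEq W] [DecidableEq Q]

/-- Two circuits have the same statistics. -/
def VEq (c c' : List (Instr W Q)) : Prop := ∀ F : Branch W Q → ℝ, val c F = val c' F

theorem VEq.refl (c : List (Instr W Q)) : VEq c c := fun _ => rfl

theorem VEq.trans {c c' c'' : List (Instr W Q)} (h : VEq c c') (h' : VEq c' c'') : VEq c c'' :=
  fun F => (h F).trans (h' F)

theorem VEq.append {c₁ c₁' c₂ c₂' : List (Instr W Q)} (h₁ : VEq c₁ c₁') (h₂ : VEq c₂ c₂') :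
    VEq (c₁ ++ c₂) (c₁' ++ c₂') := fun F => by
  rw [val_append, val_append, h₂ F, h₁]

theorem VEq.flatMap {ι : Type*} {X Y : ι → List (Instr W Q)} (l : List ι)
    (h : ∀ t ∈ l, VEq (X t) (Y t)) : VEq (l.flatMap X) (l.flatMap Y) := by
  induction l with
  | nil => exact VEq.refl _
  | cons t l ih =>
    exact (h t List.mem_cons_self).append (ih fun s hs => h s (List.mem_cons_of_mem _ hs))

theorem vEq_append_flatMap {ι : Type*} {c : List (Instr W Q)} {X : ι → List (Instr W Q)}
    (l : List ι) (h : ∀ j ∈ l, VEq (c ++ X j) (X j ++ c)) :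
    VEq (c ++ l.flatMap X) (l.flatMap X ++ c) := by
  induction l with
  | nil => simpa using VEq.refl c
  | cons j l ih =>
    have h1 := (h j List.mem_cons_self).append (VEq.refl (l.flatMap X))
    have h2 := (VEq.refl (X j)).append (ih fun s hs => h s (List.mem_cons_of_mem _ hs))
    simp only [List.flatMap_cons, List.append_assoc] at h1 h2 ⊢
    exact h1.trans h2

/-- Pairwise commutation lets one session be moved to the front of a round. -/
theorem vEq_flatMap_of_perm {ι : Type*} {X : ι → List (Instr W Q)}
    (h : ∀ i j, i ≠ j → VEq (X i ++ X j) (X j ++ X i)) {l l' : List ι} (hl : l.Perm l') :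
    VEq (l.flatMap X) (l'.flatMap X) := by
  induction hl with
  | nil => exact VEq.refl _
  | cons i _ ih => exact (VEq.refl (X i)).append ih
  | swap i j l =>
    have : VEq (X j ++ X i) (X i ++ X j) := by
      by_cases hij : j = i
      · subst hij; exact VEq.refl _
      · exact h j i hij
    simpa [List.flatMap_cons] using this.append (VEq.refl (l.flatMap X))
  | trans _ _ h1 h2 => exact h1.trans h2

variable {A B : Type} {f : A → W} {f' : B → W}

/-- Exchanging two coins permutes the list of branches, so only sums over the branches agree, not
the lists. -/
theorem vEq_bit_bit (hf : ∀ a b, f a ≠ f' b) (g : BitGate A) (g' : BitGate B) :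
    VEq (Q := Q) [.bit (g.map f), .bit (g'.map f')] [.bit (g'.map f'), .bit (g.map f)] := by
  have h1 : ∀ (s : W → Bool) a b v, Function.update s (f a) v (f' b) = s (f' b) :=
    fun s a b v => Function.update_of_ne (hf a b).symm _ _
  have h2 : ∀ (s : W → Bool) a b v, Function.update s (f' b) v (f a) = s (f a) :=
    fun s a b v => Function.update_of_ne (hf a b) _ _
  have h3 : ∀ (s : W → Bool) a b v v', Function.update (Function.update s (f a) v) (f' b) v' =
      Function.update (Function.update s (f' b) v') (f a) v :=
    fun s a b v v' => Function.update_comm (hf a b) _ _ _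
  intro F
  funext β
  cases g <;> cases g' <;>
    simp only [val_cons, val_nil, Instr.step, BitGate.step, BitGate.map, List.map_cons,
      List.map_nil, List.sum_cons, List.sum_nil, h1, h2, h3]
  all_goals ring

theorem vEq_bits_bits (hf : ∀ a b, f a ≠ f' b) (l : List (BitGate A)) (l' : List (BitGate B)) :
    VEq (Q := Q) (l.map (fun g => .bit (g.map f)) ++ l'.map (fun g => .bit (g.map f')))
      (l'.map (fun g => .bit (g.map f')) ++ l.map (fun g => .bit (g.map f))) := by
  have single : ∀ g : BitGate A, VEq (Q := Q) ([.bit (g.map f)] ++ l'.map fun g => .bit (g.map f'))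
      (l'.map (fun g => .bit (g.map f')) ++ [.bit (g.map f)]) := by
    intro g
    rw [List.map_eq_flatMap]
    exact vEq_append_flatMap l' fun g' _ => vEq_bit_bit hf g g'
  induction l with
  | nil => simpa using VEq.refl _
  | cons g l ih =>
    have h1 := (VEq.refl (Q := Q) [Instr.bit (g.map f)]).append ih
    have h2 := (single g).append (VEq.refl (Q := Q) (l.map fun g => .bit (g.map f)))
    simp only [List.map_cons, List.append_assoc, List.cons_append, List.nil_append] at h1 h2 ⊢
    exact h1.trans h2

end Equivalence

/-! ### Forgetting classical wires -/

section Pull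

variable {W W' Q : Type} [DecidableEq W] [DecidableEq W'] [DecidableEq Q]

/-- The restriction of a branch to some of the classical wires. -/
def Branch.pull (f : W → W') (β : Branch W' Q) : Branch W Q := ⟨β.store ∘ f, β.amp⟩

/-- On the wires in the range of `f`, the circuit `c'` acts as the circuit `c`. -/
def Pulls (f : W → W') (c' : List (Instr W' Q)) (c : List (Instr W Q)) : Prop :=
  ∀ β, (exec c' β).map (Branch.pull f) = exec c (β.pull f)

theorem Pulls.val_eq {f : W → W'} {c' : List (Instr W' Q)} {c : List (Instr W Q)}
    (h : Pulls f c' c) (F : Branch W Q → ℝ) (β : Branch W' Q) :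
    val c' (fun γ => F (γ.pull f)) β = val c F (β.pull f) := by
  rw [val, val, ← h, List.map_map]; rfl

theorem Pulls.nil (f : W → W') : Pulls (Q := Q) f [] [] := fun _ => rfl

theorem Pulls.append {f : W → W'} {c₁' c₂' : List (Instr W' Q)} {c₁ c₂ : List (Instr W Q)}
    (h₁ : Pulls f c₁' c₁) (h₂ : Pulls f c₂' c₂) : Pulls f (c₁' ++ c₂') (c₁ ++ c₂) := by
  intro β
  rw [exec_append, exec_append, ← h₁, List.map_flatMap, List.flatMap_map]
  congr 1
  funext γ
  exact h₂ γ

theorem Pulls.flatMap {ι : Type*} {f : W → W'} {X : ι → List (Instr W' Q)}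
    {Y : ι → List (Instr W Q)} (l : List ι) (h : ∀ t ∈ l, Pulls f (X t) (Y t)) :
    Pulls f (l.flatMap X) (l.flatMap Y) := by
  induction l with
  | nil => exact Pulls.nil f
  | cons t l ih =>
    exact (h t List.mem_cons_self).append (ih fun s hs => h s (List.mem_cons_of_mem _ hs))

theorem step_map_pull {f : W → W'} (hf : Function.Injective f) (i : Instr W Q)
    (β : Branch W' Q) : ((i.map f).step β).map (Branch.pull f) = i.step (β.pull f) := by
  rcases i with (⟨w, v⟩ | ⟨u, v, w⟩ | ⟨w⟩) | u | ⟨w, u⟩ | ⟨q, w⟩ <;>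
    simp [Instr.map, Instr.step, BitGate.step, Branch.pull, BitGate.map,
      update_comp_injective hf]
  rfl

theorem pulls_map {f : W → W'} (hf : Function.Injective f) (c : List (Instr W Q)) :
    Pulls f (c.map (Instr.map f)) c := by
  induction c with
  | nil => exact Pulls.nil f
  | cons i c ih =>
    intro β
    rw [List.map_cons, exec, exec, ← step_map_pull hf, List.map_flatMap, List.flatMap_map]
    congr 1
    funext γ
    exact ih γ

/-- Deterministic gates that write to other wires can be dropped. -/
theorem pulls_nil_of_forall {f : W → W'} (c : List (BitGate W'))
    (h : ∀ g ∈ c, (∃ w v, g = .set w v ∧ ∀ u, f u ≠ w) ∨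
      ∃ u v w, g = .nand u v w ∧ ∀ u, f u ≠ w) :
    Pulls (Q := Q) f (c.map Instr.bit) [] := by
  induction c with
  | nil => exact Pulls.nil f
  | cons g c ih =>
    have ih' := ih fun g hg => h g (List.mem_cons_of_mem _ hg)
    intro β
    obtain ⟨w, v, rfl, hw⟩ | ⟨u, v, w, rfl, hw⟩ := h g List.mem_cons_self
    · have := ih' ⟨Function.update β.store w v, β.amp⟩
      simpa [exec, Instr.step, BitGate.step, Branch.pull, update_comp_of_ne hw] using this
    · have := ih' ⟨Function.update β.store w (!(β.store u && β.store v)), β.amp⟩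
      simpa [exec, Instr.step, BitGate.step, Branch.pull, update_comp_of_ne hw] using this

end Pull

/-- The probability of the branch if the wire `w` carries `0`. -/
def zeroMass {W Q : Type} [DecidableEq Q] [Fintype Q] (w : W) (β : Branch W Q) : ℝ :=
  if β.store w = false then normSq β.amp else 0

theorem interleave_append_cons {I : Type} (c s : List I) (ss rs : List (List I)) :
    interleave ((c ++ s) :: ss) rs = c ++ interleave (s :: ss) rs := by
  cases rs <;> simp [interleave]

/-! ### The hybrid experiment with separate inputs for the sessions -/

section Hybrid

variable {M : Type} [DecidableEq M] (S : Sender M) (m d : ℕ) (e : ℤ) (L : ℕ)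
  (A : Adversary (CopyMsg M m))

/-- The classical wires of the sessions and the adversary. -/
abbrev HybridWires : Type := (Fin (m + 1) × S.Bits) ⊕ (CopyMsg M m ⊕ A.Bits)

/-- The wires of the sender in the session `j`. -/
def hybridSender (j : Fin (m + 1)) : S.Bits ⊕ M → HybridWires S m A :=
  Sum.elim (fun w => .inl (j, w)) fun x => .inr (.inl (.inl (j, x)))

/-- The wires of the adversary. -/
def hybridAdversary : A.Bits ⊕ CopyMsg M m → HybridWires S m A :=
  Sum.elim (fun w => .inr (.inr w)) fun x => .inr (.inl x)

/-- The sender's gates in turn `t` of the session `j`. -/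
def hybridSession (t : ℕ) (j : Fin (m + 1)) : List (Instr (HybridWires S m A) A.Qubits) :=
  (S.turns.getD t []).map fun g => .bit (g.map (hybridSender S m A j))

/-- The adversary's gates in turn `t`. -/
def hybridTurn (t : ℕ) : List (Instr (HybridWires S m A) A.Qubits) :=
  (A.turns.getD t []).map (Instr.map (hybridAdversary S m A))

/-- The gates of all the sessions and the adversary. -/
def hybridCircuit (K : ℕ) : List (Instr (HybridWires S m A) A.Qubits) :=
  (List.range K).flatMap fun t =>
    (List.finRange (m + 1)).flatMap (hybridSession S m A t) ++ hybridTurn S m A t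

/-- The wires when the sender has the input `γ j` in the session `j`. -/
def hybridStore (γ : Fin (m + 1) → Bool) : HybridWires S m A → Bool :=
  Sum.elim (fun p => if p.2 = S.inp then γ p.1 else false) fun _ => false

/-- The initial branch when the sender has the input `γ j` in the session `j`. -/
def hybridBranch (γ : Fin (m + 1) → Bool) : Branch (HybridWires S m A) A.Qubits :=
  ⟨hybridStore S m A γ, fun x => if x = fun _ => false then 1 else 0⟩

/-- The embedding of the wires into the joint system with the combined sender. -/
def hybridEmbedding : HybridWires S m A → JointBits (S.copies m d e L) A.toReceiver :=
  Sum.map Sum.inl id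

theorem hybridEmbedding_injective : Function.Injective (hybridEmbedding S m d e L A) :=
  Function.Injective.sumMap (fun _ _ h => Sum.inl.inj h) Function.injective_id

theorem hybridEmbedding_ne (v) (c : Aux) : hybridEmbedding S m d e L A v ≠ .inl (.inr c) := by
  rcases v with v | v <;> intro h
  · exact Sum.inl_ne_inr (Sum.inl.inj h)
  · exact Sum.inr_ne_inl h

theorem pulls_getD {W W' Q : Type} [DecidableEq W] [DecidableEq W'] [DecidableEq Q] {f : W → W'}
    {B : ℕ → List (Instr W' Q)} {H : ℕ → List (Instr W Q)} {f' : List (Instr W' Q)} {L : ℕ}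
    (hB : ∀ t, Pulls f (B t) (H t)) (hH : ∀ t, L ≤ t → H t = []) (hf' : Pulls f f' []) (t : ℕ) :
    Pulls f (((List.range L).map B ++ [[], f']).getD t []) (H t) := by
  by_cases ht : t < L
  · have : ((List.range L).map B ++ [[], f']).getD t [] = B t := by
      rw [List.getD_append _ _ _ _ (by simpa using ht)]
      simp [List.getD, ht]
    rw [this]; exact hB t
  · rw [hH t (not_lt.1 ht), List.getD_append_right _ _ _ _ (by simpa using ht)]
    rcases (t - ((List.range L).map B).length) with _ | _ | n
    · exact Pulls.nil f
    · exact hf'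
    · exact Pulls.nil f

theorem exec_copyInput_adversary (b : Bool) :
    ∃ σ, exec ((copyInput (fun c => (.inl (.inr c) : JointBits (S.copies m d e L) A.toReceiver))
        ((List.finRange (m + 1)).map fun j => .inl (.inl (j, S.inp)))).map Instr.bit)
        (initBranch (S.copies m d e L) A.toReceiver b) =
        [⟨σ, (initBranch (S.copies m d e L) A.toReceiver b).amp⟩] ∧
      σ ∘ hybridEmbedding S m d e L A = hybridStore S m A fun _ => b := by
  set l : List (JointBits (S.copies m d e L) A.toReceiver) :=
    (List.finRange (m + 1)).map fun j => .inl (.inl (j, S.inp)) with hl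
  have hmem : ∀ v, hybridEmbedding S m d e L A v ∈ l ↔ ∃ j, v = .inl (j, S.inp) := by
    intro v
    simp only [hl, List.mem_map, List.mem_finRange, true_and]
    constructor
    · rintro ⟨j, hj⟩
      exact ⟨j, (hybridEmbedding_injective S m d e L A
        (a₁ := .inl (j, S.inp)) hj).symm⟩
    · rintro ⟨j, rfl⟩
      exact ⟨j, rfl⟩
  obtain ⟨σ, h1, h2, h3⟩ := exec_copyInput
    (fun c => (.inl (.inr c) : JointBits (S.copies m d e L) A.toReceiver)) l (by
      intro v hv
      simp only [hl, List.mem_map] at hv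
      obtain ⟨j, -, rfl⟩ := hv
      exact fun h => Sum.inl_ne_inr (Sum.inl.inj h))
    (initBranch (S.copies m d e L) A.toReceiver b).store
    (initBranch (S.copies m d e L) A.toReceiver b).amp
  refine ⟨σ, h1, ?_⟩
  have hb : (initBranch (S.copies m d e L) A.toReceiver b).store (.inl (.inr .inp)) = b :=
    initBranch_store_inp _ _ b
  funext v
  rw [Function.comp_apply]
  by_cases hv : ∃ j, v = .inl (j, S.inp)
  · rw [h2 _ ((hmem v).2 hv), hb]
    obtain ⟨j, rfl⟩ := hv
    simp [hybridStore]
  · rw [h3 _ (fun h => hv ((hmem v).1 h)) (hybridEmbedding_ne S m d e L A v _),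
      initBranch_store_of_ne _ _ b (hybridEmbedding_ne S m d e L A v _)]
    rcases v with ⟨j, w⟩ | v
    · have : w ≠ S.inp := by rintro rfl; exact hv ⟨j, rfl⟩
      simp [hybridStore, this]
    · rfl

/-- The sender's additional gates either set the session inputs at the start or write to private
auxiliary wires at the end, even if the adversary goes on afterwards. Forgetting the auxiliary wires
leaves plain parallel sessions. The sender has `L + 3` turns in all. -/
theorem probGuessZero_copies (hS : S.turns.length ≤ L + 1) (b : Bool) {K : ℕ} (hK : L + 3 ≤ K)
    (hA : A.turns.length ≤ K) :
    probGuessZero (S.copies m d e L) A b =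
      val (hybridCircuit S m A K) (zeroMass (.inr (.inr A.guess)))
        (hybridBranch S m A fun _ => b) := by
  set F : BitGate (((Fin (m + 1) × S.Bits) ⊕ Aux) ⊕ CopyMsg M m) →
      Instr (JointBits (S.copies m d e L) A.toReceiver) A.Qubits := fun g =>
    .bit (g.map (Sum.elim Sum.inl fun x => Sum.inr (Sum.inl x))) with hF
  set η : Aux → JointBits (S.copies m d e L) A.toReceiver := fun c => .inl (.inr c) with hη
  set pairs : List (JointBits (S.copies m d e L) A.toReceiver ×
      JointBits (S.copies m d e L) A.toReceiver) :=
    signPairs (fun c => .inr (.inl (.inr c))) (fun t => .inl (.inl (Fin.ofNat (m + 1) t, S.out)))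
      (η .inp) d (m + 1) e with hpairs
  have hturns : senderTurns (S.copies m d e L) A.toReceiver =
      ((copyInput η ((List.finRange (m + 1)).map fun j => .inl (.inl (j, S.inp)))).map Instr.bit ++
        (S.block m 0).map F) ::
      ((List.range L).map (fun t => (S.block m (t + 1)).map F) ++
        [[], (sumAnd η pairs).map Instr.bit]) := by
    refine map_senderTurns (S := S.block m) (S' := fun t => (S.block m t).map F) F ?_
      (fun _ => rfl) ?_ L
    · refine (List.map_map (g := Instr.bit)).symm.trans (congrArg (List.map Instr.bit) ?_)
      exact (map_copyInput _ _ _).trans (congrArg _ List.map_map)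
    · refine (List.map_map (g := Instr.bit)).symm.trans (congrArg (List.map Instr.bit) ?_)
      exact (map_sumAnd _ _ _).trans (congrArg _ (map_signPairs _ _ _ _ _ _ _))
  have hrange : (S.block m 0).map F ::
      ((List.range L).map (fun t => (S.block m (t + 1)).map F) ++
        [[], (sumAnd η pairs).map Instr.bit]) =
      (List.range (L + 1)).map (fun t => (S.block m t).map F) ++
        [[], (sumAnd η pairs).map Instr.bit] := by
    simp [List.range_succ_eq_map, Function.comp_def]
  have hinj := hybridEmbedding_injective S m d e L A
  have hcirc : Pulls (hybridEmbedding S m d e L A)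
      (interleave ((List.range (L + 1)).map (fun t => (S.block m t).map F) ++
        [[], (sumAnd η pairs).map Instr.bit]) (receiverTurns (S.copies m d e L) A.toReceiver))
      (hybridCircuit S m A K) := by
    rw [interleave_eq_flatMap K _ _ (by simpa using hK) (by simpa [receiverTurns] using hA)]
    refine Pulls.flatMap _ fun t _ => Pulls.append ?_ ?_
    · refine pulls_getD (H := fun t => (List.finRange (m + 1)).flatMap (hybridSession S m A t))
        (fun t => ?_) ?_ ?_ t
      · have : (S.block m t).map F = ((List.finRange (m + 1)).flatMap
            (hybridSession S m A t)).map (Instr.map (hybridEmbedding S m d e L A)) := by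
          simp only [Sender.block, hybridSession, List.map_flatMap, List.map_map]
          congr 1; funext j
          congr 1; funext g
          refine (congrArg Instr.bit (BitGate.map_map _ _ g)).trans
            ((congrArg (fun f => Instr.bit (g.map f)) ?_).trans
              (congrArg Instr.bit (BitGate.map_map _ _ g)).symm)
          funext w
          rcases w with w | w <;> rfl
        rw [this]
        exact pulls_map hinj _
      · intro t ht
        have : S.turns.getD t [] = [] := List.getD_eq_default _ _ (hS.trans ht)
        refine List.flatMap_eq_nil_iff.2 fun j _ => ?_
        rw [hybridSession, this]
        rfl
      · refine pulls_nil_of_forall _ fun g hg => ?_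
        simp only [sumAnd, List.mem_cons, List.mem_flatMap, xorAnd, List.not_mem_nil,
          or_false] at hg
        obtain rfl | ⟨p, -, rfl | rfl | rfl | rfl | rfl | rfl⟩ := hg
        · exact .inl ⟨_, _, rfl, fun u => hybridEmbedding_ne S m d e L A u _⟩
        all_goals exact .inr ⟨_, _, _, rfl, fun u => hybridEmbedding_ne S m d e L A u _⟩
    · have : (receiverTurns (S.copies m d e L) A.toReceiver).getD t [] =
          (hybridTurn S m A t).map (Instr.map (hybridEmbedding S m d e L A)) := by
        rw [receiverTurns, getD_map, hybridTurn, List.map_map]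
        congr 1; funext i
        refine (congrArg (fun f => Instr.map f i) ?_).trans (Instr.map_map _ _ i).symm
        funext w
        rcases w with w | w <;> rfl
      rw [this]
      exact pulls_map hinj _
  obtain ⟨σ, hcopy, hσ⟩ := exec_copyInput_adversary S m d e L A b
  have hprob : probGuessZero (S.copies m d e L) A b =
      val (interleave (senderTurns (S.copies m d e L) A.toReceiver)
        (receiverTurns (S.copies m d e L) A.toReceiver))
        (fun γ => zeroMass (.inr (.inr A.guess)) (γ.pull (hybridEmbedding S m d e L A)))
        (initBranch (S.copies m d e L) A.toReceiver b) := rfl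
  rw [hprob, hturns, interleave_append_cons, hrange, val_append, val_of_exec_eq hcopy,
    hcirc.val_eq]
  congr 1
  rw [Branch.pull, hσ]
  rfl

end Hybrid

/-! ### Security of the parallel repetition -/

theorem sum_length_getD_le {I : Type} (ts : List (List I)) (K : ℕ) :
    ∑ t ∈ Finset.range K, (ts.getD t []).length ≤ turnsSize ts := by
  induction ts generalizing K with
  | nil => simp
  | cons c ts ih =>
    rcases K with _ | K
    · simp
    · have := ih K
      rw [Finset.sum_range_succ']
      simp only [List.getD_cons_succ, List.getD_cons_zero, turnsSize, List.map_cons,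
        List.sum_cons] at this ⊢
      omega

theorem turnsSize_map_range {I : Type} (T : ℕ → List I) (K : ℕ) :
    turnsSize ((List.range K).map T) = ∑ t ∈ Finset.range K, ((T t).length + 1) := by
  rw [turnsSize, List.map_map]; rfl

/-! ### The reduction to a single session -/

section Reduction

variable {M : Type} [DecidableEq M] (S : Sender M) (m : ℕ) (A : Adversary (CopyMsg M m))

theorem map_hybridSession {W : Type} (f : HybridWires S m A → W) (t : ℕ) (j : Fin (m + 1)) :
    (hybridSession S m A t j).map (Instr.map f) =
      (S.turns.getD t []).map fun g => .bit (g.map (f ∘ hybridSender S m A j)) := by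
  rw [hybridSession, List.map_map]
  exact List.map_congr_left fun g _ => congrArg Instr.bit (BitGate.map_map _ _ g)

theorem map_hybridTurn {W : Type} (f : HybridWires S m A → W) (t : ℕ) :
    (hybridTurn S m A t).map (Instr.map f) =
      (A.turns.getD t []).map (Instr.map (f ∘ hybridAdversary S m A)) := by
  rw [hybridTurn, List.map_map]
  exact List.map_congr_left fun g _ => Instr.map_map _ _ g

/-- Setting the inputs of the sessions in `l`. -/
def setInputs (β : Fin (m + 1) → Bool) (l : List (Fin (m + 1))) :
    List (Instr (HybridWires S m A) A.Qubits) :=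
  l.map fun j => .bit (.set (.inl (j, S.inp)) (β j))

theorem exec_setInputs (β γ : Fin (m + 1) → Bool) (l : List (Fin (m + 1))) :
    exec (setInputs S m A β l) (hybridBranch S m A γ) =
      [hybridBranch S m A fun j => if j ∈ l then β j else γ j] := by
  induction l generalizing γ with
  | nil => simp [setInputs, exec]
  | cons i l ih =>
    have hupd : Function.update (hybridStore S m A γ) (.inl (i, S.inp)) (β i) =
        hybridStore S m A (Function.update γ i (β i)) := by
      funext v
      rcases v with ⟨j, w⟩ | v
      · by_cases hj : j = i <;> by_cases hw : w = S.inp <;>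
          simp [hybridStore, Function.update_apply, hj, hw]
      · simp [hybridStore]
    have := ih (Function.update γ i (β i))
    simp only [setInputs, List.map_cons, exec, Instr.step, BitGate.step, hybridBranch,
      List.flatMap_cons, List.flatMap_nil, List.append_nil, hupd] at this ⊢
    rw [this]
    congr 3
    funext j
    by_cases hj : j ∈ l
    · simp [hj]
    · by_cases hi : j = i
      · subst hi; simp [hj]
      · simp [hj, hi]

variable (i : Fin (m + 1))

/-- The sessions other than `i`. -/
def otherSessions : List (Fin (m + 1)) := (List.finRange (m + 1)).filter (· ≠ i)

theorem mem_otherSessions {m : ℕ} {i j : Fin (m + 1)} : j ∈ otherSessions m i ↔ j ≠ i := by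
  simp [otherSessions]

theorem cons_otherSessions_perm : (i :: otherSessions m i).Perm (List.finRange (m + 1)) := by
  rw [List.perm_ext_iff_of_nodup _ (List.nodup_finRange _)]
  · intro j
    by_cases h : j = i <;> simp [mem_otherSessions, h]
  · exact List.nodup_cons.2 ⟨fun h => mem_otherSessions.1 h rfl,
      (List.nodup_finRange _).filter _⟩

/-- The wires of the adversary that plays the session `i` with an external sender. -/
def reductionWire : HybridWires S m A → HybridWires S m A ⊕ M
  | .inr (.inl (.inl p)) => if p.1 = i then .inr p.2 else .inl (.inr (.inl (.inl p)))
  | v => .inl v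

/-- The gates, in turn `t`, of everyone except for the sender of the session `i`. -/
def reductionTurn (β : Fin (m + 1) → Bool) (t : ℕ) : List (Instr (HybridWires S m A) A.Qubits) :=
  (if t = 0 then setInputs S m A β (otherSessions m i) else []) ++
    ((otherSessions m i).flatMap (hybridSession S m A t) ++ hybridTurn S m A t)

/-- The adversary that plays the session `i` with an external sender, and itself plays the sender,
with the inputs `β`, in the other sessions. -/
def reduction (β : Fin (m + 1) → Bool) (K : ℕ) : Adversary M where
  Bits := HybridWires S m A
  Qubits := A.Qubits
  turns := (List.range K).map fun t =>
    (reductionTurn S m A i β t).map (Instr.map (reductionWire S m A i))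
  guess := .inr (.inr A.guess)

/-- The wires of the hybrid experiment as wires of the interaction with `reduction`. -/
def reductionEmbedding (β : Fin (m + 1) → Bool) (K : ℕ) :
    HybridWires S m A → JointBits S (reduction S m A i β K).toReceiver
  | .inl p => if p.1 = i then .inl p.2 else .inr (.inr (.inl p))
  | .inr v => Sum.elim (fun w => .inr (.inr w)) (fun x => .inr (.inl x))
      (reductionWire S m A i (.inr v))

theorem reductionEmbedding_injective (β : Fin (m + 1) → Bool) (K : ℕ) :
    Function.Injective (reductionEmbedding S m A i β K) := by
  refine Function.LeftInverse.injective (g := Sum.elim (fun w => .inl (i, w))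
    (Sum.elim (fun x => .inr (.inl (.inl (i, x)))) id)) fun v => ?_
  rcases v with ⟨j, w⟩ | ((⟨j, x⟩ | c) | w)
  · by_cases h : j = i
    · subst h; simp only [reductionEmbedding, if_true]; rfl
    · simp only [reductionEmbedding, h, if_false]; rfl
  · by_cases h : j = i
    · subst h; simp only [reductionEmbedding, reductionWire, if_true]; rfl
    · simp only [reductionEmbedding, reductionWire, h, if_false]; rfl
  · rfl
  · rfl

theorem initBranch_reduction (β : Fin (m + 1) → Bool) (K : ℕ) (b : Bool) :
    (initBranch S (reduction S m A i β K).toReceiver b).pull (reductionEmbedding S m A i β K) =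
      hybridBranch S m A fun j => if j = i then b else false := by
  refine congrArg (fun s => (⟨s, _⟩ : Branch (HybridWires S m A) A.Qubits)) ?_
  funext v
  rw [Function.comp_apply]
  rcases v with ⟨j, w⟩ | ((⟨j, x⟩ | c) | w)
  · by_cases h : j = i
    · by_cases hw : w = S.inp
      · subst h hw
        simp [reductionEmbedding, hybridStore, initBranch]
      · simp [reductionEmbedding, hybridStore, initBranch, h, hw]
    · simp [reductionEmbedding, hybridStore, initBranch, h]
  · by_cases h : j = i <;> simp only [reductionEmbedding, reductionWire, h, if_true, if_false] <;>
      rfl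
  · rfl
  · rfl

theorem senderTurns_reduction (β : Fin (m + 1) → Bool) (K t : ℕ) :
    (senderTurns S (reduction S m A i β K).toReceiver).getD t [] =
      (hybridSession S m A t i).map (Instr.map (reductionEmbedding S m A i β K)) := by
  rw [map_hybridSession, senderTurns, getD_map]
  refine List.map_congr_left fun g _ => congrArg (fun f => Instr.bit (g.map f)) ?_
  funext w
  rcases w with w | w
  · simp [hybridSender, reductionEmbedding]
  · simp only [Function.comp_apply, hybridSender, Sum.elim_inr, reductionEmbedding,
      reductionWire, if_true]
    rfl

theorem receiverTurns_reduction (β : Fin (m + 1) → Bool) {K t : ℕ} (ht : t < K) :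
    (receiverTurns S (reduction S m A i β K).toReceiver).getD t [] =
      (reductionTurn S m A i β t).map (Instr.map (reductionEmbedding S m A i β K)) := by
  set f : HybridWires S m A → JointBits S (reduction S m A i β K).toReceiver :=
    Sum.elim (fun w => .inr (.inr w)) (fun x => .inr (.inl x)) ∘ reductionWire S m A i with hf
  have h1 : (receiverTurns S (reduction S m A i β K).toReceiver).getD t [] =
      (reductionTurn S m A i β t).map (Instr.map f) := by
    rw [receiverTurns, getD_map]
    have : (reduction S m A i β K).turns.getD t [] =
        (reductionTurn S m A i β t).map (Instr.map (reductionWire S m A i)) := by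
      refine (List.getD_eq_getElem _ _ (by simpa [reduction] using ht)).trans ?_
      exact (List.getElem_map _).trans (by rw [List.getElem_range])
    rw [this]
    exact List.map_map.trans (List.map_congr_left fun g _ => Instr.map_map _ _ g)
  -- The two maps differ only on the private wires of the external sender, which no gate of the
  -- reduction touches.
  have hfE : ∀ v, (∀ w, v ≠ .inl (i, w)) → f v = reductionEmbedding S m A i β K v := by
    intro v hv
    rcases v with ⟨j, w⟩ | v
    · have : j ≠ i := by rintro rfl; exact hv w rfl
      simp only [reductionEmbedding, this, if_false]
      rfl
    · rfl
  rw [h1, reductionTurn]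
  simp only [List.map_append, List.map_flatMap, map_hybridTurn]
  congr 1
  · split_ifs
    · simp only [setInputs, List.map_map]
      refine List.map_congr_left fun j hj => ?_
      have : f (.inl (j, S.inp)) = reductionEmbedding S m A i β K (.inl (j, S.inp)) :=
        hfE _ fun w h => mem_otherSessions.1 hj (Prod.mk.inj (Sum.inl.inj h)).1
      simp only [Function.comp_apply, Instr.map, BitGate.map, this]
    · rfl
  · congr 1
    · refine List.flatMap_congr fun j hj => ?_
      rw [map_hybridSession, map_hybridSession]
      refine List.map_congr_left fun g _ => congrArg (fun f => Instr.bit (g.map f)) ?_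
      funext w
      refine hfE _ fun w' h => ?_
      rcases w with w | w
      · exact mem_otherSessions.1 hj (Prod.mk.inj (Sum.inl.inj h)).1
      · exact Sum.inr_ne_inl h
    · refine List.map_congr_left fun g _ => congrArg (fun f => Instr.map f g) ?_
      funext w
      refine hfE _ fun w' h => ?_
      rcases w with w | w <;> exact Sum.inr_ne_inl h

theorem vEq_hybridSession {j j' : Fin (m + 1)} (h : j ≠ j') (t t' : ℕ) :
    VEq (hybridSession S m A t j ++ hybridSession S m A t' j')
      (hybridSession S m A t' j' ++ hybridSession S m A t j) :=
  vEq_bits_bits (by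
    intro a b
    rcases a with a | a <;> rcases b with b | b <;> simp [hybridSender, h]) _ _

theorem vEq_hybridSession_setInputs (β : Fin (m + 1) → Bool) (t : ℕ) :
    VEq (hybridSession S m A t i ++ setInputs S m A β (otherSessions m i))
      (setInputs S m A β (otherSessions m i) ++ hybridSession S m A t i) := by
  rw [setInputs, List.map_eq_flatMap]
  refine vEq_append_flatMap _ fun j hj => ?_
  exact vEq_bits_bits (f := hybridSender S m A i) (f' := hybridSender S m A j) (by
    intro a b
    rcases a with a | a <;> rcases b with b | b <;>
      simp [hybridSender, (mem_otherSessions.1 hj).symm]) _ [.set (.inl S.inp) (β j)]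

/-- The external sender acts first in each round, even before the other inputs are set; its gates
commute with these settings and with the simulated senders. -/
theorem vEq_reduction (β : Fin (m + 1) → Bool) (K : ℕ) :
    VEq ((List.range (K + 1)).flatMap fun t =>
        hybridSession S m A t i ++ reductionTurn S m A i β t)
      (setInputs S m A β (otherSessions m i) ++ hybridCircuit S m A (K + 1)) := by
  have hperm : ∀ t, VEq (hybridSession S m A t i ++
      ((otherSessions m i).flatMap (hybridSession S m A t) ++ hybridTurn S m A t))
      ((List.finRange (m + 1)).flatMap (hybridSession S m A t) ++ hybridTurn S m A t) := by
    intro t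
    rw [← List.append_assoc]
    exact (vEq_flatMap_of_perm (X := hybridSession S m A t)
      (fun j j' h => vEq_hybridSession S m A h t t)
      (cons_otherSessions_perm m i)).append (VEq.refl _)
  rw [hybridCircuit, List.range_succ_eq_map, List.flatMap_cons, List.flatMap_cons,
    List.flatMap_map, List.flatMap_map, ← List.append_assoc (setInputs S m A β _)]
  refine VEq.append ?_ (VEq.flatMap _ fun t _ => ?_)
  · have h1 := (vEq_hybridSession_setInputs S m A i β 0).append (VEq.refl
      ((otherSessions m i).flatMap (hybridSession S m A 0) ++ hybridTurn S m A 0))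
    have h2 := (VEq.refl (setInputs S m A β (otherSessions m i))).append (hperm 0)
    simp only [reductionTurn, if_true, List.append_assoc] at h1 h2 ⊢
    exact h1.trans h2
  · have := hperm (t + 1)
    simpa [reductionTurn] using this

/-- The simulation is perfect: it reproduces the hybrid experiment with the external input in
position `i`. -/
theorem probGuessZero_reduction (β : Fin (m + 1) → Bool) {K : ℕ} (hS : S.turns.length ≤ K + 1)
    (b : Bool) :
    probGuessZero S (reduction S m A i β (K + 1)) b =
      val (hybridCircuit S m A (K + 1)) (zeroMass (.inr (.inr A.guess)))
        (hybridBranch S m A fun j => if j = i then b else β j) := by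
  have hinj := reductionEmbedding_injective S m A i β (K + 1)
  have hcirc : Pulls (reductionEmbedding S m A i β (K + 1))
      (interleave (senderTurns S (reduction S m A i β (K + 1)).toReceiver)
        (receiverTurns S (reduction S m A i β (K + 1)).toReceiver))
      ((List.range (K + 1)).flatMap fun t =>
        hybridSession S m A t i ++ reductionTurn S m A i β t) := by
    rw [interleave_eq_flatMap (K + 1) _ _ (by simpa [senderTurns] using hS)
      (by simp [receiverTurns, reduction])]
    refine Pulls.flatMap _ fun t ht => Pulls.append ?_ ?_
    · rw [senderTurns_reduction]; exact pulls_map hinj _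
    · rw [receiverTurns_reduction S m A i β (List.mem_range.1 ht)]; exact pulls_map hinj _
  have hprob : probGuessZero S (reduction S m A i β (K + 1)) b =
      val (interleave (senderTurns S (reduction S m A i β (K + 1)).toReceiver)
        (receiverTurns S (reduction S m A i β (K + 1)).toReceiver))
        (fun γ => zeroMass (.inr (.inr A.guess))
          (γ.pull (reductionEmbedding S m A i β (K + 1))))
        (initBranch S (reduction S m A i β (K + 1)).toReceiver b) := rfl
  have hval : probGuessZero S (reduction S m A i β (K + 1)) b =
      val (setInputs S m A β (otherSessions m i) ++ hybridCircuit S m A (K + 1))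
        (zeroMass (.inr (.inr A.guess)))
        (hybridBranch S m A fun j => if j = i then b else false) :=
    hprob.trans ((hcirc.val_eq _ _).trans ((congrArg _ (initBranch_reduction S m A i β _ b)).trans
      (congrFun (vEq_reduction S m A i β K _) _)))
  rw [hval, val_append, val_of_exec_eq (exec_setInputs S m A β _ _)]
  congr 2
  funext j
  by_cases h : j = i <;> simp [h, mem_otherSessions]

theorem turnsSize_reduction_le (β : Fin (m + 1) → Bool) (K : ℕ) :
    turnsSize (reduction S m A i β K).turns ≤
      K + (m + 1) + (m + 1) * turnsSize S.turns + turnsSize A.turns := by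
  have hlen : (otherSessions m i).length ≤ m + 1 :=
    (List.length_filter_le _ _).trans (by simp)
  have hturn : ∀ t, (reductionTurn S m A i β t).length ≤ (if t = 0 then m + 1 else 0) +
      ((m + 1) * (S.turns.getD t []).length + (A.turns.getD t []).length) := by
    intro t
    simp only [reductionTurn, List.length_append]
    refine Nat.add_le_add ?_ (Nat.add_le_add ?_ (by simp [hybridTurn]))
    · split_ifs
      · simpa [setInputs] using hlen
      · simp
    · simp only [List.length_flatMap, hybridSession, List.length_map, List.map_const',
        List.sum_replicate, smul_eq_mul]
      exact Nat.mul_le_mul_right _ hlen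
  have h1 : ∑ t ∈ Finset.range K, (if t = 0 then m + 1 else 0) ≤ m + 1 := by
    rw [Finset.sum_ite_eq']
    split_ifs <;> simp
  have h2 := Nat.mul_le_mul_left (m + 1) (sum_length_getD_le S.turns K)
  have h3 := sum_length_getD_le A.turns K
  have h4 := Finset.sum_le_sum fun t (_ : t ∈ Finset.range K) => hturn t
  rw [Finset.sum_add_distrib, Finset.sum_add_distrib, ← Finset.mul_sum] at h4
  have h5 : turnsSize (reduction S m A i β K).turns =
      ∑ t ∈ Finset.range K, ((reductionTurn S m A i β t).length + 1) := by
    refine (turnsSize_map_range _ K).trans (Finset.sum_congr rfl fun t _ => ?_)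
    exact congrArg (· + 1) (List.length_map _)
  rw [h5, Finset.sum_add_distrib, Finset.sum_const, Finset.card_range, smul_eq_mul, mul_one]
  omega

end Reduction

/-- A hybrid argument over the number of sessions with input 1. Adversaries are nonuniform, so the
best index `i` can simply be fixed instead of being guessed. -/
theorem exists_reduction {M : Type} [DecidableEq M] (S : Sender M) (m d : ℕ) (e : ℤ) (L : ℕ)
    (A : Adversary (CopyMsg M m)) (hS : S.turns.length ≤ L + 1) :
    ∃ A' : Adversary M,
      turnsSize A'.turns ≤ (L + 3 + A.turns.length) + (m + 1) + (m + 1) * turnsSize S.turns +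
        turnsSize A.turns ∧
      |probGuessZero (S.copies m d e L) A false - probGuessZero (S.copies m d e L) A true| ≤
        (m + 1) * |probGuessZero S A' false - probGuessZero S A' true| := by
  -- Then `K + 1` rounds cover the sender's `L + 3` turns and all turns of the adversary.
  set K := L + 2 + A.turns.length with hK
  set p : (Fin (m + 1) → Bool) → ℝ := fun γ =>
    val (hybridCircuit S m A (K + 1)) (zeroMass (.inr (.inr A.guess))) (hybridBranch S m A γ)
    with hp
  set H : ℕ → ℝ := fun k => p fun j => decide ((j : ℕ) < k) with hH
  -- With external input 0 or 1 this adversary reproduces the hybrid `i` or `i + 1`.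
  set B : Fin (m + 1) → Adversary M := fun i =>
    reduction S m A i (fun j => decide ((j : ℕ) < i)) (K + 1) with hB
  have hcopies : ∀ b, probGuessZero (S.copies m d e L) A b = p fun _ => b := fun b =>
    probGuessZero_copies S m d e L A hS b (by omega) (by omega)
  have h0 : probGuessZero (S.copies m d e L) A false = H 0 := by
    rw [hcopies]; simp [hH]
  have h1 : probGuessZero (S.copies m d e L) A true = H (m + 1) := by
    rw [hcopies]; simp only [hH]; congr 1; funext j; exact (decide_eq_true j.2).symm
  have hstep : ∀ i : Fin (m + 1), |H i - H (i + 1)| =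
      |probGuessZero S (B i) false - probGuessZero S (B i) true| := by
    intro i
    rw [hB, probGuessZero_reduction S m A i _ (by omega), probGuessZero_reduction S m A i _
      (by omega)]
    simp only [hH, hp]
    congr 4 <;> funext j <;> by_cases h : j = i
    · simp [h]
    · simp [h]
    · simp [h]
    · have : (j : ℕ) ≠ i := fun h' => h (Fin.ext h')
      simp only [h, if_false, decide_eq_decide]
      omega
  have htel : |H 0 - H (m + 1)| ≤ ∑ i : Fin (m + 1), |H i - H (i + 1)| := by
    rw [Fin.sum_univ_eq_sum_range (fun k => |H k - H (k + 1)|), ← Finset.sum_range_sub']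
    exact Finset.abs_sum_le_sum_abs _ _
  obtain ⟨i, -, hi⟩ := Finset.exists_max_image Finset.univ (fun i : Fin (m + 1) =>
    |H i - H (i + 1)|) Finset.univ_nonempty
  refine ⟨B i, ?_, ?_⟩
  · refine (turnsSize_reduction_le S m A i _ _).trans (le_of_eq ?_)
    rw [hK]; ring
  · rw [h0, h1, ← hstep]
    refine htel.trans ((Finset.sum_le_card_nsmul _ _ _ fun j hj => hi j hj).trans ?_)
    simp

/-! ### Polynomially bounded and negligible functions -/

theorem PolyBounded.mono {f g : ℕ → ℕ} (hg : PolyBounded g) (h : ∀ n, f n ≤ g n) :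
    PolyBounded f := by
  obtain ⟨c, N, hc⟩ := hg
  exact ⟨c, N, fun n hn => (h n).trans_lt (hc n hn)⟩

theorem polyBounded_const (k : ℕ) : PolyBounded fun _ => k :=
  ⟨1, k, fun n hn => by simpa using hn⟩

theorem polyBounded_id : PolyBounded fun n => n :=
  ⟨2, 1, fun n hn => by nlinarith⟩

theorem PolyBounded.add {f g : ℕ → ℕ} (hf : PolyBounded f) (hg : PolyBounded g) :
    PolyBounded fun n => f n + g n := by
  obtain ⟨a, N, ha⟩ := hf
  obtain ⟨b, N', hb⟩ := hg
  refine ⟨a + b + 1, N + N' + 1, fun n hn => ?_⟩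
  have h1 : n ^ a ≤ n ^ (a + b) := Nat.pow_le_pow_right (by omega) (by omega)
  have h2 : n ^ b ≤ n ^ (a + b) := Nat.pow_le_pow_right (by omega) (by omega)
  have h3 := ha n (by omega)
  have h4 := hb n (by omega)
  have h5 : n ^ (a + b) * 2 ≤ n ^ (a + b) * n := Nat.mul_le_mul_left _ (by omega)
  rw [pow_succ]
  change f n + g n < _
  omega

theorem PolyBounded.mul {f g : ℕ → ℕ} (hf : PolyBounded f) (hg : PolyBounded g) :
    PolyBounded fun n => f n * g n := by
  obtain ⟨a, N, ha⟩ := hf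
  obtain ⟨b, N', hb⟩ := hg
  refine ⟨a + b, N + N', fun n hn => ?_⟩
  rw [pow_add]
  exact Nat.mul_lt_mul'' (ha n (by omega)) (hb n (by omega))

theorem Negligible.mono {f g : ℕ → ℝ} (hg : Negligible g) (h : ∀ n, |f n| ≤ |g n|) :
    Negligible f :=
  Asymptotics.SuperpolynomialDecay.trans_abs_le hg h

theorem Negligible.add {f g : ℕ → ℝ} (hf : Negligible f) (hg : Negligible g) :
    Negligible fun n => f n + g n :=
  Asymptotics.SuperpolynomialDecay.add hf hg

theorem Negligible.const_mul {f : ℕ → ℝ} (hf : Negligible f) (c : ℝ) :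
    Negligible fun n => c * f n :=
  Asymptotics.SuperpolynomialDecay.const_mul hf c

theorem Negligible.polyBounded_mul {k : ℕ → ℕ} {f : ℕ → ℝ} (hk : PolyBounded k)
    (hf : Negligible f) : Negligible fun n => (k n : ℝ) * f n := by
  obtain ⟨c, N, hc⟩ := hk
  refine (Asymptotics.SuperpolynomialDecay.param_pow_mul hf c).trans_eventually_abs_le ?_
  filter_upwards [Filter.eventually_gt_atTop N] with n hn
  have : (k n : ℝ) ≤ (n : ℝ) ^ c := by exact_mod_cast (hc n hn).le
  simp only [Function.comp_apply, Pi.mul_apply, Pi.pow_apply, abs_mul]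
  refine mul_le_mul_of_nonneg_right ?_ (abs_nonneg _)
  rwa [abs_of_nonneg (Nat.cast_nonneg _), abs_of_nonneg (by positivity)]

theorem negligible_exp_neg : Negligible fun n => Real.exp (-(n : ℝ)) := fun c =>
  (Real.tendsto_pow_mul_exp_neg_atTop_nhds_zero c).comp tendsto_natCast_atTop_atTop

/-- From `1 - x ≤ exp(-x)`; the extra `+ 1` in the exponent matches the number `m + 1` of sessions.
-/
theorem one_sub_pow_le_exp {d : ℕ} (hd : 1 ≤ d) (n : ℕ) :
    (1 - 1 / (2 * (d : ℝ) ^ 2)) ^ (2 * d ^ 2 * n + 1) ≤ Real.exp (-(n : ℝ)) := by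
  have hd' : (1 : ℝ) ≤ d := by exact_mod_cast hd
  have h0 : 0 ≤ 1 - 1 / (2 * (d : ℝ) ^ 2) := by
    rw [sub_nonneg, div_le_one (by positivity)]
    nlinarith
  have h1 : 1 - 1 / (2 * (d : ℝ) ^ 2) ≤ Real.exp (-(1 / (2 * (d : ℝ) ^ 2))) :=
    Real.one_sub_le_exp_neg _
  calc (1 - 1 / (2 * (d : ℝ) ^ 2)) ^ (2 * d ^ 2 * n + 1)
      ≤ (1 - 1 / (2 * (d : ℝ) ^ 2)) ^ (2 * d ^ 2 * n) :=
        pow_le_pow_of_le_one h0 (sub_le_self _ (by positivity)) (Nat.le_succ _)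
    _ ≤ Real.exp (-(1 / (2 * (d : ℝ) ^ 2))) ^ (2 * d ^ 2 * n) := pow_le_pow_left₀ h0 h1 _
    _ = Real.exp (-(n : ℝ)) := by
        rw [← Real.exp_nat_mul]
        congr 1
        push_cast
        field_simp

/-! ### The size of the parallel repetition -/

theorem turnsSize_append {I : Type} (s t : List (List I)) :
    turnsSize (s ++ t) = turnsSize s + turnsSize t := by
  simp [turnsSize]

theorem turnsSize_cons {I : Type} (c : List I) (t : List (List I)) :
    turnsSize (c :: t) = c.length + 1 + turnsSize t := by
  simp [turnsSize]

theorem length_le_turnsSize {I : Type} (t : List (List I)) : t.length ≤ turnsSize t := by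
  induction t with
  | nil => simp
  | cons c t ih =>
    rw [turnsSize_cons, List.length_cons]
    omega

theorem length_interior_le (d : ℕ) : (interior d).length ≤ 2 * d := by
  simp only [interior, Finset.length_toList, Int.card_Ioo]
  omega

theorem length_positions (d : ℕ) : (positions d).length = 2 * d + 1 := by
  simp only [positions, Finset.length_toList, Int.card_Icc]
  omega

theorem length_signPairs_le {W : Type} (κ : Ctl → W) (s : ℕ → W) (b₀ : W) (d K : ℕ) (e : ℤ) :
    (signPairs κ s b₀ d K e).length ≤ K * (2 * d + 1) := by
  simp only [signPairs, List.length_flatMap, List.length_append, List.length_map,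
    List.length_singleton, List.map_const', List.sum_replicate, List.length_range, smul_eq_mul]
  exact Nat.mul_le_mul_left _ (Nat.succ_le_succ (length_interior_le d))

theorem length_sumAnd {W : Type} (η : Aux → W) (l : List (W × W)) :
    (sumAnd η l).length = 6 * l.length + 1 := by
  simp [sumAnd, List.length_flatMap, xorAnd, mul_comm]

theorem length_walk_le {W Q : Type} (κ : Ctl → W) (acc : Q) (q : ℕ → Q) (h : ∀ t, acc ≠ q t)
    (d t n : ℕ) : (walk κ acc q h d t n).length ≤ n * (8 * d + 5) := by
  induction n generalizing t with
  | zero => simp [walk]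
  | succ n ih =>
    have h1 := ih (t + 1)
    have h2 := length_interior_le d
    have h3 : (walkStep κ acc (q t) (h t) d t).length =
        (interior d).length + 2 + 3 * (positions d).length := by
      simp [walkStep, List.length_flatMap, moveCell]
      ring
    rw [walk, List.length_append, h3, length_positions, Nat.succ_mul n]
    omega

section Size

variable {M : Type}

theorem length_senderBlock (S : Sender M) (m t : ℕ) :
    (S.block m t).length = (m + 1) * (S.turns.getD t []).length := by
  simp [Sender.block, List.length_flatMap]

theorem length_receiverBlock (R : Receiver M) (m t : ℕ) :
    (R.block m t).length = (m + 1) * (R.turns.getD t []).length := by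
  simp [Receiver.block, List.length_flatMap]

theorem sum_length_blocks_le {I : Type} (ts : List (List I)) (m L : ℕ) :
    (m + 1) * (ts.getD 0 []).length +
      ∑ t ∈ Finset.range L, ((m + 1) * (ts.getD (t + 1) []).length + 1) ≤
      (m + 1) * turnsSize ts + L := by
  have h := Nat.mul_le_mul_left (m + 1) (sum_length_getD_le ts (L + 1))
  rw [Finset.sum_range_succ', mul_add, Finset.mul_sum] at h
  rw [Finset.sum_add_distrib, Finset.sum_const, Finset.card_range, smul_eq_mul, mul_one]
  omega

theorem turnsSize_senderCopies_le (S : Sender M) (m d : ℕ) (e : ℤ) (L : ℕ) :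
    turnsSize (S.copies m d e L).turns ≤
      (m + 1) * turnsSize S.turns + L + 6 * ((m + 1) * (2 * d + 1)) + m + 6 := by
  have h1 := sum_length_blocks_le S.turns m L
  have h2 := length_signPairs_le
    (fun c => (.inr (.inr c) : ((Fin (m + 1) × S.Bits) ⊕ Aux) ⊕ CopyMsg M m))
    (fun t => .inl (.inl (Fin.ofNat (m + 1) t, S.out))) (.inl (.inr .inp)) d (m + 1) e
  simp only [Sender.copies, turnsSize_cons, turnsSize_append, turnsSize_map_range,
    List.length_append, length_senderBlock, copyInput, List.length_cons, List.length_map,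
    List.length_finRange, length_sumAnd, List.length_nil]
  simp only [turnsSize, List.map_nil, List.sum_nil] at h1 ⊢
  omega

theorem turnsSize_receiverCopies_le (R : QubitReceiver M) (m d L : ℕ) :
    turnsSize (R.copies m d L).turns ≤
      (m + 1) * turnsSize R.turns + L + (m + 1) * (8 * d + 5) + 7 := by
  have h1 := sum_length_blocks_le R.turns m L
  have h2 := length_walk_le
    (fun c => (.inr (.inr c) : (Fin (m + 1) × R.Bits) ⊕ CopyMsg M m))
    (none : Option (Fin (m + 1) × R.Qubits)) (fun t => some (Fin.ofNat (m + 1) t, R.out))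
    (fun _ => by simp) d 0 (m + 1)
  simp only [QubitReceiver.copies, turnsSize_cons, turnsSize_append, turnsSize_map_range,
    length_receiverBlock, combine, List.length_append, List.length_cons, List.length_nil]
  simp only [turnsSize, List.map_nil, List.sum_nil] at h1 ⊢
  omega

end Size

/-! ### Oblivious state preparation from small angles -/

theorem exists_isOSP {d : ℕ → ℕ} (hd : ∀ n, 1 ≤ d n) (hpoly : PolyBounded d) {ε : ℕ → ℝ}
    (hε : ∀ n, ∃ e : ℤ, |e| = d n ∧ ∀ b (k : ℤ), |k| = d n →
      angle (ε n) b ^ k = sgn (b && decide (k = e)) * if b then Complex.I else 1)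
    {P : Protocol} (hP : P.IsEpsOSP ε) : ∃ P' : Protocol, P'.IsOSP := by
  choose e he hangle using hε
  -- The walk is absorbed on the time scale `d²`; the factor `n` makes the remaining probability
  -- exponentially small.
  set m : ℕ → ℕ := fun n => 2 * d n ^ 2 * n with hm
  -- A polynomial bound for the number of turns of both parties, since every turn counts towards the
  -- size.
  set L : ℕ → ℕ := fun n =>
    turnsSize (P.sender n).turns + turnsSize (P.receiver n).turns with hL
  have hmpoly : PolyBounded fun n => m n + 1 :=
    ((((polyBounded_const 2).mul (hpoly.mul hpoly)).mul polyBounded_id).add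
      (polyBounded_const 1)).mono fun n => by simp only [hm]; rw [sq]
  have hLpoly : PolyBounded L := P.sender_poly.add P.receiver_poly
  have hS : ∀ n, (P.sender n).turns.length ≤ L n + 1 := fun n =>
    (length_le_turnsSize _).trans (by simp only [hL]; omega)
  have hR : ∀ n, (P.receiver n).turns.length ≤ L n + 1 := fun n =>
    (length_le_turnsSize _).trans (by simp only [hL]; omega)
  let P' : Protocol :=
    { Msg := fun n => CopyMsg (P.Msg n) (m n)
      sender := fun n => (P.sender n).copies (m n) (d n) (e n) (L n)
      receiver := fun n => (P.receiver n).copies (m n) (d n) (L n)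
      sender_poly :=
        (((((hmpoly.mul P.sender_poly).add hLpoly).add ((polyBounded_const 6).mul
          (hmpoly.mul (((polyBounded_const 2).mul hpoly).add (polyBounded_const 1))))).add
          hmpoly).add (polyBounded_const 6)).mono fun n =>
            (turnsSize_senderCopies_le _ _ _ _ _).trans (by omega)
      receiver_poly :=
        ((((hmpoly.mul P.receiver_poly).add hLpoly).add
          (hmpoly.mul (((polyBounded_const 8).mul hpoly).add (polyBounded_const 5)))).add
          (polyBounded_const 7)).mono fun n => turnsSize_receiverCopies_le _ _ _ _ }
  refine ⟨P', fun b => ?_, fun A hA => ?_⟩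
  · have hbound : ∀ n, 1 - correctness (P'.sender n) (P'.receiver n) b (stdKet b) ≤
        4 * Real.exp (-(n : ℝ)) + 4 * (((m n + 1 : ℕ) : ℝ) *
          (1 - correctness (P.sender n) (P.receiver n) b (angleKet (ε n) b))) := by
      intro n
      refine (one_sub_correctness_copies_le (P.sender n) (P.receiver n) (m n) (d n) (e n) (L n)
        (hS n) (hR n) (hd n) (he n) b (hangle n b)).trans (add_le_add ?_ (le_of_eq ?_))
      · exact mul_le_mul_of_nonneg_left (one_sub_pow_le_exp (hd n) n) (by norm_num)
      · push_cast; ring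
    refine ((negligible_exp_neg.const_mul 4).add
      ((Negligible.polyBounded_mul hmpoly (hP.1 b)).const_mul 4)).mono fun n => ?_
    rw [abs_of_nonneg (sub_nonneg.2 (correctness_le_one _ _ b (stdKet_unit b)))]
    exact (hbound n).trans (le_abs_self _)
  · have hred := fun n => exists_reduction (P.sender n) (m n) (d n) (e n) (L n) (A n) (hS n)
    choose B hBsize hB using hred
    have hBpoly : PolyBounded fun n => turnsSize (B n).turns :=
      (((((hLpoly.add (polyBounded_const 3)).add hA).add hmpoly).add
        (hmpoly.mul P.sender_poly)).add hA).mono fun n =>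
          (hBsize n).trans (by have := length_le_turnsSize (A n).turns; omega)
    refine (Negligible.polyBounded_mul hmpoly (hP.2 B hBpoly)).mono fun n => ?_
    rw [abs_abs]
    refine (hB n).trans ((le_of_eq ?_).trans (le_abs_self _))
    push_cast
    rfl

theorem exists_isOSP_of_odd {c d : ℕ → ℕ} (hc : ∀ n, Odd (c n)) (hcd : ∀ n, c n ≤ d n)
    (hpoly : PolyBounded d)
    (h : ∃ P : Protocol, P.IsEpsOSP fun n => (c n : ℝ) / (d n : ℝ)) : ∃ P' : Protocol, P'.IsOSP := by
  obtain ⟨P, hP⟩ := h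
  have hd : ∀ n, 1 ≤ d n := fun n => (hc n).pos.trans_le (hcd n)
  exact exists_isOSP hd hpoly (fun n => exists_angle_zpow (hc n) (hd n)) hP

end OSP

end

/-! ### The theorem -/

theorem mainTheorem11 :
    -- constant angle
    (∀ ε : ℝ, 0 < ε → ε ≤ 1 → (∃ c d : ℤ, Odd c ∧ ε = (c : ℝ) / (d : ℝ)) →
      (∃ P : OSP.Protocol, P.IsEpsOSP (fun _ => ε)) → ∃ P' : OSP.Protocol, P'.IsOSP) ∧
    -- in particular, the angles `π / (2 m)`
    (∀ m : ℕ, 1 ≤ m →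
      (∃ P : OSP.Protocol, P.IsEpsOSP (fun _ => 1 / (m : ℝ))) → ∃ P' : OSP.Protocol, P'.IsOSP) ∧
    -- inverse-polynomial angles, depending on the security parameter
    (∀ c d : ℕ → ℕ, (∀ n, Odd (c n)) → (∀ n, c n ≤ d n) → OSP.PolyBounded d →
      (∃ P : OSP.Protocol, P.IsEpsOSP (fun n => (c n : ℝ) / (d n : ℝ))) →
        ∃ P' : OSP.Protocol, P'.IsOSP) := by
  refine ⟨?_, fun m hm h => ?_, fun c d hc hcd hd h => OSP.exists_isOSP_of_odd hc hcd hd h⟩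
  · rintro ε hε0 hε1 ⟨c, d, hc, rfl⟩ h
    have hd : (0 : ℝ) < |(d : ℝ)| := abs_pos.2 fun hd => by simp [hd] at hε0
    -- Both integers may be negative; positivity of the quotient allows absolute values, which
    -- preserve oddness of `c`.
    have hcd : (c : ℝ) / (d : ℝ) = (c.natAbs : ℝ) / (d.natAbs : ℝ) := by
      rw [← abs_of_pos hε0, abs_div, Nat.cast_natAbs, Nat.cast_natAbs, Int.cast_abs, Int.cast_abs]
    have hle : c.natAbs ≤ d.natAbs := by
      rw [← abs_of_pos hε0, abs_div, div_le_one hd] at hε1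
      have : |c| ≤ |d| := by exact_mod_cast hε1
      rw [Int.abs_eq_natAbs, Int.abs_eq_natAbs] at this
      omega
    refine OSP.exists_isOSP_of_odd (c := fun _ => c.natAbs) (d := fun _ => d.natAbs)
      (fun _ => Int.natAbs_odd.2 hc) (fun _ => hle) (OSP.polyBounded_const _) ?_
    simpa only [hcd] using h
  · refine OSP.exists_isOSP_of_odd (c := fun _ => 1) (d := fun _ => m) (fun _ => odd_one)
      (fun _ => hm) (OSP.polyBounded_const _) ?_
    simpa only [Nat.cast_one] using h
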